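/- Let $M$ be a smooth ($C^\infty$, Hausdorff) real $n$-manifold, $V\to M$ a smooth real vector bundle of rank $n$, and $\nabla$ a flat smooth connection on $V$, with dual connection $\nabla^\vee$ on $V^\vee$. Write $X=\mathrm{tot}(V)\xrightarrow{\pi}M$ and $\widehat X=\mathrm{tot}(V^\vee)\xrightarrow{\widehat\pi}M$. *Conventions.* For a vector bundle $W$, put $\langle v+f,w+g\rangle=-\tfrac12(f(w)+g(v))$ on $W\oplus W^\vee$. A generalized almost complex structure on $W$ is a smooth $\langle\,,\rangle$-orthogonal endomorphism $\mathcal J$ of $W\oplus W^\vee$ with $\mathcal J^2=-1$; on a manifold one takes $W$ to be the tangent bundle. It is integrable if the sheaf of smooth sections of its $+i$ eigenbundle in $(T\oplus T^\vee)\otimes\mathbb C$ is closed under the Courant bracket $$[Y+\xi,Z+\eta]=[Y,Z]+\mathcal L_Y\eta-\mathcal L_Z\xi+\tfrac12 d(\iota_Z\xi-\iota_Y\eta).$$ A generalized Kähler structure is a pair $(\mathcal J,\mathcal J')$ of commuting, integrable generalized almost complex structures such that $G=-\mathcal J\mathcal J'$ is positive definite, i.e. $\sigma\langle Gu,u\rangle>0$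 for all $u\neq0$. Here $\sigma\in\{1,-1\}$ is a fixed sign convention for the pairing; everything below holds for both choices. *Semi-flat structures.* Let $D:T_X\to\pi^*V$ be the vertical projection defined by $\nabla$, i.e. $D=(\pi^*\nabla)(S)$ with $S$ the tautological section of $\pi^*V$. The isomorphism $A=(D,d\pi):T_X\to\pi^*V\oplus\pi^*T_M$ induces $$F=A\oplus(A^{-1})^\vee:\ T_X\oplus T_X^\vee\to\pi^*(V\oplus T_M\oplus V^\vee\oplus T_M^\vee).$$ A generalized almost complex structure $\underline{\mathcal J}$ on $V\oplus T_M$ is adapted if $\underline{\mathcal J}(V\oplus V^\vee)=T_M\oplus T_M^\vee$. A $\nabla$-semi-flat structure on $X$ is a generalized almost complex structure of the form $F^{-1}(\pi^*\underline{\mathcal J})F$ with $\underline{\mathcal J}$ adapted; a $\nabla$-semi-flat generalized Kähler structure is a generalized Kähler structure $(\mathcal J,\mathcal J')$ on $X$ with $\mathcal J$ and $\mathcal J'$ both $\nabla$-semi-flat. The same definitions apply to $(V^\vee,\nabla^\vee)$ and $\widehat X$, with $\widehat F$ in place of $F$. For an endomorphism $\underline{\mathcal J}$ of $V\oplus T_M\oplus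 V^\vee\oplus T_M^\vee$ let $\check{\underline{\mathcal J}}$ be its conjugate by the transposition of the summands $V$ and $V^\vee$, an endomorphism of $V^\vee\oplus T_M\oplus V\oplus T_M^\vee$ (where $V^{\vee\vee}=V$). **Statement.** If $\underline{\mathcal J}$ is adapted, so is $\check{\underline{\mathcal J}}$, and $$\mathcal J=F^{-1}(\pi^*\underline{\mathcal J})F\ \longmapsto\ \widehat{\mathcal J}=\widehat F^{-1}(\widehat\pi^*\check{\underline{\mathcal J}})\widehat F$$ is a well-defined bijection from the $\nabla$-semi-flat generalized almost complex structures on $X$ to the $\nabla^\vee$-semi-flat generalized almost complex structures on $\widehat X$. For all $\nabla$-semi-flat $\mathcal J,\mathcal J'$ on $X$: 1. $\mathcal J$ is integrable if and only if $\widehat{\mathcal J}$ is integrable; 2. $\mathcal J$ and $\mathcal J'$ commute if and only if $\widehat{\mathcal J}$ and $\widehat{\mathcal J}'$ commute; 3. $-\mathcal J\mathcal J'$ is positive definite if and only if $-\widehat{\mathcal J}\widehat{\mathcal J}'$ is. Consequently $(\mathcal J,\mathcal J')\mapsto(\widehat{\mathcal J},\widehat{\mathcal J}')$ is a bijection from the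 $\nabla$-semi-flat generalized Kähler structures on $X$ to the $\nabla^\vee$-semi-flat generalized Kähler structures on $\widehat X$. -/

import Mathlib

open Bundle
open scoped Manifold ContDiff Topology

noncomputable section

namespace GenGeom

/-! ### The bundle `W ⊕ W^∨` and generalized almost complex structures on a vector bundle `W` -/

section Linear

/-- The fibre `w ⊕ w^∨`, for a finite dimensional real topological vector space `w`. -/
abbrev Gen (w : Type*) [AddCommGroup w] [Module ℝ w] [TopologicalSpace w] : Type _ :=
  w × (w →L[ℝ] ℝ)

variable {w : Type*} [AddCommGroup w] [Module ℝ w] [TopologicalSpace w]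
  [IsTopologicalAddGroup w] [ContinuousSMul ℝ w]

/-- The pairing `⟨v + f, w + g⟩ = -(1/2) (f(w) + g(v))` on `w ⊕ w^∨`. -/
def pairing (a b : Gen w) : ℝ := -(1 / 2) * (a.2 b.1 + b.2 a.1)

end Linear

section Bundles

variable {EB : Type*} [NormedAddCommGroup EB] [NormedSpace ℝ EB]
  {HB : Type*} [TopologicalSpace HB] (I : ModelWithCorners ℝ EB HB)
  {B : Type*} [TopologicalSpace B] [ChartedSpace HB B]
  (G : Type*) [NormedAddCommGroup G] [NormedSpace ℝ G]
  {W : B → Type*} [TopologicalSpace (TotalSpace G W)]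
  [∀ x, AddCommGroup (W x)] [∀ x, Module ℝ (W x)] [∀ x, TopologicalSpace (W x)]
  [∀ x, IsTopologicalAddGroup (W x)] [∀ x, ContinuousSMul ℝ (W x)]
  [FiberBundle G W] [VectorBundle ℝ G W]

/-- `s` is a smooth section of `W ⊕ W^∨` over `U`: both of its components are smooth. -/
def SmoothSectionOn (s : ∀ x, Gen (W x)) (U : Set B) : Prop :=
  ContMDiffOn I (I.prod 𝓘(ℝ, G)) ∞ (fun x => TotalSpace.mk' G x (s x).1) U ∧
  ContMDiffOn I (I.prod 𝓘(ℝ, G →L[ℝ] ℝ)) ∞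
    (fun x => (TotalSpace.mk' (G →L[ℝ] ℝ) x (s x).2 :
      TotalSpace (G →L[ℝ] ℝ) (fun x => W x →L[ℝ] ℝ))) U

/-- A generalized almost complex structure on the vector bundle `W` (with model fibre `G`):
a smooth bundle endomorphism of `W ⊕ W^∨` that is orthogonal for the pairing and squares
to `-1`. -/
structure IsGenAlmostComplex (J : ∀ x, Gen (W x) →ₗ[ℝ] Gen (W x)) : Prop where
  sq : ∀ x u, J x (J x u) = -u
  orth : ∀ x u v, pairing (J x u) (J x v) = pairing u v
  smooth : ∀ U : Set B, IsOpen U → ∀ s : ∀ x, Gen (W x),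
    SmoothSectionOn I G s U → SmoothSectionOn I G (fun x => J x (s x)) U

end Bundles

/-! ### The Courant bracket and integrability on a manifold `B` -/

section Courant

variable {EB : Type*} [NormedAddCommGroup EB] [NormedSpace ℝ EB]
  {HB : Type*} [TopologicalSpace HB] (I : ModelWithCorners ℝ EB HB)
  {B : Type*} [TopologicalSpace B] [ChartedSpace HB B]

/-- The fibre at `x` of `T_B ⊕ T_B^∨`. -/
abbrev GenTangent (x : B) : Type _ := Gen (TangentSpace I x)

/-- The one-form `ξ` in the preferred chart at `x₀`, as a one-form on the model space. -/
def oneFormInChart (ξ : ∀ x : B, TangentSpace I x →L[ℝ] ℝ) (x₀ : B) (y : EB) : EB →L[ℝ] ℝ :=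
  (ξ ((extChartAt I x₀).symm y)).comp
    (mfderivWithin 𝓘(ℝ, EB) I (extChartAt I x₀).symm (Set.range I) y)

/-- The exterior derivative of a one-form at `x₀`, contracted with `u`: the one-form
`v ↦ dξ (u, v)`, computed in the preferred chart at `x₀` from
`dω (a, b) = (D_a ω) b - (D_b ω) a`. -/
def contractExtDeriv (ξ : ∀ x : B, TangentSpace I x →L[ℝ] ℝ) (x₀ : B) (u : TangentSpace I x₀) :
    TangentSpace I x₀ →L[ℝ] ℝ :=
  let Dω : EB →L[ℝ] EB →L[ℝ] ℝ :=
    fderivWithin ℝ (oneFormInChart I ξ x₀) (Set.range I) (extChartAt I x₀ x₀)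
  let dφ : TangentSpace I x₀ →L[ℝ] EB := mfderiv I 𝓘(ℝ, EB) (extChartAt I x₀) x₀
  (Dω (dφ u) - Dω.flip (dφ u)).comp dφ

/-- The Lie derivative `L_X η = ι_X dη + d (ι_X η)` of a one-form. -/
def lieDerivOneForm (X : ∀ x : B, TangentSpace I x) (η : ∀ x : B, TangentSpace I x →L[ℝ] ℝ)
    (x : B) : TangentSpace I x →L[ℝ] ℝ :=
  contractExtDeriv I η x (X x) + mvfderiv I (fun y => η y (X y)) x

/-- The Courant bracket of two sections of `T_B ⊕ T_B^∨`:
`[X + ξ, Y + η] = [X, Y] + L_X η - L_Y ξ + (1/2) d (ι_Y ξ - ι_X η)`. -/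
def courant (s t : ∀ x : B, GenTangent I x) (x : B) : GenTangent I x :=
  (VectorField.mlieBracket I (fun y => (s y).1) (fun y => (t y).1) x,
    lieDerivOneForm I (fun y => (s y).1) (fun y => (t y).2) x
      - lieDerivOneForm I (fun y => (t y).1) (fun y => (s y).2) x
      + (1 / 2 : ℝ) • mvfderiv I (fun y => (s y).2 (t y).1 - (t y).2 (s y).1) x)

/-- The fibre at `x` of `(T_B ⊕ T_B^∨) ⊗ ℂ`; the pair `(a, b)` stands for `a + i b`. -/
abbrev GenTangentC (x : B) : Type _ := GenTangent I x × GenTangent I x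

/-- The complex bilinear extension of the Courant bracket,
`[a + i b, c + i d] = [a, c] - [b, d] + i ([a, d] + [b, c])`. -/
def courantC (s t : ∀ x : B, GenTangentC I x) (x : B) : GenTangentC I x :=
  (courant I (fun y => (s y).1) (fun y => (t y).1) x
      - courant I (fun y => (s y).2) (fun y => (t y).2) x,
    courant I (fun y => (s y).1) (fun y => (t y).2) x
      + courant I (fun y => (s y).2) (fun y => (t y).1) x)

/-- The `+i` eigenspace `E_x` of `J` in the complexified fibre: `J (a + i b) = i (a + i b)`, that
is `J a = -b` and `J b = a`. -/
def plusEigenspace (J : ∀ x : B, GenTangent I x →ₗ[ℝ] GenTangent I x) (x : B) :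
    Set (GenTangentC I x) :=
  {z | J x z.1 = -z.2 ∧ J x z.2 = z.1}

/-- `J` is integrable: the sheaf of smooth sections of its `+i` eigenbundle is closed under the
Courant bracket. -/
def Integrable [IsManifold I 1 B] (J : ∀ x : B, GenTangent I x →ₗ[ℝ] GenTangent I x) : Prop :=
  ∀ U : Set B, IsOpen U → ∀ s t : ∀ x : B, GenTangentC I x,
    SmoothSectionOn I EB (fun x => (s x).1) U → SmoothSectionOn I EB (fun x => (s x).2) U →
    SmoothSectionOn I EB (fun x => (t x).1) U → SmoothSectionOn I EB (fun x => (t x).2) U →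
    (∀ x ∈ U, s x ∈ plusEigenspace I J x) → (∀ x ∈ U, t x ∈ plusEigenspace I J x) →
    ∀ x ∈ U, courantC I s t x ∈ plusEigenspace I J x

/-- The two structures commute. -/
def Commutes (J J' : ∀ x : B, GenTangent I x →ₗ[ℝ] GenTangent I x) : Prop :=
  ∀ x u, J x (J' x u) = J' x (J x u)

/-- `G = -J J'` is positive definite for the pairing `σ ⟨ , ⟩`. Here `σ = 1` and `σ = -1` are the
two sign conventions for the standard pairing of `T_B ⊕ T_B^∨`. -/
def PositiveProduct (σ : ℤˣ) (J J' : ∀ x : B, GenTangent I x →ₗ[ℝ] GenTangent I x) : Prop :=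
  ∀ x u, u ≠ 0 → 0 < ((σ : ℤ) : ℝ) * pairing (-(J x (J' x u))) u

/-- `(J, J')` is a generalized Kähler structure on `B`: a commuting pair of integrable generalized
almost complex structures such that `-J J'` is positive definite. -/
structure IsGenKahler [IsManifold I 1 B] (σ : ℤˣ)
    (J J' : ∀ x : B, GenTangent I x →ₗ[ℝ] GenTangent I x) : Prop where
  left : IsGenAlmostComplex I EB J
  right : IsGenAlmostComplex I EB J'
  commutes : Commutes I J J'
  positive : PositiveProduct I σ J J'
  integrable_left : Integrable I J
  integrable_right : Integrable I J'

end Courant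

/-! ### Connections -/

section Connection

variable {E : Type*} [NormedAddCommGroup E] [NormedSpace ℝ E] [FiniteDimensional ℝ E]
  {F : Type*} [NormedAddCommGroup F] [NormedSpace ℝ F] [FiniteDimensional ℝ F]
  {M : Type*} [TopologicalSpace M] [ChartedSpace E M] [IsManifold 𝓘(ℝ, E) ∞ M]
  {V : M → Type*} [TopologicalSpace (TotalSpace F V)]
  [∀ x, AddCommGroup (V x)] [∀ x, Module ℝ (V x)] [∀ x, TopologicalSpace (V x)]
  [∀ x, IsTopologicalAddGroup (V x)] [∀ x, ContinuousSMul ℝ (V x)]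
  [FiberBundle F V] [VectorBundle ℝ F V] [ContMDiffVectorBundle ∞ F V 𝓘(ℝ, E)]

/-- The connection is flat: `∇_X ∇_Y σ - ∇_Y ∇_X σ - ∇_[X, Y] σ = 0` for all smooth vector
fields `X`, `Y` and smooth sections `σ` over an open set. -/
def IsFlat (cov : CovariantDerivative 𝓘(ℝ, E) F V) : Prop :=
  ∀ U : Set M, IsOpen U →
  ∀ (X Y : ∀ x : M, TangentSpace 𝓘(ℝ, E) x) (σ : ∀ x, V x),
    ContMDiffOn 𝓘(ℝ, E) (𝓘(ℝ, E).prod 𝓘(ℝ, E)) ∞ (fun x => TotalSpace.mk' E x (X x)) U →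
    ContMDiffOn 𝓘(ℝ, E) (𝓘(ℝ, E).prod 𝓘(ℝ, E)) ∞ (fun x => TotalSpace.mk' E x (Y x)) U →
    ContMDiffOn 𝓘(ℝ, E) (𝓘(ℝ, E).prod 𝓘(ℝ, F)) ∞ (fun x => TotalSpace.mk' F x (σ x)) U →
    ∀ x ∈ U,
      cov (fun y => cov σ y (Y y)) x (X x) - cov (fun y => cov σ y (X y)) x (Y x)
        - cov σ x (VectorField.mlieBracket 𝓘(ℝ, E) X Y x) = 0

/-- The dual bundle `V^∨`. -/
abbrev DualBundle {M : Type*} (V : M → Type*) [∀ x, AddCommGroup (V x)] [∀ x, Module ℝ (V x)]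
    [∀ x, TopologicalSpace (V x)] : M → Type _ := fun x => V x →L[ℝ] ℝ

theorem mdiffAt_dual_apply {f : ∀ x, DualBundle V x} {σ : ∀ x, V x} {x : M}
    (hf : MDifferentiableAt 𝓘(ℝ, E) (𝓘(ℝ, E).prod 𝓘(ℝ, F →L[ℝ] ℝ))
      (fun y => (TotalSpace.mk' (F →L[ℝ] ℝ) y (f y) :
        TotalSpace (F →L[ℝ] ℝ) (DualBundle V))) x)
    (hσ : MDifferentiableAt 𝓘(ℝ, E) (𝓘(ℝ, E).prod 𝓘(ℝ, F))
      (fun y => TotalSpace.mk' F y (σ y)) x) :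
    MDifferentiableAt 𝓘(ℝ, E) 𝓘(ℝ, ℝ) (fun y => f y (σ y)) x := by
  have h := MDifferentiableAt.clm_bundle_apply (E₂ := Bundle.Trivial M ℝ) (b := fun y => y)
    (ϕ := f) hf hσ
  exact ((mdifferentiableAt_totalSpace ..).1 h).2

/-- The one-form `u ↦ u (f (σ)) - f (∇_u σ)` at `x`. -/
def dualConnAux (cov : CovariantDerivative 𝓘(ℝ, E) F V) (f : ∀ x, DualBundle V x) (x : M)
    (σ : ∀ x, V x) : TangentSpace 𝓘(ℝ, E) x →L[ℝ] ℝ :=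
  mvfderiv 𝓘(ℝ, E) (fun y => f y (σ y)) x - (f x).comp (cov σ x)

theorem tensorialAt_dualConnAux (cov : CovariantDerivative 𝓘(ℝ, E) F V)
    {f : ∀ x, DualBundle V x} {x : M}
    (hf : MDifferentiableAt 𝓘(ℝ, E) (𝓘(ℝ, E).prod 𝓘(ℝ, F →L[ℝ] ℝ))
      (fun y => (TotalSpace.mk' (F →L[ℝ] ℝ) y (f y) :
        TotalSpace (F →L[ℝ] ℝ) (DualBundle V))) x) :
    TensorialAt 𝓘(ℝ, E) F (dualConnAux cov f x) x where
  smul {g σ} hg hσ := by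
    have h := mdiffAt_dual_apply hf hσ
    have e : (fun y => f y ((g • σ) y)) = fun y => g y * f y (σ y) := by
      ext y; simp
    ext u
    simp only [dualConnAux, e]
    rw [mvfderiv_fun_mul hg h, cov.isCovariantDerivativeOn.leibniz hσ hg]
    simp
    ring
  add {σ τ} hσ hτ := by
    have h := mdiffAt_dual_apply hf hσ
    have h' := mdiffAt_dual_apply hf hτ
    have e : (fun y => f y ((σ + τ) y)) = fun y => f y (σ y) + f y (τ y) := by
      ext y; simp
    ext u
    simp only [dualConnAux, e]
    rw [mvfderiv_fun_add h h', cov.isCovariantDerivativeOn.add hσ hτ]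
    simp
    ring

open scoped Classical in
/-- The value of the dual connection: `(∇^∨_u f) (v) = u (f (σ)) - f (∇_u σ)`, where `σ` is any
section of `V` differentiable at `x` with `σ x = v` (here the extension of `v` that is constant in
the preferred trivialization; by tensoriality the choice is irrelevant). If `f` is not
differentiable at `x`, the value is zero. -/
def dualConnFun (cov : CovariantDerivative 𝓘(ℝ, E) F V) (f : ∀ x, DualBundle V x) (x : M) :
    TangentSpace 𝓘(ℝ, E) x →L[ℝ] DualBundle V x :=
  if hf : MDifferentiableAt 𝓘(ℝ, E) (𝓘(ℝ, E).prod 𝓘(ℝ, F →L[ℝ] ℝ))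
      (fun y => (TotalSpace.mk' (F →L[ℝ] ℝ) y (f y) :
        TotalSpace (F →L[ℝ] ℝ) (DualBundle V))) x then
    haveI : T2Space (V x) := FiberBundle.t2Space F V x
    haveI : FiniteDimensional ℝ (V x) := VectorBundle.finiteDimensional ℝ F V x
    haveI : FiniteDimensional ℝ (TangentSpace 𝓘(ℝ, E) x) := inferInstanceAs (FiniteDimensional ℝ E)
    haveI : T2Space (TangentSpace 𝓘(ℝ, E) x) := inferInstanceAs (T2Space E)
    LinearMap.toContinuousLinearMap
      { toFun u := LinearMap.toContinuousLinearMap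
          { toFun v := TensorialAt.mkHom (dualConnAux cov f x) x (tensorialAt_dualConnAux cov hf) v u
            map_add' := by intros; simp
            map_smul' := by intros; simp }
        map_add' := by intros; ext; simp
        map_smul' := by intros; ext; simp }
  else 0

theorem dualConnFun_apply (cov : CovariantDerivative 𝓘(ℝ, E) F V)
    {f : ∀ x, DualBundle V x} {σ : ∀ x, V x} {x : M}
    (hf : MDifferentiableAt 𝓘(ℝ, E) (𝓘(ℝ, E).prod 𝓘(ℝ, F →L[ℝ] ℝ))
      (fun y => (TotalSpace.mk' (F →L[ℝ] ℝ) y (f y) :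
        TotalSpace (F →L[ℝ] ℝ) (DualBundle V))) x)
    (hσ : MDifferentiableAt 𝓘(ℝ, E) (𝓘(ℝ, E).prod 𝓘(ℝ, F))
      (fun y => TotalSpace.mk' F y (σ y)) x) (u : TangentSpace 𝓘(ℝ, E) x) :
    dualConnFun cov f x u (σ x) =
      mvfderiv 𝓘(ℝ, E) (fun y => f y (σ y)) x u - f x (cov σ x u) := by
  have := TensorialAt.mkHom_apply (Φ := dualConnAux cov f x) (tensorialAt_dualConnAux cov hf) hσ
  simp only [dualConnFun, dif_pos hf]
  exact DFunLike.congr_fun this u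

/-- The dual connection `∇^∨` on `V^∨`. -/
def dualConn (cov : CovariantDerivative 𝓘(ℝ, E) F V) :
    CovariantDerivative 𝓘(ℝ, E) (F →L[ℝ] ℝ) (DualBundle V) where
  toFun := dualConnFun cov
  isCovariantDerivativeOnUniv :=
    { add := by
        intro f g x hf hg _
        ext u v
        have hσ := FiberBundle.mdifferentiableAt_extend 𝓘(ℝ, E) F v
        have hfg := mdifferentiableAt_add_section hf hg
        have h1 := dualConnFun_apply cov hfg hσ u
        have h2 := dualConnFun_apply cov hf hσ u
        have h3 := dualConnFun_apply cov hg hσ u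
        have e : (fun y => (f + g) y (FiberBundle.extend F v y)) =
            fun y => f y (FiberBundle.extend F v y) + g y (FiberBundle.extend F v y) := by
          ext y; simp
        rw [FiberBundle.extend_apply_self] at h1 h2 h3
        erw [h1]
        erw [e, mvfderiv_fun_add (mdiffAt_dual_apply hf hσ) (mdiffAt_dual_apply hg hσ)]
        simp only [add_apply, Pi.add_apply]
        rw [h2, h3]
        ring
      leibniz := by
        intro f g x hf hg _
        ext u v
        have hσ := FiberBundle.mdifferentiableAt_extend 𝓘(ℝ, E) F v
        have hfg := hg.smul_section hf
        have h1 := dualConnFun_apply cov hfg hσ u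
        have h2 := dualConnFun_apply cov hf hσ u
        have e : (fun y => (g • f) y (FiberBundle.extend F v y)) =
            fun y => g y * f y (FiberBundle.extend F v y) := by
          ext y; simp
        rw [FiberBundle.extend_apply_self] at h1 h2
        erw [h1]
        erw [e, mvfderiv_fun_mul hg (mdiffAt_dual_apply hf hσ)]
        simp
        rw [h2]
        ring }

/-! ### The splitting of the tangent sequence of `X = tot V` -/

/-- The vertical projection `D : T_X → π^* V` at the point `p` of `X = tot V`. In the frame `e_i`
with fibre coordinates `ξ_i` given by the preferred trivialization it is
`D = π^{-1} e_i ⊗ dξ_i + ξ_i π^* (∇ e_i)`. -/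
def vertProj (cov : CovariantDerivative 𝓘(ℝ, E) F V) (p : TotalSpace F V) :
    TangentSpace (𝓘(ℝ, E).prod 𝓘(ℝ, F)) p →L[ℝ] V p.proj :=
  let e := trivializationAt F V p.proj
  (e.symmL ℝ p.proj).comp
      (mvfderiv (𝓘(ℝ, E).prod 𝓘(ℝ, F)) (fun q : TotalSpace F V => (e q).2) p)
    + (cov (fun y => e.symm y (e p).2) p.proj).comp
      (mfderiv (𝓘(ℝ, E).prod 𝓘(ℝ, F)) 𝓘(ℝ, E) (fun q : TotalSpace F V => q.proj) p)

/-- The map `(D, dπ) : T_X → π^* V ⊕ π^* T_M` at `p`. -/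
def splitMap (cov : CovariantDerivative 𝓘(ℝ, E) F V) (p : TotalSpace F V) :
    TangentSpace (𝓘(ℝ, E).prod 𝓘(ℝ, F)) p →L[ℝ] V p.proj × TangentSpace 𝓘(ℝ, E) p.proj :=
  (vertProj cov p).prod
    (mfderiv (𝓘(ℝ, E).prod 𝓘(ℝ, F)) 𝓘(ℝ, E) (fun q : TotalSpace F V => q.proj) p)

theorem splitMap_bijective (cov : CovariantDerivative 𝓘(ℝ, E) F V) (p : TotalSpace F V) :
    Function.Bijective (splitMap cov p) := by
  have hn : (∞ : WithTop ℕ∞) ≠ 0 := by simp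
  have : FiniteDimensional ℝ (V p.proj) := VectorBundle.finiteDimensional ℝ F V p.proj
  have : FiniteDimensional ℝ (TangentSpace 𝓘(ℝ, E) p.proj) :=
    inferInstanceAs (FiniteDimensional ℝ E)
  have : FiniteDimensional ℝ (TangentSpace (𝓘(ℝ, E).prod 𝓘(ℝ, F)) p) :=
    inferInstanceAs (FiniteDimensional ℝ (E × F))
  set e := trivializationAt F V p.proj with he
  have hp : p.proj ∈ e.baseSet := FiberBundle.mem_baseSet_trivializationAt' p.proj
  have hps : p ∈ e.source := e.mem_source.2 hp
  have hmd : e.toOpenPartialHomeomorph.MDifferentiable (𝓘(ℝ, E).prod 𝓘(ℝ, F))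
      (𝓘(ℝ, E).prod 𝓘(ℝ, F)) :=
    ⟨(Bundle.Trivialization.contMDiffOn (n := ∞) (IB := 𝓘(ℝ, E)) e).mdifferentiableOn hn,
     (Bundle.Trivialization.contMDiffOn_symm (n := ∞) (IB := 𝓘(ℝ, E)) e).mdifferentiableOn hn⟩
  have hinj : Function.Injective (splitMap cov p) := by
    rw [injective_iff_map_eq_zero]
    intro v hv
    obtain ⟨hD, hπ⟩ := Prod.ext_iff.1 hv
    have hD' : vertProj cov p v = 0 := hD
    have hπ' : mfderiv (𝓘(ℝ, E).prod 𝓘(ℝ, F)) 𝓘(ℝ, E)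
      (fun q : TotalSpace F V => q.proj) p v = 0 := hπ
    have hed : MDifferentiableAt (𝓘(ℝ, E).prod 𝓘(ℝ, F)) (𝓘(ℝ, E).prod 𝓘(ℝ, F)) e p :=
      hmd.mdifferentiableAt hps
    have hξ : MDifferentiableAt (𝓘(ℝ, E).prod 𝓘(ℝ, F)) 𝓘(ℝ, F)
      (fun q : TotalSpace F V => (e q).2) p := hed.snd
    have hpd : MDifferentiableAt (𝓘(ℝ, E).prod 𝓘(ℝ, F)) 𝓘(ℝ, E)
      (fun q : TotalSpace F V => q.proj) p :=
      (contMDiffAt_proj (n := ∞) (IB := 𝓘(ℝ, E)) V).mdifferentiableAt hn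
    have hξ0 : mvfderiv (𝓘(ℝ, E).prod 𝓘(ℝ, F)) (fun q : TotalSpace F V => (e q).2) p v = 0 := by
      simp only [vertProj, ← he, add_apply, ContinuousLinearMap.comp_apply, hπ',
        map_zero, add_zero] at hD'
      have := congrArg (e.continuousLinearMapAt ℝ p.proj) hD'
      rwa [map_zero, e.continuousLinearMapAt_symmL hp] at this
    have hev : (e : TotalSpace F V → M × F) =ᶠ[𝓝 p] fun q => (q.proj, (e q).2) := by
      filter_upwards [e.open_source.mem_nhds hps] with q hq
      exact Prod.ext (e.coe_fst hq) rfl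
    apply hmd.mfderiv_injective hps
    rw [map_zero]
    have h1 := hev.mfderiv_eq (I := 𝓘(ℝ, E).prod 𝓘(ℝ, F)) (I' := 𝓘(ℝ, E).prod 𝓘(ℝ, F))
    rw [mfderiv_prodMk hpd hξ] at h1
    refine (DFunLike.congr_fun h1 v).trans ?_
    exact Prod.ext hπ' hξ0
  have hfin : Module.finrank ℝ (TangentSpace (𝓘(ℝ, E).prod 𝓘(ℝ, F)) p) =
      Module.finrank ℝ (V p.proj × TangentSpace 𝓘(ℝ, E) p.proj) := by
    have h1 : Module.finrank ℝ (V p.proj) = Module.finrank ℝ F :=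
      (VectorBundle.continuousLinearEquivAt ℝ F V p.proj).toLinearEquiv.finrank_eq
    have h2 : Module.finrank ℝ (TangentSpace (𝓘(ℝ, E).prod 𝓘(ℝ, F)) p) =
      Module.finrank ℝ (E × F) := rfl
    have h3 : Module.finrank ℝ (TangentSpace 𝓘(ℝ, E) p.proj) = Module.finrank ℝ E := rfl
    rw [Module.finrank_prod, h1, h2, h3, Module.finrank_prod, add_comm]
  exact ⟨hinj, (LinearMap.injective_iff_surjective_of_finrank_eq_finrank hfin
    (f := (splitMap cov p).toLinearMap)).1 hinj⟩

/-- The isomorphism `(D, dπ) : T_X → π^* V ⊕ π^* T_M` at `p`; its inverse is `(j, α)`, where `j` is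
the inclusion of the vertical tangent vectors and `α` the horizontal lift. -/
def splitEquiv (cov : CovariantDerivative 𝓘(ℝ, E) F V) (p : TotalSpace F V) :
    TangentSpace (𝓘(ℝ, E).prod 𝓘(ℝ, F)) p ≃L[ℝ] V p.proj × TangentSpace 𝓘(ℝ, E) p.proj :=
  haveI : T2Space (V p.proj) := FiberBundle.t2Space F V p.proj
  haveI : T2Space (TangentSpace 𝓘(ℝ, E) p.proj) := inferInstanceAs (T2Space E)
  haveI : T2Space (TangentSpace (𝓘(ℝ, E).prod 𝓘(ℝ, F)) p) := inferInstanceAs (T2Space (E × F))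
  haveI : FiniteDimensional ℝ (TangentSpace (𝓘(ℝ, E).prod 𝓘(ℝ, F)) p) :=
    inferInstanceAs (FiniteDimensional ℝ (E × F))
  (LinearEquiv.ofBijective (splitMap cov p).toLinearMap (splitMap_bijective cov p))
    |>.toContinuousLinearEquiv

/-- The isomorphism induced by a linear isomorphism `w ≃ w'` from `w ⊕ w^∨` to `w' ⊕ w'^∨`. -/
def genMap {w w' : Type*} [AddCommGroup w] [Module ℝ w] [TopologicalSpace w]
    [IsTopologicalAddGroup w] [ContinuousSMul ℝ w]
    [AddCommGroup w'] [Module ℝ w'] [TopologicalSpace w']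
    [IsTopologicalAddGroup w'] [ContinuousSMul ℝ w'] (A : w ≃L[ℝ] w') : Gen w ≃ₗ[ℝ] Gen w' where
  toFun u := (A u.1, u.2.comp (A.symm : w' →L[ℝ] w))
  invFun u := (A.symm u.1, u.2.comp (A : w →L[ℝ] w'))
  map_add' _ _ := by simp
  map_smul' _ _ := by simp
  left_inv u := by ext <;> simp
  right_inv u := by ext <;> simp

/-- The pull back to `X = tot V`, through `F = ((D, dπ), ((D, dπ)⁻¹)^∨)`, of an endomorphism `K` of
`V ⊕ T_M ⊕ V^∨ ⊕ T_M^∨`: `F⁻¹ (π^* K) F`. -/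
def lift (cov : CovariantDerivative 𝓘(ℝ, E) F V)
    (K : ∀ x : M, Gen (V x × TangentSpace 𝓘(ℝ, E) x) →ₗ[ℝ] Gen (V x × TangentSpace 𝓘(ℝ, E) x))
    (p : TotalSpace F V) :
    GenTangent (𝓘(ℝ, E).prod 𝓘(ℝ, F)) p →ₗ[ℝ] GenTangent (𝓘(ℝ, E).prod 𝓘(ℝ, F)) p :=
  (genMap (splitEquiv cov p)).symm.toLinearMap ∘ₗ K p.proj ∘ₗ
    (genMap (splitEquiv cov p)).toLinearMap

end Connection

/-! ### The transposition of `V` and `V^∨` -/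

section Swap

variable {v : Type*} [AddCommGroup v] [Module ℝ v] [TopologicalSpace v]
  [IsTopologicalAddGroup v] [ContinuousSMul ℝ v]
  {t : Type*} [AddCommGroup t] [Module ℝ t] [TopologicalSpace t]
  [IsTopologicalAddGroup t] [ContinuousSMul ℝ t]

/-- The canonical map `v → v^∨^∨`. -/
def evalDual (a : v) : (v →L[ℝ] ℝ) →L[ℝ] ℝ where
  toFun f := f a
  map_add' _ _ := rfl
  map_smul' _ _ := rfl
  cont := continuous_eval_const a

/-- The transposition `v ⊕ t ⊕ v^∨ ⊕ t^∨ → v^∨ ⊕ t ⊕ v^∨^∨ ⊕ t^∨`,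
`(a, b, f, g) ↦ (f, b, a, g)`; a functional on `v × t` is identified with the pair of its
restrictions `(f, g)`, and `a` is viewed in `v^∨^∨`. -/
def transposeMap : Gen (v × t) →ₗ[ℝ] Gen ((v →L[ℝ] ℝ) × t) where
  toFun u := ((u.2.comp (ContinuousLinearMap.inl ℝ v t), u.1.2),
    (evalDual u.1.1).coprod (u.2.comp (ContinuousLinearMap.inr ℝ v t)))
  map_add' a b := by
    ext x <;> simp [evalDual]
  map_smul' c a := by
    ext x <;> simp [evalDual]

theorem transposeMap_bijective [T2Space v] [FiniteDimensional ℝ v] :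
    Function.Bijective (transposeMap (v := v) (t := t)) := by
  constructor
  · rw [injective_iff_map_eq_zero]
    rintro ⟨⟨a, b⟩, φ⟩ h
    have h1 : φ.comp (ContinuousLinearMap.inl ℝ v t) = 0 := congrArg (fun z => z.1.1) h
    have h2 : b = 0 := congrArg (fun z => z.1.2) h
    have h3 : (evalDual a).coprod (φ.comp (ContinuousLinearMap.inr ℝ v t)) = 0 :=
      congrArg (fun z => z.2) h
    have ha : a = 0 := by
      rw [← Module.forall_dual_apply_eq_zero_iff ℝ]
      intro f
      have := DFunLike.congr_fun h3 (LinearMap.toContinuousLinearMap f, 0)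
      have h0 : φ ((0 : v), (0 : t)) = 0 := map_zero φ
      simpa [evalDual, h0] using this
    have hφ : φ = 0 := by
      ext x
      · simpa using DFunLike.congr_fun h1 x
      · simpa using DFunLike.congr_fun h3 (0, x)
    simp [ha, h2, hφ]
  · rintro ⟨⟨f, b⟩, ψ⟩
    let a : v := (Module.evalEquiv ℝ v).symm
      ((ψ.comp (ContinuousLinearMap.inl ℝ (v →L[ℝ] ℝ) t)).toLinearMap ∘ₗ
        (LinearMap.toContinuousLinearMap : (v →ₗ[ℝ] ℝ) ≃ₗ[ℝ] (v →L[ℝ] ℝ)).toLinearMap)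
    have ha : ∀ g : v →L[ℝ] ℝ, g a = ψ (g, 0) := by
      intro g
      have := Module.apply_evalEquiv_symm_apply (R := ℝ) (M := v) g.toLinearMap
        ((ψ.comp (ContinuousLinearMap.inl ℝ (v →L[ℝ] ℝ) t)).toLinearMap ∘ₗ
          (LinearMap.toContinuousLinearMap : (v →ₗ[ℝ] ℝ) ≃ₗ[ℝ] (v →L[ℝ] ℝ)).toLinearMap)
      exact this
    refine ⟨((a, b), f.coprod (ψ.comp (ContinuousLinearMap.inr ℝ (v →L[ℝ] ℝ) t))), ?_⟩
    refine Prod.ext (Prod.ext ?_ rfl) ?_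
    · ext x; simp [transposeMap]
    · ext x
      · simp [transposeMap, evalDual, ha]
      · simp [transposeMap]

/-- `transposeMap` as a linear isomorphism. -/
def transpose [T2Space v] [FiniteDimensional ℝ v] : Gen (v × t) ≃ₗ[ℝ] Gen ((v →L[ℝ] ℝ) × t) :=
  LinearEquiv.ofBijective transposeMap transposeMap_bijective

/-- The subspace `v ⊕ v^∨` of `v ⊕ t ⊕ v^∨ ⊕ t^∨`. -/
def leftPart : Submodule ℝ (Gen (v × t)) where
  carrier := {u | u.1.2 = 0 ∧ u.2.comp (ContinuousLinearMap.inr ℝ v t) = 0}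
  add_mem' := by
    rintro a b ⟨h1, h2⟩ ⟨h3, h4⟩
    exact ⟨by simp [h1, h3], by simp [ContinuousLinearMap.add_comp, h2, h4]⟩
  zero_mem' := ⟨rfl, by simp⟩
  smul_mem' := by
    rintro c a ⟨h1, h2⟩
    exact ⟨by simp [h1], by simp [ContinuousLinearMap.smul_comp, h2]⟩

/-- The subspace `t ⊕ t^∨` of `v ⊕ t ⊕ v^∨ ⊕ t^∨`. -/
def rightPart : Submodule ℝ (Gen (v × t)) where
  carrier := {u | u.1.1 = 0 ∧ u.2.comp (ContinuousLinearMap.inl ℝ v t) = 0}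
  add_mem' := by
    rintro a b ⟨h1, h2⟩ ⟨h3, h4⟩
    exact ⟨by simp [h1, h3], by simp [ContinuousLinearMap.add_comp, h2, h4]⟩
  zero_mem' := ⟨rfl, by simp⟩
  smul_mem' := by
    rintro c a ⟨h1, h2⟩
    exact ⟨by simp [h1], by simp [ContinuousLinearMap.smul_comp, h2]⟩

end Swap

/-! ### Semi-flat structures and the mirror correspondence -/

section SemiFlat

variable {E : Type*} [NormedAddCommGroup E] [NormedSpace ℝ E] [FiniteDimensional ℝ E]
  {F : Type*} [NormedAddCommGroup F] [NormedSpace ℝ F] [FiniteDimensional ℝ F]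
  {M : Type*} [TopologicalSpace M] [ChartedSpace E M] [IsManifold 𝓘(ℝ, E) ∞ M]
  {V : M → Type*} [TopologicalSpace (TotalSpace F V)]
  [∀ x, AddCommGroup (V x)] [∀ x, Module ℝ (V x)] [∀ x, TopologicalSpace (V x)]
  [∀ x, IsTopologicalAddGroup (V x)] [∀ x, ContinuousSMul ℝ (V x)]
  [FiberBundle F V] [VectorBundle ℝ F V] [ContMDiffVectorBundle ∞ F V 𝓘(ℝ, E)]

/-- `K` is an adapted generalized almost complex structure on `V ⊕ T_M`, that is
`K (V ⊕ V^∨) = T_M ⊕ T_M^∨`. -/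
structure IsAdapted (F : Type*) [NormedAddCommGroup F] [NormedSpace ℝ F]
    {V : M → Type*} [TopologicalSpace (TotalSpace F V)]
    [∀ x, AddCommGroup (V x)] [∀ x, Module ℝ (V x)] [∀ x, TopologicalSpace (V x)]
    [∀ x, IsTopologicalAddGroup (V x)] [∀ x, ContinuousSMul ℝ (V x)]
    [FiberBundle F V] [VectorBundle ℝ F V]
    (K : ∀ x : M, Gen (V x × TangentSpace 𝓘(ℝ, E) x) →ₗ[ℝ] Gen (V x × TangentSpace 𝓘(ℝ, E) x)) :
    Prop where
  isGenAlmostComplex :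
    IsGenAlmostComplex (W := V ×ᵇ (TangentSpace 𝓘(ℝ, E) : M → Type _)) 𝓘(ℝ, E) (F × E) K
  map_left : ∀ x, Submodule.map (K x) leftPart = rightPart

/-- The `∇`-semi-flat generalized almost complex structures on `X = tot V`: `∇` is flat and `J` is
the lift `F⁻¹ (π^* K) F` of an adapted generalized almost complex structure `K` on `V ⊕ T_M`. -/
structure IsSemiFlat (cov : CovariantDerivative 𝓘(ℝ, E) F V)
    (J : ∀ p : TotalSpace F V,
      GenTangent (𝓘(ℝ, E).prod 𝓘(ℝ, F)) p →ₗ[ℝ] GenTangent (𝓘(ℝ, E).prod 𝓘(ℝ, F)) p) : Prop where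
  flat : IsFlat cov
  isGenAlmostComplex : IsGenAlmostComplex (𝓘(ℝ, E).prod 𝓘(ℝ, F)) (E × F) J
  exists_lift : ∃ K, IsAdapted F K ∧ J = lift cov K

/-- The type of `∇`-semi-flat generalized almost complex structures on `tot V`. -/
def SemiFlat (cov : CovariantDerivative 𝓘(ℝ, E) F V) : Type _ := {J // IsSemiFlat cov J}

/-- The type of `∇`-semi-flat generalized Kähler structures on `tot V`: the generalized Kähler pairs
consisting of two `∇`-semi-flat structures. -/
def SemiFlatKahler (σ : ℤˣ) (cov : CovariantDerivative 𝓘(ℝ, E) F V) : Type _ :=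
  {P : SemiFlat cov × SemiFlat cov // IsGenKahler (𝓘(ℝ, E).prod 𝓘(ℝ, F)) σ P.1.1 P.2.1}

/-- The fibrewise dual of an endomorphism `K` of `V ⊕ T_M ⊕ V^∨ ⊕ T_M^∨`: its conjugate by the
transposition of `V` and `V^∨`, an endomorphism of `V^∨ ⊕ T_M ⊕ V ⊕ T_M^∨`. -/
def mirror (F : Type*) [NormedAddCommGroup F] [NormedSpace ℝ F] [FiniteDimensional ℝ F]
    {V : M → Type*} [TopologicalSpace (TotalSpace F V)]
    [∀ x, AddCommGroup (V x)] [∀ x, Module ℝ (V x)] [∀ x, TopologicalSpace (V x)]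
    [∀ x, IsTopologicalAddGroup (V x)] [∀ x, ContinuousSMul ℝ (V x)]
    [FiberBundle F V] [VectorBundle ℝ F V]
    (K : ∀ x : M, Gen (V x × TangentSpace 𝓘(ℝ, E) x) →ₗ[ℝ] Gen (V x × TangentSpace 𝓘(ℝ, E) x))
    (x : M) : Gen (DualBundle V x × TangentSpace 𝓘(ℝ, E) x) →ₗ[ℝ]
      Gen (DualBundle V x × TangentSpace 𝓘(ℝ, E) x) :=
  haveI : T2Space (V x) := FiberBundle.t2Space F V x
  haveI : FiniteDimensional ℝ (V x) := VectorBundle.finiteDimensional ℝ F V x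
  transpose.toLinearMap ∘ₗ K x ∘ₗ transpose.symm.toLinearMap

end SemiFlat

end GenGeom

end

/-!
In a chart of `M` and a trivialization of `V`, the isomorphism `F` is a constant splitting followed
by the shear `(ẏ, ξ̇) ↦ (ξ̇ + A(ẏ) ξ, ẏ)`, where `A` is the connection matrix and `ξ` the fibre
coordinate. Integrability of `J` is the vanishing of the tensor
`N(a, b, c) = ⟨[Ja, Jb] - J[Ja, b] - J[a, Jb] - [a, b], c⟩`, and in coordinates `N` depends only on
`J` and on cyclic sums of its derivative. Conjugating by the shear adds to that derivative the
commutator of `J` with a skew operator built from the derivative of `A(ẏ) ξ`; because `∇` is flat,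
this operator has the same cyclic sums as the action of `A` on `V ⊕ V^∨`. Hence `N` is the pullback
of a tensor on `V ⊕ T_M ⊕ V^∨ ⊕ T_M^∨` made of `K`, its derivative and the action of `A`, with no
dependence on `ξ`. The transposition of `V` and `V^∨` is an isometry intertwining the actions of `∇`
and `∇^∨`, so it matches these tensors for `K` and its fibrewise dual. Commutation and positivity
are conditions on each fibre, and a fibrewise isometry preserves them.
-/

noncomputable section

namespace GenGeom

section Pairing

variable {w : Type*} [AddCommGroup w] [Module ℝ w] [TopologicalSpace w]

theorem pairing_comm (a b : Gen w) : pairing a b = pairing b a := by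
  simp only [pairing, add_comm]

theorem pairing_add_left (a a' b : Gen w) : pairing (a + a') b = pairing a b + pairing a' b := by
  simp only [pairing, Prod.fst_add, Prod.snd_add, add_apply, map_add]
  ring

theorem pairing_neg_left (a b : Gen w) : pairing (-a) b = -pairing a b := by
  simp only [pairing, Prod.fst_neg, Prod.snd_neg, neg_apply, map_neg]
  ring

theorem pairing_neg_right (a b : Gen w) : pairing a (-b) = -pairing a b := by
  rw [pairing_comm, pairing_neg_left, pairing_comm]

theorem pairing_sub_left (a a' b : Gen w) : pairing (a - a') b = pairing a b - pairing a' b := by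
  rw [sub_eq_add_neg, pairing_add_left, pairing_neg_left, sub_eq_add_neg]

theorem eq_zero_of_pairing_eq_zero [SeparatingDual ℝ w] {a : Gen w} (h : ∀ b, pairing a b = 0) :
    a = 0 := by
  refine Prod.ext ?_ ?_
  · by_contra hne
    obtain ⟨f, hf⟩ := SeparatingDual.exists_ne_zero (R := ℝ) hne
    exact hf (by simpa [pairing] using h (0, f))
  · ext v
    simpa [pairing] using h (v, 0)

theorem pairing_skew_of_orthogonal {j : Gen w → Gen w} (hsq : ∀ u, j (j u) = -u)
    (horth : ∀ u v, pairing (j u) (j v) = pairing u v) (a b : Gen w) :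
    pairing (j a) b = -pairing a (j b) := by
  rw [← horth a (j b), hsq, pairing_neg_right, neg_neg]

theorem pairing_genMap [IsTopologicalAddGroup w] [ContinuousSMul ℝ w] {w' : Type*}
    [AddCommGroup w'] [Module ℝ w'] [TopologicalSpace w'] [IsTopologicalAddGroup w']
    [ContinuousSMul ℝ w'] (A : w ≃L[ℝ] w') (a b : Gen w) :
    pairing (genMap A a) (genMap A b) = pairing a b := by
  simp [pairing, genMap]

end Pairing

section NijenhuisForm

variable {w : Type*} [AddCommGroup w] [Module ℝ w] [TopologicalSpace w]

/-- The sum of a ternary form over the cyclic permutations of its arguments. -/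
def cyclicSum {U : Type*} (f : U → U → U → ℝ) (a b c : U) : ℝ := f a b c + f b c a + f c a b

/-- The Nijenhuis form of an endomorphism `k` of `w ⊕ w^∨`, where `D a` stands for the derivative of
`k` in the direction of the anchor of `a`. On a manifold, and for the ordinary derivative in a
chart, it is the Nijenhuis tensor of `k` for the Courant bracket; on `V ⊕ T_M` the derivative is
covariant on the summands `V` and `V^∨`. -/
def nijenhuisForm (k : Gen w → Gen w) (D : Gen w → Gen w → Gen w) : Gen w → Gen w → Gen w → ℝ :=
  cyclicSum fun a b c => pairing (D (k a) (k b) - D a b) c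

theorem nijenhuisForm_map {w' : Type*} [AddCommGroup w'] [Module ℝ w'] [TopologicalSpace w']
    {k : Gen w → Gen w} {D : Gen w → Gen w → Gen w}
    {k' : Gen w' → Gen w'} {D' : Gen w' → Gen w' → Gen w'} {T : Gen w → Gen w'}
    (hT : ∀ a b, pairing (T a) (T b) = pairing a b) (hk : ∀ a, k' (T a) = T (k a))
    (hD : ∀ a b, D' (T a) (T b) = T (D a b)) (a b c : Gen w) :
    nijenhuisForm k' D' (T a) (T b) (T c) = nijenhuisForm k D a b c := by
  simp only [nijenhuisForm, cyclicSum, hk, hD, pairing_sub_left, hT]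

/-- The derivative of `k` for the connection that differs from the one underlying `D` by the
one-form `θ`. -/
def twist (k : Gen w → Gen w) (D θ : Gen w → Gen w → Gen w) (a b : Gen w) : Gen w :=
  D a b + (θ a (k b) - k (θ a b))

theorem nijenhuisForm_twist {k : Gen w → Gen w} (hsq : ∀ u, k (k u) = -u)
    (hk : ∀ a b, pairing (k a) b = -pairing a (k b)) (D : Gen w → Gen w → Gen w)
    {θ : Gen w → Gen w → Gen w} (hθ : ∀ a b c, pairing (θ a b) c = -pairing b (θ a c))
    (a b c : Gen w) :
    let T := cyclicSum fun a b c => pairing (θ a b) c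
    nijenhuisForm k (twist k D θ) a b c = nijenhuisForm k D a b c +
      (T (k a) (k b) (k c) - T (k a) b c - T a (k b) c - T a b (k c)) := by
  have hθsq (a b c : Gen w) : pairing (θ a (k (k b))) c = -pairing (θ a b) c := by
    rw [hθ, hsq, pairing_neg_left, hθ a b c]
  simp only [nijenhuisForm, twist, cyclicSum, pairing_add_left, pairing_sub_left, hk, hθsq]
  ring

/-- The Nijenhuis form sees a connection only through the totally antisymmetric part of its
connection form. -/
theorem nijenhuisForm_twist_congr {k : Gen w → Gen w} (hsq : ∀ u, k (k u) = -u)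
    (hk : ∀ a b, pairing (k a) b = -pairing a (k b)) (D : Gen w → Gen w → Gen w)
    {θ θ' : Gen w → Gen w → Gen w} (hθ : ∀ a b c, pairing (θ a b) c = -pairing b (θ a c))
    (hθ' : ∀ a b c, pairing (θ' a b) c = -pairing b (θ' a c))
    (h : ∀ a b c, cyclicSum (fun a b c => pairing (θ a b) c) a b c =
      cyclicSum (fun a b c => pairing (θ' a b) c) a b c) (a b c : Gen w) :
    nijenhuisForm k (twist k D θ) a b c = nijenhuisForm k (twist k D θ') a b c := by
  rw [nijenhuisForm_twist hsq hk D hθ, nijenhuisForm_twist hsq hk D hθ']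
  simp only [h]

end NijenhuisForm

section CourantJet

variable {W : Type*} [NormedAddCommGroup W] [NormedSpace ℝ W]

-- Shortcuts without which instance search on the products behind `Gen` times out.
scoped instance : NormedAddCommGroup (Gen W) := inferInstance
scoped instance : NormedSpace ℝ (Gen W) := inferInstance
scoped instance : AddCommGroup (Gen W →L[ℝ] ℝ) := inferInstance
scoped instance : AddCommGroup (Gen W →L[ℝ] Gen W) := inferInstance
scoped instance : NormedSpace ℝ (Gen W →L[ℝ] Gen W) := inferInstance

/-- `pairing` as a continuous bilinear form. -/
def pairingForm : Gen W →L[ℝ] Gen W →L[ℝ] ℝ :=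
  let B := (ContinuousLinearMap.id ℝ (W →L[ℝ] ℝ)).bilinearComp
    (ContinuousLinearMap.snd ℝ W (W →L[ℝ] ℝ)) (ContinuousLinearMap.fst ℝ W (W →L[ℝ] ℝ));
  -(1 / 2 : ℝ) • (B + B.flip)

@[simp]
theorem pairingForm_apply (a b : Gen W) : pairingForm a b = pairing a b := rfl

/-- The Courant bracket at a point of a vector space, as a function of the one-jets `(a, A)` and
`(b, B)` of the two sections. -/
def courantJet (a : Gen W) (A : W →L[ℝ] Gen W) (b : Gen W) (B : W →L[ℝ] Gen W) : Gen W :=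
  B a.1 - A b.1 + (0, (pairingForm a).comp B - (pairingForm b).comp A)

theorem pairing_courantJet (a : Gen W) (A : W →L[ℝ] Gen W) (b : Gen W) (B : W →L[ℝ] Gen W)
    (c : Gen W) :
    pairing (courantJet a A b B) c = pairing (B a.1) c - pairing (A b.1) c
      + 1 / 2 * pairing (A c.1) b - 1 / 2 * pairing (B c.1) a := by
  have h : pairing ((0 : W), (pairingForm a).comp B - (pairingForm b).comp A) c =
      1 / 2 * pairing (A c.1) b - 1 / 2 * pairing (B c.1) a := by
    simp only [pairing_comm (A c.1), pairing_comm (B c.1)]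
    simp only [pairing, sub_apply, ContinuousLinearMap.comp_apply, pairingForm_apply, map_zero]
    ring
  rw [courantJet, pairing_add_left, pairing_sub_left, h]
  ring

theorem courantJet_neg_left (a : Gen W) (A : W →L[ℝ] Gen W) (b : Gen W) (B : W →L[ℝ] Gen W) :
    courantJet (-a) (-A) b B = -courantJet a A b B := by
  simp only [courantJet, Prod.fst_neg, map_neg, neg_apply, ContinuousLinearMap.neg_comp,
    ContinuousLinearMap.comp_neg, neg_add, Prod.neg_mk, neg_zero, neg_sub]
  congr 1
  · abel
  · congr 1
    abel

theorem courantJet_neg_right (a : Gen W) (A : W →L[ℝ] Gen W) (b : Gen W) (B : W →L[ℝ] Gen W) :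
    courantJet a A (-b) (-B) = -courantJet a A b B := by
  simp only [courantJet, Prod.fst_neg, map_neg, neg_apply, ContinuousLinearMap.neg_comp,
    ContinuousLinearMap.comp_neg, neg_add, Prod.neg_mk, neg_zero, neg_sub]
  congr 1
  · abel
  · congr 1
    abel

/-- The derivative of `j s` in terms of the one-jet `(a, A)` of `s`. -/
def applyJet (j : Gen W →L[ℝ] Gen W) (Dj : W →L[ℝ] Gen W →L[ℝ] Gen W) (a : Gen W)
    (A : W →L[ℝ] Gen W) : W →L[ℝ] Gen W := Dj.flip a + j.comp A

/-- The Nijenhuis torsion `j ([s, t] - [j s, j t]) - [s, j t] - [j s, t]`, in terms of the one-jets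
`(a, A)` and `(b, B)` of `s` and `t`. -/
def nijenhuisJet (j : Gen W →L[ℝ] Gen W) (Dj : W →L[ℝ] Gen W →L[ℝ] Gen W)
    (a : Gen W) (A : W →L[ℝ] Gen W) (b : Gen W) (B : W →L[ℝ] Gen W) : Gen W :=
  j (courantJet a A b B - courantJet (j a) (applyJet j Dj a A) (j b) (applyJet j Dj b B))
    - courantJet a A (j b) (applyJet j Dj b B) - courantJet (j a) (applyJet j Dj a A) b B

variable {j : Gen W →L[ℝ] Gen W} {Dj : W →L[ℝ] Gen W →L[ℝ] Gen W}

/-- The derivatives of `s` and `t` cancel: the torsion is tensorial. -/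
theorem pairing_nijenhuisJet (hsq : ∀ u, j (j u) = -u)
    (hj : ∀ a b, pairing (j a) b = -pairing a (j b))
    (hDj : ∀ v a b, pairing (Dj v a) b = -pairing a (Dj v b))
    (hanti : ∀ v a, Dj v (j a) = -j (Dj v a))
    (a : Gen W) (A : W →L[ℝ] Gen W) (b : Gen W) (B : W →L[ℝ] Gen W) (c : Gen W) :
    pairing (nijenhuisJet j Dj a A b B) c = nijenhuisForm j (fun a => Dj a.1) a b c := by
  have hcomm (v : W) (x y : Gen W) : pairing (Dj v (j x)) y = pairing (Dj v x) (j y) := by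
    rw [hanti, pairing_neg_left, hj, neg_neg]
  have hswap (v : W) (x y : Gen W) : pairing (Dj v x) y = -pairing (Dj v y) x := by
    rw [hDj, pairing_comm]
  simp only [nijenhuisJet, pairing_sub_left, hj, pairing_courantJet, applyJet, add_apply,
    ContinuousLinearMap.comp_apply, ContinuousLinearMap.flip_apply, pairing_add_left,
    nijenhuisForm, cyclicSum, hsq, pairing_neg_right, hcomm]
  rw [hswap b.1 c a, hswap (j b).1 c (j a), hcomm (j b).1 a c, hswap c.1 b a,
    hswap (j c).1 b (j a), hcomm (j c).1 a b]
  ring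

theorem nijenhuisJet_eq_zero_iff (hsq : ∀ u, j (j u) = -u)
    (hj : ∀ a b, pairing (j a) b = -pairing a (j b))
    (hDj : ∀ v a b, pairing (Dj v a) b = -pairing a (Dj v b))
    (hanti : ∀ v a, Dj v (j a) = -j (Dj v a))
    (a : Gen W) (A : W →L[ℝ] Gen W) (b : Gen W) (B : W →L[ℝ] Gen W) :
    nijenhuisJet j Dj a A b B = 0 ↔ ∀ c, nijenhuisForm j (fun a => Dj a.1) a b c = 0 := by
  simp only [← pairing_nijenhuisJet hsq hj hDj hanti a A b B]
  exact ⟨fun h c => by simp [h, pairing], eq_zero_of_pairing_eq_zero⟩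

end CourantJet

section Calculus

variable {X : Type*} [NormedAddCommGroup X] [NormedSpace ℝ X]
  {W : Type*} [NormedAddCommGroup W] [NormedSpace ℝ W]

theorem hasFDerivAt_pairing {f g : X → Gen W} {f' g' : X →L[ℝ] Gen W} {x : X}
    (hf : HasFDerivAt f f' x) (hg : HasFDerivAt g g' x) :
    HasFDerivAt (fun y => pairing (f y) (g y))
      ((pairingForm (f x)).comp g' + (pairingForm (g x)).comp f') x := by
  refine (pairingForm.hasFDerivAt_of_bilinear hf hg).congr_fderiv ?_
  ext v
  simp [pairing_comm (f' v)]

variable {j : X → Gen W →L[ℝ] Gen W} {Dj : X →L[ℝ] Gen W →L[ℝ] Gen W} {x : X}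

theorem pairing_skew_of_hasFDerivAt (hj : HasFDerivAt j Dj x)
    (hskew : ∀ᶠ y in 𝓝 x, ∀ a b, pairing (j y a) b = -pairing a (j y b))
    (v : X) (a b : Gen W) : pairing (Dj v a) b = -pairing a (Dj v b) := by
  have hleft := hasFDerivAt_pairing (hj.clm_apply (hasFDerivAt_const a x)) (hasFDerivAt_const b x)
  have hright := (hasFDerivAt_pairing (hasFDerivAt_const a x)
    (hj.clm_apply (hasFDerivAt_const b x))).neg
  have heq := hleft.unique (hright.congr_of_eventuallyEq (hskew.mono fun y hy => hy a b))
  simpa [pairing_comm b] using DFunLike.congr_fun heq v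

theorem anticommute_of_hasFDerivAt (hj : HasFDerivAt j Dj x)
    (hsq : ∀ᶠ y in 𝓝 x, ∀ a, j y (j y a) = -a)
    (v : X) (a : Gen W) : Dj v (j x a) = -j x (Dj v a) := by
  have hsq' := (hasFDerivAt_const (𝕜 := ℝ) (-a) x).congr_of_eventuallyEq (hsq.mono fun y hy => hy a)
  have heq := (hj.clm_apply (hj.clm_apply (hasFDerivAt_const a x))).unique hsq'
  exact eq_neg_of_add_eq_zero_right (by simpa using DFunLike.congr_fun heq v)

end Calculus

section Shear

variable {W : Type*} [NormedAddCommGroup W] [NormedSpace ℝ W]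
  {E : Type*} [NormedAddCommGroup E] [NormedSpace ℝ E]
  {F : Type*} [NormedAddCommGroup F] [NormedSpace ℝ F]

scoped instance : NormedAddCommGroup (Gen (F × E)) := inferInstance
scoped instance : NormedSpace ℝ (Gen (F × E)) := inferInstance
scoped instance : AddCommGroup (E →L[ℝ] F →L[ℝ] F) := inferInstance
scoped instance : NormedAddCommGroup (E →L[ℝ] F →L[ℝ] F) := inferInstance
scoped instance : SeminormedAddCommGroup (E →L[ℝ] F →L[ℝ] F) := inferInstance
scoped instance : NormedSpace ℝ (E →L[ℝ] F →L[ℝ] F) := inferInstance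
scoped instance : NormedAddCommGroup (F →L[ℝ] E →L[ℝ] F) := inferInstance

/-- The infinitesimal version of `genMap`: the derivative at `g = 0` of the action of `1 + g` on
`b`. -/
def genAct (b : Gen W) : (W →L[ℝ] W) →L[ℝ] Gen W :=
  (ContinuousLinearMap.apply ℝ W b.1).prod (-ContinuousLinearMap.compL ℝ W W ℝ b.2)

theorem genAct_apply (b : Gen W) (g : W →L[ℝ] W) : genAct b g = (g b.1, -b.2.comp g) := rfl

theorem pairing_genAct (b : Gen W) (g : W →L[ℝ] W) (c : Gen W) :
    pairing (genAct b g) c = -(1 / 2) * (c.2 (g b.1) - b.2 (g c.1)) := by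
  simp only [pairing, genAct_apply, neg_apply, ContinuousLinearMap.comp_apply]
  ring

theorem pairing_genAct_skew (g : W →L[ℝ] W) (b c : Gen W) :
    pairing (genAct b g) c = -pairing b (genAct c g) := by
  rw [pairing_comm b, pairing_genAct, pairing_genAct]
  ring

/-- The isomorphism `(u, η) ↦ (η + C u, u)`. In coordinates it is the splitting `(D, dπ)` of the
tangent space of `tot V`, with `C u = A u ξ` for the connection form `A` and the fibre
coordinate `ξ`. -/
def shear (C : E →L[ℝ] F) : (E × F) ≃L[ℝ] (F × E) where
  toFun v := (v.2 + C v.1, v.1)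
  invFun z := (z.2, z.1 - C z.2)
  map_add' _ _ := by ext <;> simp; abel
  map_smul' _ _ := by ext <;> simp
  left_inv _ := by ext <;> simp
  right_inv _ := by ext <;> simp
  continuous_toFun := by fun_prop
  continuous_invFun := by fun_prop

@[simp]
theorem shear_apply (C : E →L[ℝ] F) (v : E × F) : shear C v = (v.2 + C v.1, v.1) := rfl

@[simp]
theorem shear_symm_apply (C : E →L[ℝ] F) (z : F × E) :
    (shear C).symm z = (z.2, z.1 - C z.2) := rfl

/-- The nilpotent endomorphism `(x, u) ↦ (C u, 0)`, as a linear function of `C`. -/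
def nilpotentPart : (E →L[ℝ] F) →L[ℝ] (F × E →L[ℝ] F × E) :=
  (ContinuousLinearMap.compL ℝ (F × E) F (F × E) (ContinuousLinearMap.inl ℝ F E)).comp
    ((ContinuousLinearMap.compL ℝ (F × E) E F).flip (ContinuousLinearMap.snd ℝ F E))

@[simp]
theorem nilpotentPart_apply (C : E →L[ℝ] F) (z : F × E) : nilpotentPart C z = (C z.2, 0) := rfl

theorem genMap_shear (C C₀ : E →L[ℝ] F) (b : Gen (E × F)) :
    genMap (shear C) b =
      genAct (genMap (shear C₀) b) (nilpotentPart (C - C₀)) + genMap (shear C₀) b := by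
  refine Prod.ext (Prod.ext ?_ ?_) (ContinuousLinearMap.ext fun z => ?_)
  · simp only [genMap, genAct_apply, LinearEquiv.coe_mk, LinearMap.coe_mk, AddHom.coe_mk,
      shear_apply, nilpotentPart_apply, Prod.fst_add, sub_apply]
    abel
  · simp [genMap, genAct_apply]
  · have hz : (shear C).symm z =
        (shear C₀).symm z - (shear C₀).symm (nilpotentPart (C - C₀) z) := by
      simp
    simp only [genMap, LinearEquiv.coe_mk, LinearMap.coe_mk, AddHom.coe_mk, genAct_apply,
      Prod.snd_add, add_apply, neg_apply, ContinuousLinearMap.comp_apply,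
      ContinuousLinearEquiv.coe_coe, hz, map_sub b.2]
    ring

theorem hasFDerivAt_genMap_shear {X : Type*} [NormedAddCommGroup X] [NormedSpace ℝ X]
    {C : X → E →L[ℝ] F} {C' : X →L[ℝ] E →L[ℝ] F} {x : X} (hC : HasFDerivAt C C' x)
    (b : Gen (E × F)) :
    HasFDerivAt (fun y => genMap (shear (C y)) b)
      (((genAct (genMap (shear (C x)) b)).comp nilpotentPart).comp C') x := by
  rw [show (fun y => genMap (shear (C y)) b) = _ from funext fun y => genMap_shear (C y) (C x) b]
  exact (((genAct (genMap (shear (C x)) b)).comp nilpotentPart).hasFDerivAt.comp x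
    (hC.sub_const (C x))).add_const _

end Shear

section ShearConjugate

variable {X : Type*} [NormedAddCommGroup X] [NormedSpace ℝ X]
  {E : Type*} [NormedAddCommGroup E] [NormedSpace ℝ E]
  {F : Type*} [NormedAddCommGroup F] [NormedSpace ℝ F]

/-- Differentiating `P j = k P`, where `P` acts by the isometries `genMap (shear C)`, adds to the
derivative of `k` its commutator with the logarithmic derivative of `P`. -/
theorem genMap_shear_hasFDerivAt_conj {C : X → E →L[ℝ] F} {C' : X →L[ℝ] E →L[ℝ] F}
    {k : X → Gen (F × E) →L[ℝ] Gen (F × E)} {Dk : X →L[ℝ] Gen (F × E) →L[ℝ] Gen (F × E)}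
    {j : X → Gen (E × F) →L[ℝ] Gen (E × F)} {Dj : X →L[ℝ] Gen (E × F) →L[ℝ] Gen (E × F)} {x : X}
    (hC : HasFDerivAt C C' x) (hk : HasFDerivAt k Dk x) (hj : HasFDerivAt j Dj x)
    (hjk : ∀ᶠ y in 𝓝 x, ∀ b, genMap (shear (C y)) (j y b) = k y (genMap (shear (C y)) b))
    (v : X) (b : Gen (E × F)) :
    genMap (shear (C x)) (Dj v b) = Dk v (genMap (shear (C x)) b)
      + (k x (genAct (genMap (shear (C x)) b) (nilpotentPart (C' v)))
        - genAct (k x (genMap (shear (C x)) b)) (nilpotentPart (C' v))) := by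
  have hP := hasFDerivAt_genMap_shear hC
  rw [← sub_eq_zero]
  refine eq_zero_of_pairing_eq_zero fun c' => ?_
  obtain ⟨c, rfl⟩ := (genMap (shear (C x))).surjective c'
  have hconj := hasFDerivAt_pairing (hk.clm_apply (hP b)) (hP c)
  have hdirect := hasFDerivAt_pairing (hj.clm_apply (hasFDerivAt_const b x))
    (hasFDerivAt_const c x)
  have heq := hdirect.unique (hconj.congr_of_eventuallyEq (hjk.mono fun y hy => by
    simp only [← hy, pairing_genMap]))
  have hv : pairing (Dj v b) c =
      pairing (k x (genMap (shear (C x)) b)) (genAct (genMap (shear (C x)) c)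
        (nilpotentPart (C' v))) +
      (pairing (k x (genAct (genMap (shear (C x)) b) (nilpotentPart (C' v))))
        (genMap (shear (C x)) c) +
      pairing (Dk v (genMap (shear (C x)) b)) (genMap (shear (C x)) c)) := by
    simpa [pairing_comm c, pairing_comm (genMap (shear (C x)) c)] using DFunLike.congr_fun heq v
  simp only [pairing_sub_left, pairing_add_left, pairing_genMap, hv,
    pairing_genAct_skew _ (k x (genMap (shear (C x)) b))]
  ring

theorem nijenhuisForm_of_genMap_shear_conj {C : E × F → E →L[ℝ] F}
    {C' : (E × F) →L[ℝ] E →L[ℝ] F}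
    {k : E × F → Gen (F × E) →L[ℝ] Gen (F × E)}
    {Dk : (E × F) →L[ℝ] Gen (F × E) →L[ℝ] Gen (F × E)}
    {j : E × F → Gen (E × F) →L[ℝ] Gen (E × F)}
    {Dj : (E × F) →L[ℝ] Gen (E × F) →L[ℝ] Gen (E × F)} {x : E × F}
    (hC : HasFDerivAt C C' x) (hk : HasFDerivAt k Dk x) (hj : HasFDerivAt j Dj x)
    (hjk : ∀ᶠ y in 𝓝 x, ∀ b, genMap (shear (C y)) (j y b) = k y (genMap (shear (C y)) b))
    (a b c : Gen (E × F)) :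
    nijenhuisForm (j x) (fun a => Dj a.1) a b c =
      nijenhuisForm (k x) (twist (k x) (fun a => Dk ((shear (C x)).symm a.1))
        fun a b => genAct b (nilpotentPart (-C' ((shear (C x)).symm a.1))))
        (genMap (shear (C x)) a) (genMap (shear (C x)) b) (genMap (shear (C x)) c) := by
  refine (nijenhuisForm_map (fun _ _ => pairing_genMap _ _ _)
    (fun a => (hjk.self_of_nhds a).symm) (fun a b => ?_) a b c).symm
  have ha : (shear (C x)).symm (genMap (shear (C x)) a).1 = a.1 :=
    (shear (C x)).symm_apply_apply a.1
  rw [twist, ha, genMap_shear_hasFDerivAt_conj hC hk hj hjk]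
  simp only [map_neg]
  abel

end ShearConjugate

section FlatConnection

variable {E : Type*} [NormedAddCommGroup E] [NormedSpace ℝ E]
  {F : Type*} [NormedAddCommGroup F] [NormedSpace ℝ F]

/-- The action of the connection form `A` of `V` on `V ⊕ T_M ⊕ V^∨ ⊕ T_M^∨`, trivial on `T_M` and
`T_M^∨`, along the anchor of `a`. -/
def connAct (A : E →L[ℝ] F →L[ℝ] F) (a b : Gen (F × E)) : Gen (F × E) :=
  genAct b ((A a.1.2).prodMap 0)

theorem pairing_connAct_skew (A : E →L[ℝ] F →L[ℝ] F) (a b c : Gen (F × E)) :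
    pairing (connAct A a b) c = -pairing b (connAct A a c) :=
  pairing_genAct_skew _ b c

/-- The Nijenhuis form of an endomorphism `k` of `V ⊕ T_M ⊕ V^∨ ⊕ T_M^∨` with derivative `Dk`, for
the connection on `V` with connection form `A`. -/
def baseNijenhuisForm (A : E →L[ℝ] F →L[ℝ] F) (k : Gen (F × E) → Gen (F × E))
    (Dk : E → Gen (F × E) → Gen (F × E)) : Gen (F × E) → Gen (F × E) → Gen (F × E) → ℝ :=
  nijenhuisForm k (twist k (fun a => Dk a.1.2) (connAct A))

/-- For a flat connection, the derivative of the shear along itself and the connection form have the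
same totally antisymmetric part. -/
theorem cyclicSum_shear_eq_cyclicSum_connAct {A : E →L[ℝ] F →L[ℝ] F}
    {DA : E →L[ℝ] E →L[ℝ] F →L[ℝ] F}
    (hflat : ∀ u v x, DA u v x - DA v u x + A u (A v x) - A v (A u x) = 0) (ξ : F)
    (a b c : Gen (F × E)) :
    cyclicSum (fun a b c => pairing (genAct b (nilpotentPart
      (-((DA a.1.2).flip ξ + A.flip (a.1.1 - A a.1.2 ξ))))) c) a b c =
    cyclicSum (fun a b c => pairing (connAct A a b) c) a b c := by
  have hsplit (f : (F × E) →L[ℝ] ℝ) (x : F) : f (x, 0) = f.comp (.inl ℝ F E) x := rfl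
  have hcurv (f : (F × E) →L[ℝ] ℝ) (u v : E) : f.comp (.inl ℝ F E)
      (DA u v ξ - DA v u ξ + A u (A v ξ) - A v (A u ξ)) = 0 := by
    rw [hflat, map_zero]
  have hconn (b : Gen (F × E)) (L : F →L[ℝ] F) : L.prodMap (0 : E →L[ℝ] E) b.1 = (L b.1.1, 0) := rfl
  simp only [map_add, map_sub] at hcurv
  simp only [cyclicSum, connAct, pairing_genAct, nilpotentPart_apply, hconn, hsplit, neg_apply,
    add_apply, ContinuousLinearMap.flip_apply]
  simp only [map_neg, map_add, map_sub]
  linear_combination (1 / 2) * (hcurv c.2 a.1.2 b.1.2) + (1 / 2) * (hcurv a.2 b.1.2 c.1.2)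
    + (1 / 2) * (hcurv b.2 c.1.2 a.1.2)

theorem nijenhuisForm_twist_shear {A : E →L[ℝ] F →L[ℝ] F} {DA : E →L[ℝ] E →L[ℝ] F →L[ℝ] F}
    {k : Gen (F × E) → Gen (F × E)} (hsq : ∀ u, k (k u) = -u)
    (hskew : ∀ a b, pairing (k a) b = -pairing a (k b))
    (hflat : ∀ u v x, DA u v x - DA v u x + A u (A v x) - A v (A u x) = 0)
    (Dk : E → Gen (F × E) → Gen (F × E)) (ξ : F) (a b c : Gen (F × E)) :
    nijenhuisForm k (twist k (fun a => Dk a.1.2) fun a b => genAct b (nilpotentPart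
      (-((DA a.1.2).flip ξ + A.flip (a.1.1 - A a.1.2 ξ))))) a b c =
    baseNijenhuisForm A k Dk a b c := by
  rw [baseNijenhuisForm, nijenhuisForm_twist_congr hsq hskew _ ?_ (pairing_connAct_skew A)
    (cyclicSum_shear_eq_cyclicSum_connAct hflat ξ)]
  intro a b c
  exact pairing_genAct_skew _ b c

theorem exists_hasFDerivAt_flip_apply {A : E → E →L[ℝ] F →L[ℝ] F}
    {DA : E →L[ℝ] E →L[ℝ] F →L[ℝ] F} {y : E} (hA : HasFDerivAt A DA y) (ξ : F) :
    ∃ C' : (E × F) →L[ℝ] E →L[ℝ] F,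
      HasFDerivAt (fun w : E × F => (A w.1).flip w.2) C' (y, ξ) ∧
      ∀ v, C' v = (DA v.1).flip ξ + (A y).flip v.2 := by
  have hAfst : HasFDerivAt (fun w : E × F => A w.1) (DA.comp (.fst ℝ E F)) (y, ξ) :=
    HasFDerivAt.comp (y, ξ) hA hasFDerivAt_fst
  let flipForm : (E →L[ℝ] F →L[ℝ] F) →L[ℝ] (F →L[ℝ] E →L[ℝ] F) :=
    (ContinuousLinearMap.flipₗᵢ ℝ E F F).toContinuousLinearEquiv
  refine ⟨_, flipForm.hasFDerivAt_of_bilinear hAfst (hasFDerivAt_snd (𝕜 := ℝ) (p := (y, ξ))),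
    fun v => ?_⟩
  ext u
  simp [flipForm, add_comm]

theorem nijenhuisForm_eq_baseNijenhuisForm {A : E → E →L[ℝ] F →L[ℝ] F}
    {DA : E →L[ℝ] E →L[ℝ] F →L[ℝ] F} {k : E → Gen (F × E) →L[ℝ] Gen (F × E)}
    {Dk : E →L[ℝ] Gen (F × E) →L[ℝ] Gen (F × E)}
    {j : E × F → Gen (E × F) →L[ℝ] Gen (E × F)}
    {Dj : (E × F) →L[ℝ] Gen (E × F) →L[ℝ] Gen (E × F)} {y : E} {ξ : F}
    (hA : HasFDerivAt A DA y) (hk : HasFDerivAt k Dk y) (hj : HasFDerivAt j Dj (y, ξ))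
    (hjk : ∀ᶠ w in 𝓝 (y, ξ), ∀ b, genMap (shear ((A w.1).flip w.2)) (j w b) =
      k w.1 (genMap (shear ((A w.1).flip w.2)) b))
    (hsq : ∀ u, k y (k y u) = -u) (hskew : ∀ a b, pairing (k y a) b = -pairing a (k y b))
    (hflat : ∀ u v x, DA u v x - DA v u x + A y u (A y v x) - A y v (A y u x) = 0)
    (a b c : Gen (E × F)) :
    nijenhuisForm (j (y, ξ)) (fun a => Dj a.1) a b c =
      baseNijenhuisForm (A y) (k y) (fun u => Dk u) (genMap (shear ((A y).flip ξ)) a)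
        (genMap (shear ((A y).flip ξ)) b) (genMap (shear ((A y).flip ξ)) c) := by
  have hkfst : HasFDerivAt (fun w : E × F => k w.1) (Dk.comp (.fst ℝ E F)) (y, ξ) :=
    HasFDerivAt.comp (y, ξ) hk hasFDerivAt_fst
  obtain ⟨C', hC', hC'_apply⟩ := exists_hasFDerivAt_flip_apply hA ξ
  refine (nijenhuisForm_of_genMap_shear_conj hC' hkfst hj hjk a b c).trans ?_
  have hDk (a : Gen (F × E)) : Dk.comp (.fst ℝ E F) ((shear ((A y).flip ξ)).symm a.1) = Dk a.1.2 :=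
    rfl
  simp only [hDk, hC'_apply]
  exact nijenhuisForm_twist_shear hsq hskew hflat (fun u => Dk u) ξ _ _ _

end FlatConnection

section Transpose

section

variable {v : Type*} [AddCommGroup v] [Module ℝ v] [TopologicalSpace v]
  [ContinuousSMul ℝ v]
  {t : Type*} [AddCommGroup t] [Module ℝ t] [TopologicalSpace t]

theorem pairing_transposeMap (a b : Gen (v × t)) :
    pairing (transposeMap a) (transposeMap b) = pairing a b := by
  have hsplit (f : (v × t) →L[ℝ] ℝ) (z : v × t) : f z = f (z.1, 0) + f (0, z.2) := by
    rw [← map_add, Prod.fst_add_snd]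
  rw [pairing, pairing, hsplit a.2 b.1, hsplit b.2 a.1]
  simp only [transposeMap, evalDual, LinearMap.coe_mk, AddHom.coe_mk,
    ContinuousLinearMap.coprod_apply, ContinuousLinearMap.coe_mk', ContinuousLinearMap.comp_apply,
    ContinuousLinearMap.inl_apply, ContinuousLinearMap.inr_apply]
  ring

end

variable {E : Type*} [NormedAddCommGroup E] [NormedSpace ℝ E]
  {F : Type*} [NormedAddCommGroup F] [NormedSpace ℝ F]

theorem connAct_transposeMap {A : E →L[ℝ] F →L[ℝ] F}
    {A' : E →L[ℝ] (F →L[ℝ] ℝ) →L[ℝ] (F →L[ℝ] ℝ)} (hA : ∀ u f x, A' u f x = -f (A u x))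
    (a b : Gen (F × E)) :
    connAct A' (transposeMap a) (transposeMap b) = transposeMap (connAct A a b) := by
  refine Prod.ext (Prod.ext (ContinuousLinearMap.ext fun x => ?_) rfl)
    (ContinuousLinearMap.ext fun z => ?_)
  · simp [connAct, genAct_apply, transposeMap, hA]
  · have h0 (f : (F × E) →L[ℝ] ℝ) : f (0, 0) = 0 := map_zero f
    simp [connAct, genAct_apply, transposeMap, evalDual, hA, h0]

theorem baseNijenhuisForm_transposeMap {A : E →L[ℝ] F →L[ℝ] F}
    {A' : E →L[ℝ] (F →L[ℝ] ℝ) →L[ℝ] (F →L[ℝ] ℝ)} (hA : ∀ u f x, A' u f x = -f (A u x))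
    {k : Gen (F × E) → Gen (F × E)} {Dk : E → Gen (F × E) → Gen (F × E)}
    {k' : Gen ((F →L[ℝ] ℝ) × E) →ₗ[ℝ] Gen ((F →L[ℝ] ℝ) × E)}
    {Dk' : E → Gen ((F →L[ℝ] ℝ) × E) → Gen ((F →L[ℝ] ℝ) × E)}
    (hk : ∀ z, k' (transposeMap z) = transposeMap (k z))
    (hDk : ∀ u z, Dk' u (transposeMap z) = transposeMap (Dk u z)) (a b c : Gen (F × E)) :
    baseNijenhuisForm A' k' Dk' (transposeMap a) (transposeMap b) (transposeMap c) =
      baseNijenhuisForm A k Dk a b c := by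
  refine nijenhuisForm_map pairing_transposeMap hk (fun a b => ?_) a b c
  have hu : (transposeMap a).1.2 = a.1.2 := rfl
  simp only [twist, hk, hu, hDk, connAct_transposeMap hA, map_add, map_sub]

end Transpose

theorem baseSet_trivializationAt_mem_nhds {B : Type*} [TopologicalSpace B] {G : Type*}
    [TopologicalSpace G] {W : B → Type*} [TopologicalSpace (TotalSpace G W)]
    [∀ x, TopologicalSpace (W x)] [FiberBundle G W] (x : B) :
    (trivializationAt G W x).baseSet ∈ 𝓝 x :=
  (trivializationAt G W x).open_baseSet.mem_nhds (mem_baseSet_trivializationAt G W x)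

section Coordinates

variable {B : Type*} [TopologicalSpace B] {G : Type*} [NormedAddCommGroup G] [NormedSpace ℝ G]
  {W : B → Type*} [TopologicalSpace (TotalSpace G W)]
  [∀ x, AddCommGroup (W x)] [∀ x, Module ℝ (W x)] [∀ x, TopologicalSpace (W x)]
  [FiberBundle G W]

/-- The coordinates of an element of `W_x ⊕ W_x^∨` in a trivialization of `W`. -/
def coordGen (e : Trivialization G (π G W)) [e.IsLinear ℝ] (x : B) : Gen (W x) →ₗ[ℝ] Gen G where
  toFun u := (e.continuousLinearMapAt ℝ x u.1, u.2.comp (e.symmL ℝ x))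
  map_add' _ _ := by simp
  map_smul' _ _ := by simp

/-- The element of `W_x ⊕ W_x^∨` with given coordinates in a trivialization of `W`; it inverts
`coordGen` over the base set. -/
def coordGenSymm (e : Trivialization G (π G W)) [e.IsLinear ℝ] (x : B) :
    Gen G →ₗ[ℝ] Gen (W x) where
  toFun v := (e.symmL ℝ x v.1, v.2.comp (e.continuousLinearMapAt ℝ x))
  map_add' _ _ := by simp
  map_smul' _ _ := by simp

variable {e : Trivialization G (π G W)} [e.IsLinear ℝ]

theorem coordGen_apply (x : B) (u : Gen (W x)) :
    coordGen e x u = (e.continuousLinearMapAt ℝ x u.1, u.2.comp (e.symmL ℝ x)) := rfl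

theorem coordGen_coordGenSymm {x : B} (hx : x ∈ e.baseSet) (v : Gen G) :
    coordGen e x (coordGenSymm e x v) = v := by
  refine Prod.ext (e.continuousLinearMapAt_symmL hx v.1) ?_
  ext z
  exact congrArg v.2 (e.continuousLinearMapAt_symmL hx z)

theorem coordGenSymm_coordGen {x : B} (hx : x ∈ e.baseSet) (u : Gen (W x)) :
    coordGenSymm e x (coordGen e x u) = u := by
  refine Prod.ext (e.symmL_continuousLinearMapAt hx u.1) ?_
  ext z
  exact congrArg u.2 (e.symmL_continuousLinearMapAt hx z)

theorem coordGen_injective {x : B} (hx : x ∈ e.baseSet) : Function.Injective (coordGen e x) :=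
  Function.LeftInverse.injective (coordGenSymm_coordGen hx)

theorem pairing_coordGen {x : B} (hx : x ∈ e.baseSet) (u v : Gen (W x)) :
    pairing (coordGen e x u) (coordGen e x v) = pairing u v := by
  simp only [pairing, coordGen_apply, ContinuousLinearMap.comp_apply,
    e.symmL_continuousLinearMapAt hx]

section CoordEnd

variable [FiniteDimensional ℝ G] {J : ∀ x, Gen (W x) →ₗ[ℝ] Gen (W x)}

/-- The matrix, in a trivialization of `W`, of an endomorphism of `W ⊕ W^∨`. -/
def coordEnd (e : Trivialization G (π G W)) [e.IsLinear ℝ]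
    (J : ∀ x, Gen (W x) →ₗ[ℝ] Gen (W x)) (x : B) : Gen G →L[ℝ] Gen G :=
  LinearMap.toContinuousLinearMap (coordGen e x ∘ₗ J x ∘ₗ coordGenSymm e x)

theorem coordEnd_apply (x : B) (v : Gen G) :
    coordEnd e J x v = coordGen e x (J x (coordGenSymm e x v)) := rfl

theorem coordEnd_coordGen {x : B} (hx : x ∈ e.baseSet) (u : Gen (W x)) :
    coordEnd e J x (coordGen e x u) = coordGen e x (J x u) := by
  rw [coordEnd_apply, coordGenSymm_coordGen hx]

theorem coordEnd_sq (hsq : ∀ x u, J x (J x u) = -u) {x : B} (hx : x ∈ e.baseSet) (v : Gen G) :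
    coordEnd e J x (coordEnd e J x v) = -v := by
  rw [coordEnd_apply x v, coordEnd_coordGen hx, hsq, map_neg, coordGen_coordGenSymm hx]

theorem pairing_coordEnd (horth : ∀ x u v, pairing (J x u) (J x v) = pairing u v) {x : B}
    (hx : x ∈ e.baseSet) (v v' : Gen G) :
    pairing (coordEnd e J x v) (coordEnd e J x v') = pairing v v' := by
  rw [coordEnd_apply, coordEnd_apply, pairing_coordGen hx, horth, ← pairing_coordGen hx,
    coordGen_coordGenSymm hx, coordGen_coordGenSymm hx]

end CoordEnd

end Coordinates

theorem contMDiffAt_clm_of_apply {EB : Type*} [NormedAddCommGroup EB] [NormedSpace ℝ EB]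
    {HB : Type*} [TopologicalSpace HB] {I : ModelWithCorners ℝ EB HB}
    {B : Type*} [TopologicalSpace B] [ChartedSpace HB B]
    {P Q : Type*} [NormedAddCommGroup P] [NormedSpace ℝ P]
    [FiniteDimensional ℝ P] [NormedAddCommGroup Q] [NormedSpace ℝ Q]
    {f : B → P →L[ℝ] Q} {x : B} {n : WithTop ℕ∞}
    (h : ∀ v, ContMDiffAt I 𝓘(ℝ, Q) n (fun y => f y v) x) :
    ContMDiffAt I 𝓘(ℝ, P →L[ℝ] Q) n f x := by
  let basisEquiv : P ≃L[ℝ] Fin (Module.finrank ℝ P) → ℝ :=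
    ContinuousLinearEquiv.ofFinrankEq (Module.finrank_fin_fun ℝ).symm
  let columns : (P →L[ℝ] Q) ≃L[ℝ] Fin (Module.finrank ℝ P) → Q :=
    (basisEquiv.arrowCongr (.refl ℝ Q)).trans (ContinuousLinearEquiv.piRing _)
  rw [← Function.id_comp f, ← columns.symm_comp_self]
  exact columns.symm.contDiff.contMDiff.contMDiffAt.comp x
    (contMDiffAt_pi_space.2 fun i => h (basisEquiv.symm (Pi.single i 1)))

section SmoothSections

variable {EB : Type*} [NormedAddCommGroup EB] [NormedSpace ℝ EB]
  {HB : Type*} [TopologicalSpace HB] {I : ModelWithCorners ℝ EB HB}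
  {B : Type*} [TopologicalSpace B] [ChartedSpace HB B]
  {G : Type*} [NormedAddCommGroup G] [NormedSpace ℝ G]
  {W : B → Type*} [TopologicalSpace (TotalSpace G W)]
  [∀ x, AddCommGroup (W x)] [∀ x, Module ℝ (W x)] [∀ x, TopologicalSpace (W x)]
  [FiberBundle G W] [VectorBundle ℝ G W]

theorem contMDiffAt_section_iff_coord {s : ∀ x, W x} {x₀ : B} :
    ContMDiffAt I (I.prod 𝓘(ℝ, G)) ∞ (fun x => TotalSpace.mk' G x (s x)) x₀ ↔
      ContMDiffAt I 𝓘(ℝ, G) ∞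
        (fun x => (trivializationAt G W x₀).continuousLinearMapAt ℝ x (s x)) x₀ := by
  rw [contMDiffAt_section]
  refine Filter.EventuallyEq.contMDiffAt_iff ?_
  filter_upwards [baseSet_trivializationAt_mem_nhds (G := G) (W := W) x₀] with x hx
  rw [Trivialization.continuousLinearMapAt_apply, Trivialization.coe_linearMapAt_of_mem _ hx]

theorem contMDiffAt_dual_section_iff_coord {s : ∀ x, W x →L[ℝ] ℝ} {x₀ : B} :
    ContMDiffAt I (I.prod 𝓘(ℝ, G →L[ℝ] ℝ)) ∞
        (fun x => (TotalSpace.mk' (G →L[ℝ] ℝ) x (s x) :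
          TotalSpace (G →L[ℝ] ℝ) (fun x => W x →L[ℝ] ℝ))) x₀ ↔
      ContMDiffAt I 𝓘(ℝ, G →L[ℝ] ℝ) ∞
        (fun x => (s x).comp ((trivializationAt G W x₀).symmL ℝ x)) x₀ := by
  rw [contMDiffAt_section]
  refine Filter.EventuallyEq.contMDiffAt_iff ?_
  filter_upwards with x
  rw [hom_trivializationAt_apply]
  ext v
  simp [ContinuousLinearMap.inCoordinates]

theorem contMDiffOn_symmL {n : WithTop ℕ∞} [ContMDiffVectorBundle n G W I]
    (e : Trivialization G (π G W)) [MemTrivializationAtlas e] (ξ : G) :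
    ContMDiffOn I (I.prod 𝓘(ℝ, G)) n (fun x => TotalSpace.mk' G x (e.symmL ℝ x ξ)) e.baseSet := by
  rw [e.contMDiffOn_section_baseSet_iff]
  refine (contMDiffOn_const (c := ξ)).congr fun x hx => ?_
  exact (congrFun (e.coe_linearMapAt_of_mem (R := ℝ) hx) _).symm.trans
    (e.continuousLinearMapAt_symmL hx ξ)

theorem smoothSectionOn_iff {s : ∀ x, Gen (W x)} {U : Set B} (hU : IsOpen U) :
    SmoothSectionOn I G s U ↔ ∀ x₀ ∈ U, ContMDiffAt I 𝓘(ℝ, Gen G) ∞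
      (fun x => coordGen (trivializationAt G W x₀) x (s x)) x₀ := by
  constructor
  · rintro ⟨hfst, hsnd⟩ x₀ hx₀
    exact (contMDiffAt_section_iff_coord.1 (hfst.contMDiffAt (hU.mem_nhds hx₀))).prodMk_space
      (contMDiffAt_dual_section_iff_coord.1 (hsnd.contMDiffAt (hU.mem_nhds hx₀)))
  · intro h
    refine ⟨fun x₀ hx₀ => ContMDiffAt.contMDiffWithinAt ?_,
      fun x₀ hx₀ => ContMDiffAt.contMDiffWithinAt ?_⟩
    · rw [contMDiffAt_section_iff_coord]
      exact (contDiff_fst (𝕜 := ℝ) (E := G) (F := G →L[ℝ] ℝ)).contMDiff.contMDiffAt.comp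
        x₀ (h x₀ hx₀)
    · rw [contMDiffAt_dual_section_iff_coord]
      exact (contDiff_snd (𝕜 := ℝ) (E := G) (F := G →L[ℝ] ℝ)).contMDiff.contMDiffAt.comp
        x₀ (h x₀ hx₀)

theorem smoothSectionOn_coordGenSymm [ContMDiffVectorBundle ∞ G W I] (x₀ : B) (v : Gen G) :
    SmoothSectionOn I G (fun x => coordGenSymm (trivializationAt G W x₀) x v)
      (trivializationAt G W x₀).baseSet := by
  set e := trivializationAt G W x₀
  refine ⟨contMDiffOn_symmL e v.1, ?_⟩
  have hbase : (trivializationAt (G →L[ℝ] ℝ) (fun x => W x →L[ℝ] ℝ) x₀).baseSet = e.baseSet := by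
    rw [hom_trivializationAt_baseSet]
    exact Set.inter_univ _
  rw [← hbase, Trivialization.contMDiffOn_section_baseSet_iff]
  refine (contMDiffOn_const (c := v.2)).congr fun x hx => ?_
  rw [hbase] at hx
  rw [hom_trivializationAt_apply]
  ext z
  simp only [ContinuousLinearMap.inCoordinates, ContinuousLinearMap.comp_apply,
    Trivial.fiberBundle_trivializationAt', Trivial.continuousLinearMapAt_trivialization]
  exact congrArg v.2 (e.continuousLinearMapAt_symmL (R := ℝ) hx z)

variable [FiniteDimensional ℝ G] {J : ∀ x, Gen (W x) →ₗ[ℝ] Gen (W x)}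

theorem smoothSectionOn_apply_of_contMDiffAt_coordEnd
    (h : ∀ x₀, ContMDiffAt I 𝓘(ℝ, Gen G →L[ℝ] Gen G) ∞
      (coordEnd (trivializationAt G W x₀) J) x₀)
    (U : Set B) (hU : IsOpen U) (s : ∀ x, Gen (W x)) (hs : SmoothSectionOn I G s U) :
    SmoothSectionOn I G (fun x => J x (s x)) U := by
  rw [smoothSectionOn_iff hU] at hs ⊢
  intro x₀ hx₀
  refine ((h x₀).clm_apply (hs x₀ hx₀)).congr_of_eventuallyEq ?_
  filter_upwards [baseSet_trivializationAt_mem_nhds (G := G) (W := W) x₀] with x hx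
  exact (coordEnd_coordGen hx (s x)).symm

theorem contMDiffAt_coordEnd [ContMDiffVectorBundle ∞ G W I]
    (hJ : ∀ U : Set B, IsOpen U → ∀ s : ∀ x, Gen (W x),
      SmoothSectionOn I G s U → SmoothSectionOn I G (fun x => J x (s x)) U) (x₀ : B) :
    ContMDiffAt I 𝓘(ℝ, Gen G →L[ℝ] Gen G) ∞ (coordEnd (trivializationAt G W x₀) J) x₀ := by
  refine contMDiffAt_clm_of_apply fun v => ?_
  have hopen := (trivializationAt G W x₀).open_baseSet
  exact (smoothSectionOn_iff hopen).1 (hJ _ hopen _ (smoothSectionOn_coordGenSymm (I := I) x₀ v))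
    x₀ (mem_baseSet_trivializationAt G W x₀)

end SmoothSections

theorem inverse_symmL {B : Type*} [TopologicalSpace B] {G : Type*} [NormedAddCommGroup G]
    [NormedSpace ℝ G] {W : B → Type*} [TopologicalSpace (TotalSpace G W)]
    [∀ x, AddCommGroup (W x)] [∀ x, Module ℝ (W x)] [∀ x, TopologicalSpace (W x)]
    [FiberBundle G W] (e : Trivialization G (π G W)) [e.IsLinear ℝ] {x : B} (hx : x ∈ e.baseSet) :
    (e.symmL ℝ x).inverse = e.continuousLinearMapAt ℝ x :=
  ContinuousLinearMap.inverse_eq (ContinuousLinearMap.ext (e.symmL_continuousLinearMapAt hx))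
    (ContinuousLinearMap.ext (e.continuousLinearMapAt_symmL hx))

theorem inverse_continuousLinearMapAt {B : Type*} [TopologicalSpace B] {G : Type*}
    [NormedAddCommGroup G] [NormedSpace ℝ G] {W : B → Type*} [TopologicalSpace (TotalSpace G W)]
    [∀ x, AddCommGroup (W x)] [∀ x, Module ℝ (W x)] [∀ x, TopologicalSpace (W x)]
    [FiberBundle G W] (e : Trivialization G (π G W)) [e.IsLinear ℝ] {x : B} (hx : x ∈ e.baseSet) :
    (e.continuousLinearMapAt ℝ x).inverse = e.symmL ℝ x :=
  ContinuousLinearMap.inverse_eq (ContinuousLinearMap.ext (e.continuousLinearMapAt_symmL hx))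
    (ContinuousLinearMap.ext (e.symmL_continuousLinearMapAt hx))

section Charts

variable {EB : Type*} [NormedAddCommGroup EB] [NormedSpace ℝ EB]
  {HB : Type*} [TopologicalSpace HB] {I : ModelWithCorners ℝ EB HB}
  {B : Type*} [TopologicalSpace B] [ChartedSpace HB B]
  {Q : Type*} [NormedAddCommGroup Q] [NormedSpace ℝ Q]

theorem differentiableAt_comp_extChartAt_symm [I.Boundaryless] {f : B → Q} {p : B}
    (hf : MDifferentiableAt I 𝓘(ℝ, Q) f p) :
    DifferentiableAt ℝ (fun y => f ((extChartAt I p).symm y)) (extChartAt I p p) := by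
  have h := ((mdifferentiableAt_iff (f := f) (x := p)).1 hf).2
  rwa [I.range_eq_univ, differentiableWithinAt_univ] at h

theorem contDiffAt_comp_extChartAt_symm [I.Boundaryless] {f : B → Q} {p : B} {n : WithTop ℕ∞}
    (hf : ContMDiffAt I 𝓘(ℝ, Q) n f p) :
    ContDiffAt ℝ n (fun y => f ((extChartAt I p).symm y)) (extChartAt I p p) := by
  have h := ((contMDiffAt_iff (f := f) (x := p)).1 hf).2
  rwa [I.range_eq_univ, contDiffWithinAt_univ] at h

/-- The local representative of a section of a vector bundle `W`, in the preferred trivialization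
of `W` and the preferred chart of the base at `p`. -/
def sectionCoord (I : ModelWithCorners ℝ EB HB) (G : Type*) [NormedAddCommGroup G]
    [NormedSpace ℝ G] {W : B → Type*} [TopologicalSpace (TotalSpace G W)]
    [∀ x, AddCommGroup (W x)] [∀ x, Module ℝ (W x)] [∀ x, TopologicalSpace (W x)]
    [FiberBundle G W] [VectorBundle ℝ G W] (p : B) (σ : ∀ x, W x) (y : EB) : G :=
  (trivializationAt G W p).continuousLinearMapAt ℝ ((extChartAt I p).symm y)
    (σ ((extChartAt I p).symm y))

section

variable {W : B → Type*} [TopologicalSpace (TotalSpace Q W)]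
  [∀ x, AddCommGroup (W x)] [∀ x, Module ℝ (W x)] [∀ x, TopologicalSpace (W x)]
  [FiberBundle Q W] [VectorBundle ℝ Q W]

theorem sectionCoord_self (p : B) (σ : ∀ x, W x) :
    sectionCoord I Q p σ (extChartAt I p p) =
      (trivializationAt Q W p).continuousLinearMapAt ℝ p (σ p) := by
  rw [sectionCoord, extChartAt_to_inv]

theorem contDiffAt_sectionCoord [I.Boundaryless] {p : B} {σ : ∀ x, W x}
    (hσ : ContMDiffAt I (I.prod 𝓘(ℝ, Q)) ∞ (fun x => TotalSpace.mk' Q x (σ x)) p) :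
    ContDiffAt ℝ ∞ (sectionCoord I Q p σ) (extChartAt I p p) :=
  contDiffAt_comp_extChartAt_symm (contMDiffAt_section_iff_coord.1 hσ)

end

variable [IsManifold I 1 B] {p x : B}

theorem extChartAt_symm_mem_baseSet {y : EB} (hy : y ∈ (extChartAt I p).target) :
    (extChartAt I p).symm y ∈ (trivializationAt EB (TangentSpace I) p).baseSet := by
  have h := (extChartAt I p).map_target hy
  rwa [extChartAt_source] at h

theorem symmL_extChartAt_symm {y : EB} (hy : y ∈ (extChartAt I p).target) :
    (trivializationAt EB (TangentSpace I) p).symmL ℝ ((extChartAt I p).symm y) =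
      mfderivWithin 𝓘(ℝ, EB) I (extChartAt I p).symm (Set.range I) y := by
  rw [TangentBundle.symmL_trivializationAt (extChartAt_symm_mem_baseSet hy),
    (extChartAt I p).right_inv hy]

theorem hasMFDerivAt_of_extChartAt (hx : x ∈ (chartAt HB p).source) {g : B → Q} {ĝ : EB → Q}
    {ĝ' : EB →L[ℝ] Q} (hg : ∀ᶠ y in 𝓝 (extChartAt I p x), g ((extChartAt I p).symm y) = ĝ y)
    (hĝ : HasFDerivAt ĝ ĝ' (extChartAt I p x)) :
    HasMFDerivAt I 𝓘(ℝ, Q) g x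
      (ĝ'.comp ((trivializationAt EB (TangentSpace I) p).continuousLinearMapAt ℝ x)) := by
  have hx' : x ∈ (extChartAt I p).source := by rwa [extChartAt_source]
  have heq : g =ᶠ[𝓝 x] ĝ ∘ extChartAt I p := by
    filter_upwards [(continuousAt_extChartAt' hx').eventually hg,
      extChartAt_source_mem_nhds' hx'] with z hz hz'
    rw [Function.comp_apply, ← hz, (extChartAt I p).left_inv hz']
  rw [TangentBundle.continuousLinearMapAt_trivializationAt hx]
  exact (HasMFDerivAt.comp x hĝ.hasMFDerivAt
    (mdifferentiableAt_extChartAt hx).hasMFDerivAt).congr_of_eventuallyEq heq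

theorem mvfderiv_of_extChartAt (hx : x ∈ (chartAt HB p).source) {g : B → Q} {ĝ : EB → Q}
    {ĝ' : EB →L[ℝ] Q} (hg : ∀ᶠ y in 𝓝 (extChartAt I p x), g ((extChartAt I p).symm y) = ĝ y)
    (hĝ : HasFDerivAt ĝ ĝ' (extChartAt I p x)) (v : TangentSpace I x) :
    mvfderiv I g x v =
      ĝ' ((trivializationAt EB (TangentSpace I) p).continuousLinearMapAt ℝ x v) := by
  rw [mvfderiv, (hasMFDerivAt_of_extChartAt hx hg hĝ).mfderiv]
  rfl

theorem mpullbackWithin_extChartAt_symm (X : ∀ x : B, TangentSpace I x) {y : EB}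
    (hy : y ∈ (extChartAt I p).target) :
    VectorField.mpullbackWithin 𝓘(ℝ, EB) I (extChartAt I p).symm X (Set.range I) y =
      sectionCoord I EB p X y :=
  (congrArg (fun L : EB →L[ℝ] TangentSpace I ((extChartAt I p).symm y) =>
    L.inverse (X ((extChartAt I p).symm y))) (symmL_extChartAt_symm hy).symm).trans
      (DFunLike.congr_fun (inverse_symmL _ (extChartAt_symm_mem_baseSet hy)) _)

theorem continuousLinearMapAt_mlieBracket [I.Boundaryless] (p : B)
    (X Y : ∀ x : B, TangentSpace I x) :
    (trivializationAt EB (TangentSpace I) p).continuousLinearMapAt ℝ p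
      (VectorField.mlieBracket I X Y p) =
    VectorField.lieBracket ℝ (sectionCoord I EB p X) (sectionCoord I EB p Y)
      (extChartAt I p p) := by
  have hp := mem_baseSet_trivializationAt EB (TangentSpace I) p
  have hcoord (X : ∀ x : B, TangentSpace I x) :
      VectorField.mpullbackWithin 𝓘(ℝ, EB) I (extChartAt I p).symm X Set.univ
        =ᶠ[𝓝 (extChartAt I p p)] sectionCoord I EB p X := by
    filter_upwards [extChartAt_target_mem_nhds (I := I) p] with y hy
    rw [← I.range_eq_univ, mpullbackWithin_extChartAt_symm X hy]
  have hinverse : (mfderiv I 𝓘(ℝ, EB) (extChartAt I p) p).inverse =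
      (trivializationAt EB (TangentSpace I) p).symmL ℝ p :=
    (congrArg (ContinuousLinearMap.inverse (M := TangentSpace I p) (M₂ := EB))
      (TangentBundle.continuousLinearMapAt_trivializationAt (mem_chart_source HB p)).symm).trans
      (inverse_continuousLinearMapAt (trivializationAt EB (TangentSpace I) p) hp)
  rw [VectorField.mlieBracket, VectorField.mlieBracketWithin_apply, hinverse, Set.preimage_univ,
    Set.univ_inter, I.range_eq_univ]
  refine ((trivializationAt EB (TangentSpace I) p).continuousLinearMapAt_symmL hp _).trans ?_
  refine (congrFun VectorField.lieBracketWithin_univ (extChartAt I p p)).trans ?_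
  exact (hcoord X).lieBracket_vectorField_eq (hcoord Y)

end Charts

section CourantCoordinates

variable {EB : Type*} [NormedAddCommGroup EB] [NormedSpace ℝ EB]
  {HB : Type*} [TopologicalSpace HB] {I : ModelWithCorners ℝ EB HB}
  {B : Type*} [TopologicalSpace B] [ChartedSpace HB B] [IsManifold I 1 B]

/-- The local representative of a section of `T_B ⊕ T_B^∨` in the preferred chart at `p`. -/
def sectionInChart (p : B) (s : ∀ x : B, GenTangent I x) (y : EB) : Gen EB :=
  coordGen (trivializationAt EB (TangentSpace I) p) ((extChartAt I p).symm y)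
    (s ((extChartAt I p).symm y))

theorem sectionInChart_self (p : B) (s : ∀ x : B, GenTangent I x) :
    sectionInChart p s (extChartAt I p p) =
      coordGen (trivializationAt EB (TangentSpace I) p) p (s p) := by
  simp only [sectionInChart]
  rw [extChartAt_to_inv]

variable {p : B} {s t : ∀ x : B, GenTangent I x} {s' t' : EB →L[ℝ] Gen EB}

theorem contractExtDeriv_apply [I.Boundaryless]
    (hs : HasFDerivAt (sectionInChart p s) s' (extChartAt I p p)) (u v : TangentSpace I p) :
    contractExtDeriv I (fun x => (s x).2) p u v =
      (s' ((trivializationAt EB (TangentSpace I) p).continuousLinearMapAt ℝ p u)).2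
        ((trivializationAt EB (TangentSpace I) p).continuousLinearMapAt ℝ p v) -
      (s' ((trivializationAt EB (TangentSpace I) p).continuousLinearMapAt ℝ p v)).2
        ((trivializationAt EB (TangentSpace I) p).continuousLinearMapAt ℝ p u) := by
  have hcoord : oneFormInChart I (fun x => (s x).2) p =ᶠ[𝓝 (extChartAt I p p)]
      fun y => (sectionInChart p s y).2 := by
    filter_upwards [extChartAt_target_mem_nhds (I := I) p] with y hy
    rw [oneFormInChart, ← symmL_extChartAt_symm hy]
    rfl
  rw [contractExtDeriv, I.range_eq_univ, fderivWithin_univ, hcoord.fderiv_eq, hs.snd.fderiv,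
    ← TangentBundle.continuousLinearMapAt_trivializationAt (mem_chart_source HB p)]
  rfl

theorem dual_apply_extChartAt_symm {y : EB} (hy : y ∈ (extChartAt I p).target) :
    (t ((extChartAt I p).symm y)).2 (s ((extChartAt I p).symm y)).1 =
      (sectionInChart p t y).2 (sectionInChart p s y).1 :=
  (congrArg (t ((extChartAt I p).symm y)).2 (Trivialization.symmL_continuousLinearMapAt _
    (extChartAt_symm_mem_baseSet hy) _)).symm

theorem mdifferentiableAt_dual_apply [I.Boundaryless]
    (hs : HasFDerivAt (sectionInChart p s) s' (extChartAt I p p))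
    (ht : HasFDerivAt (sectionInChart p t) t' (extChartAt I p p)) :
    MDifferentiableAt I 𝓘(ℝ, ℝ) (fun x => (t x).2 (s x).1) p :=
  (hasMFDerivAt_of_extChartAt (mem_chart_source HB p)
    (by filter_upwards [extChartAt_target_mem_nhds p] with y using dual_apply_extChartAt_symm)
    (ht.snd.clm_apply hs.fst)).mdifferentiableAt

theorem mvfderiv_dual_apply [I.Boundaryless]
    (hs : HasFDerivAt (sectionInChart p s) s' (extChartAt I p p))
    (ht : HasFDerivAt (sectionInChart p t) t' (extChartAt I p p)) (v : TangentSpace I p) :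
    mvfderiv I (fun x => (t x).2 (s x).1) p v =
      (sectionInChart p t (extChartAt I p p)).2
        (s' ((trivializationAt EB (TangentSpace I) p).continuousLinearMapAt ℝ p v)).1 +
      (t' ((trivializationAt EB (TangentSpace I) p).continuousLinearMapAt ℝ p v)).2
        (sectionInChart p s (extChartAt I p p)).1 :=
  mvfderiv_of_extChartAt (mem_chart_source HB p)
    (by filter_upwards [extChartAt_target_mem_nhds p] with y using dual_apply_extChartAt_symm)
    (ht.snd.clm_apply hs.fst) v

theorem coordGen_courant [I.Boundaryless]
    (hs : HasFDerivAt (sectionInChart p s) s' (extChartAt I p p))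
    (ht : HasFDerivAt (sectionInChart p t) t' (extChartAt I p p)) :
    coordGen (trivializationAt EB (TangentSpace I) p) p (courant I s t p) =
      courantJet (sectionInChart p s (extChartAt I p p)) s'
        (sectionInChart p t (extChartAt I p p)) t' := by
  have hfst (r : ∀ x : B, GenTangent I x) :
      (trivializationAt EB (TangentSpace I) p).continuousLinearMapAt ℝ p (r p).1 =
        (sectionInChart p r (extChartAt I p p)).1 :=
    congrArg Prod.fst (sectionInChart_self p r).symm
  refine Prod.ext ?_ ?_
  · refine (continuousLinearMapAt_mlieBracket p _ _).trans ?_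
    change fderiv ℝ (fun y => (sectionInChart p t y).1) (extChartAt I p p)
        (sectionInChart p s (extChartAt I p p)).1 -
      fderiv ℝ (fun y => (sectionInChart p s y).1) (extChartAt I p p)
        (sectionInChart p t (extChartAt I p p)).1 = _
    rw [hs.fst.fderiv, ht.fst.fderiv]
    simp [courantJet]
  · ext v
    set ℓ := (trivializationAt EB (TangentSpace I) p).symmL ℝ p v
    have hℓ : (trivializationAt EB (TangentSpace I) p).continuousLinearMapAt ℝ p ℓ = v :=
      Trivialization.continuousLinearMapAt_symmL _ (mem_baseSet_trivializationAt EB _ p) v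
    change contractExtDeriv I (fun x => (t x).2) p (s p).1 ℓ
        + mvfderiv I (fun x => (t x).2 (s x).1) p ℓ
      - (contractExtDeriv I (fun x => (s x).2) p (t p).1 ℓ
        + mvfderiv I (fun x => (s x).2 (t x).1) p ℓ)
      + (1 / 2 : ℝ) *
        mvfderiv I ((fun x => (s x).2 (t x).1) - fun x => (t x).2 (s x).1) p ℓ = _
    rw [mvfderiv_sub (mdifferentiableAt_dual_apply ht hs) (mdifferentiableAt_dual_apply hs ht),
      sub_apply, mvfderiv_dual_apply hs ht, mvfderiv_dual_apply ht hs,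
      contractExtDeriv_apply hs, contractExtDeriv_apply ht, hℓ, hfst, hfst]
    simp only [courantJet, Prod.snd_add, Prod.snd_sub, add_apply, sub_apply,
      ContinuousLinearMap.comp_apply, pairingForm_apply, pairing]
    ring

end CourantCoordinates

section IntegrabilityCriterion

variable {EB : Type*} [NormedAddCommGroup EB] [NormedSpace ℝ EB]
  {HB : Type*} [TopologicalSpace HB] {I : ModelWithCorners ℝ EB HB}
  {B : Type*} [TopologicalSpace B] [ChartedSpace HB B]
  {J : ∀ x : B, GenTangent I x →ₗ[ℝ] GenTangent I x} {p : B}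

theorem mem_plusEigenspace_iff (hsq : ∀ x u, J x (J x u) = -u) (z : GenTangentC I p) :
    z ∈ plusEigenspace I J p ↔ J p z.1 + z.2 = 0 := by
  refine ⟨fun h => by rw [h.1, neg_add_cancel], fun h => ⟨eq_neg_of_add_eq_zero_left h, ?_⟩⟩
  rw [eq_neg_of_add_eq_zero_right h, map_neg, hsq, neg_neg]

theorem mk_apply_neg_mem_plusEigenspace (hsq : ∀ x u, J x (J x u) = -u) (u : GenTangent I p) :
    (u, J p (-u)) ∈ plusEigenspace I J p :=
  (mem_plusEigenspace_iff hsq _).2 (by rw [map_neg, add_neg_cancel])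

variable [IsManifold I 1 B]

theorem SmoothSectionOn.differentiableAt_sectionInChart [I.Boundaryless]
    {s : ∀ x : B, GenTangent I x} {U : Set B} (hs : SmoothSectionOn I EB s U) (hU : IsOpen U)
    (hp : p ∈ U) : DifferentiableAt ℝ (sectionInChart p s) (extChartAt I p p) :=
  differentiableAt_comp_extChartAt_symm
    (((smoothSectionOn_iff hU).1 hs p hp).mdifferentiableAt (by simp))

variable [FiniteDimensional ℝ EB]

/-- The local representative of an endomorphism of `T_B ⊕ T_B^∨` in the preferred chart at `p`. -/
def endInChart (J : ∀ x : B, GenTangent I x →ₗ[ℝ] GenTangent I x) (p : B) (y : EB) :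
    Gen EB →L[ℝ] Gen EB :=
  coordEnd (trivializationAt EB (TangentSpace I) p) J ((extChartAt I p).symm y)

theorem endInChart_self_coordGen (u : GenTangent I p) :
    endInChart J p (extChartAt I p p) (coordGen (trivializationAt EB (TangentSpace I) p) p u) =
      coordGen (trivializationAt EB (TangentSpace I) p) p (J p u) := by
  rw [endInChart, extChartAt_to_inv,
    coordEnd_coordGen (mem_baseSet_trivializationAt EB (TangentSpace I) p)]

variable [I.Boundaryless]

theorem sectionInChart_apply_eventuallyEq (s : ∀ x : B, GenTangent I x) :
    sectionInChart p (fun x => J x (s x)) =ᶠ[𝓝 (extChartAt I p p)]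
      fun y => endInChart J p y (sectionInChart p s y) := by
  filter_upwards [extChartAt_target_mem_nhds p] with y hy
  exact (coordEnd_coordGen (extChartAt_symm_mem_baseSet hy) _).symm

theorem sectionInChart_snd_eventuallyEq {s : ∀ x : B, GenTangentC I x}
    (hs : ∀ᶠ x in 𝓝 p, s x ∈ plusEigenspace I J x) :
    sectionInChart p (fun x => (s x).2) =ᶠ[𝓝 (extChartAt I p p)]
      fun y => -(endInChart J p y (sectionInChart p (fun x => (s x).1) y)) := by
  have hlim : Filter.Tendsto (extChartAt I p).symm (𝓝 (extChartAt I p p)) (𝓝 p) := by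
    have hcont := continuousAt_extChartAt_symm (I := I) p
    rwa [ContinuousAt, extChartAt_to_inv] at hcont
  filter_upwards [hlim.eventually hs, sectionInChart_apply_eventuallyEq fun x => (s x).1]
    with y hy hy'
  rw [← hy', sectionInChart, sectionInChart, hy.1, map_neg, neg_neg]

namespace IsGenAlmostComplex

theorem endInChart_sq (hJ : IsGenAlmostComplex I EB J) (p : B) :
    ∀ᶠ y in 𝓝 (extChartAt I p p), ∀ a, endInChart J p y (endInChart J p y a) = -a := by
  filter_upwards [extChartAt_target_mem_nhds p] with y hy a
  exact coordEnd_sq hJ.sq (extChartAt_symm_mem_baseSet hy) a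

theorem pairing_endInChart_skew (hJ : IsGenAlmostComplex I EB J) (p : B) :
    ∀ᶠ y in 𝓝 (extChartAt I p p), ∀ a b,
      pairing (endInChart J p y a) b = -pairing a (endInChart J p y b) := by
  filter_upwards [extChartAt_target_mem_nhds p, hJ.endInChart_sq p] with y hy hsq
  exact pairing_skew_of_orthogonal hsq
    (pairing_coordEnd hJ.orth (extChartAt_symm_mem_baseSet hy))

/-- Sections of the `+i` eigenbundle are `s - i J s`, and the bracket of two of these is in the
eigenbundle if and only if the Nijenhuis torsion of `J` vanishes on the real parts. -/
theorem courantC_mem_plusEigenspace_iff (hJ : IsGenAlmostComplex I EB J)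
    {D : EB →L[ℝ] Gen EB →L[ℝ] Gen EB} (hD : HasFDerivAt (endInChart J p) D (extChartAt I p p))
    {s t : ∀ x : B, GenTangentC I x}
    (hs : DifferentiableAt ℝ (sectionInChart p fun x => (s x).1) (extChartAt I p p))
    (ht : DifferentiableAt ℝ (sectionInChart p fun x => (t x).1) (extChartAt I p p))
    (hsJ : ∀ᶠ x in 𝓝 p, s x ∈ plusEigenspace I J x)
    (htJ : ∀ᶠ x in 𝓝 p, t x ∈ plusEigenspace I J x) :
    courantC I s t p ∈ plusEigenspace I J p ↔
      ∀ c, nijenhuisForm (endInChart J p (extChartAt I p p)) (fun a => D a.1)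
        (coordGen (trivializationAt EB (TangentSpace I) p) p (s p).1)
        (coordGen (trivializationAt EB (TangentSpace I) p) p (t p).1) c = 0 := by
  have := FiniteDimensional.complete ℝ EB
  have hsnd {s : ∀ x : B, GenTangentC I x}
      (hs : DifferentiableAt ℝ (sectionInChart p fun x => (s x).1) (extChartAt I p p))
      (hsJ : ∀ᶠ x in 𝓝 p, s x ∈ plusEigenspace I J x) :
      HasFDerivAt (sectionInChart p fun x => (s x).2)
        (-applyJet (endInChart J p (extChartAt I p p)) D
          (sectionInChart p (fun x => (s x).1) (extChartAt I p p))
          (fderiv ℝ (sectionInChart p fun x => (s x).1) (extChartAt I p p)))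
        (extChartAt I p p) := by
    rw [applyJet, add_comm]
    exact (hD.clm_apply hs.hasFDerivAt).fun_neg.congr_of_eventuallyEq
      (sectionInChart_snd_eventuallyEq hsJ)
  rw [mem_plusEigenspace_iff hJ.sq,
    ← (coordGen_injective (mem_baseSet_trivializationAt EB (TangentSpace I) p)).eq_iff, map_zero,
    map_add, ← endInChart_self_coordGen]
  simp only [courantC, map_sub, map_add, coordGen_courant hs.hasFDerivAt ht.hasFDerivAt,
    coordGen_courant (hsnd hs hsJ) ht.hasFDerivAt, coordGen_courant hs.hasFDerivAt (hsnd ht htJ),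
    coordGen_courant (hsnd hs hsJ) (hsnd ht htJ), (sectionInChart_snd_eventuallyEq hsJ).eq_of_nhds,
    (sectionInChart_snd_eventuallyEq htJ).eq_of_nhds, courantJet_neg_left, courantJet_neg_right,
    neg_neg]
  rw [← sectionInChart_self p fun x => (s x).1, ← sectionInChart_self p fun x => (t x).1,
    ← nijenhuisJet_eq_zero_iff (hJ.endInChart_sq p).self_of_nhds
      (hJ.pairing_endInChart_skew p).self_of_nhds
      (pairing_skew_of_hasFDerivAt hD (hJ.pairing_endInChart_skew p))
      (anticommute_of_hasFDerivAt hD (hJ.endInChart_sq p)) _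
      (fderiv ℝ (sectionInChart p fun x => (s x).1) (extChartAt I p p)) _
      (fderiv ℝ (sectionInChart p fun x => (t x).1) (extChartAt I p p))]
  simp only [nijenhuisJet, sub_eq_add_neg, add_assoc, map_add, map_neg]

variable [ContMDiffVectorBundle ∞ EB (TangentSpace I : B → Type _) I]

theorem differentiableAt_endInChart (hJ : IsGenAlmostComplex I EB J) (p : B) :
    DifferentiableAt ℝ (endInChart J p) (extChartAt I p p) :=
  differentiableAt_comp_extChartAt_symm
    ((contMDiffAt_coordEnd hJ.smooth p).mdifferentiableAt (by simp))

theorem integrable_iff (hJ : IsGenAlmostComplex I EB J) :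
    Integrable I J ↔ ∀ p a b c, nijenhuisForm (endInChart J p (extChartAt I p p))
      (fun a => fderiv ℝ (endInChart J p) (extChartAt I p p) a.1) a b c = 0 := by
  refine ⟨fun h p a b => ?_, fun h U hU s t hs _ ht _ hsJ htJ p hp => ?_⟩
  · set e := trivializationAt EB (TangentSpace I) p
    have hp : p ∈ e.baseSet := mem_baseSet_trivializationAt EB (TangentSpace I) p
    have hsmooth (a : Gen EB) : SmoothSectionOn I EB (fun x => coordGenSymm e x a) e.baseSet :=
      smoothSectionOn_coordGenSymm p a
    have hsmooth' (a : Gen EB) :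
        SmoothSectionOn I EB (fun x => J x (-coordGenSymm e x a)) e.baseSet := by
      simp only [← map_neg (coordGenSymm e _)]
      exact hJ.smooth _ e.open_baseSet _ (hsmooth (-a))
    have hmem (a : Gen EB) (x : B) := mk_apply_neg_mem_plusEigenspace hJ.sq (coordGenSymm e x a)
    have hbracket := h e.baseSet e.open_baseSet
      (fun x => (coordGenSymm e x a, J x (-coordGenSymm e x a)))
      (fun x => (coordGenSymm e x b, J x (-coordGenSymm e x b)))
      (hsmooth a) (hsmooth' a) (hsmooth b) (hsmooth' b)
      (fun x _ => hmem a x) (fun x _ => hmem b x) p hp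
    rw [hJ.courantC_mem_plusEigenspace_iff (hJ.differentiableAt_endInChart p).hasFDerivAt
      ((hsmooth a).differentiableAt_sectionInChart e.open_baseSet hp)
      ((hsmooth b).differentiableAt_sectionInChart e.open_baseSet hp)
      (Filter.Eventually.of_forall (hmem a)) (Filter.Eventually.of_forall (hmem b))] at hbracket
    rwa [coordGen_coordGenSymm hp, coordGen_coordGenSymm hp] at hbracket
  · rw [hJ.courantC_mem_plusEigenspace_iff (hJ.differentiableAt_endInChart p).hasFDerivAt
      (hs.differentiableAt_sectionInChart hU hp) (ht.differentiableAt_sectionInChart hU hp)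
      (Filter.eventually_of_mem (hU.mem_nhds hp) hsJ)
      (Filter.eventually_of_mem (hU.mem_nhds hp) htJ)]
    exact h p _ _

end IsGenAlmostComplex

end IntegrabilityCriterion

section ChartCalculus

variable {E : Type*} [NormedAddCommGroup E] [NormedSpace ℝ E]
  {F : Type*} [NormedAddCommGroup F] [NormedSpace ℝ F]
  {A : E → E →L[ℝ] F →L[ℝ] F} {X Y : E → E} {s : E → F} {y : E}

/-- The covariant derivative `X s + A(X) s` of a vector-valued function `s` along a vector field
`X`, for a connection form `A` on a trivial bundle over a vector space. -/
def chartCov (A : E → E →L[ℝ] F →L[ℝ] F) (X : E → E) (s : E → F) (y : E) : F :=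
  fderiv ℝ s y (X y) + A y (X y) (s y)

/-- The curvature `dA + [A, A]` of a connection form `A` on a trivial bundle over a vector
space. -/
def curvatureForm (A : E → E →L[ℝ] F →L[ℝ] F) (y : E) (u v : E) (ξ : F) : F :=
  fderiv ℝ A y u v ξ - fderiv ℝ A y v u ξ + A y u (A y v ξ) - A y v (A y u ξ)

theorem hasFDerivAt_chartCov (hA : DifferentiableAt ℝ A y) (hX : DifferentiableAt ℝ X y)
    (hs : ContDiffAt ℝ 2 s y) :
    HasFDerivAt (chartCov A X s)
      ((fderiv ℝ s y).comp (fderiv ℝ X y) + (fderiv ℝ (fderiv ℝ s) y).flip (X y) +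
        ((A y (X y)).comp (fderiv ℝ s y) +
          ((A y).comp (fderiv ℝ X y) + (fderiv ℝ A y).flip (X y)).flip (s y))) y := by
  have hs' : DifferentiableAt ℝ (fderiv ℝ s) y :=
    (hs.fderiv_right (m := 1) (by norm_num)).differentiableAt one_ne_zero
  exact (hs'.hasFDerivAt.clm_apply hX.hasFDerivAt).add
    ((hA.hasFDerivAt.clm_apply hX.hasFDerivAt).clm_apply
      (hs.differentiableAt two_ne_zero).hasFDerivAt)

theorem chartCov_commutator (hA : DifferentiableAt ℝ A y) (hX : DifferentiableAt ℝ X y)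
    (hY : DifferentiableAt ℝ Y y) (hs : ContDiffAt ℝ 2 s y) :
    chartCov A X (chartCov A Y s) y - chartCov A Y (chartCov A X s) y
        - chartCov A (VectorField.lieBracket ℝ X Y) s y =
      curvatureForm A y (X y) (Y y) (s y) := by
  have hsymm := hs.isSymmSndFDerivAt (by simp)
  have hcov (X Y : E → E) (hY : DifferentiableAt ℝ Y y) :
      chartCov A X (chartCov A Y s) y =
        fderiv ℝ s y (fderiv ℝ Y y (X y)) + fderiv ℝ (fderiv ℝ s) y (X y) (Y y)
          + (A y (Y y) (fderiv ℝ s y (X y))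
            + (A y (fderiv ℝ Y y (X y)) (s y) + fderiv ℝ A y (X y) (Y y) (s y)))
          + A y (X y) (fderiv ℝ s y (Y y) + A y (Y y) (s y)) := by
    rw [chartCov, (hasFDerivAt_chartCov hA hY hs).fderiv]
    rfl
  rw [hcov X Y hY, hcov Y X hX, hsymm (Y y) (X y)]
  simp only [chartCov, curvatureForm, VectorField.lieBracket, map_sub, map_add, sub_apply]
  abel

end ChartCalculus

section ConnectionForm

variable {EB : Type*} [NormedAddCommGroup EB] [NormedSpace ℝ EB]
  {HB : Type*} [TopologicalSpace HB] {I : ModelWithCorners ℝ EB HB}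
  {B : Type*} [TopologicalSpace B] [ChartedSpace HB B]
  {F : Type*} [NormedAddCommGroup F] [NormedSpace ℝ F]
  {V : B → Type*} [TopologicalSpace (TotalSpace F V)]
  [∀ x, AddCommGroup (V x)] [∀ x, Module ℝ (V x)] [∀ x, TopologicalSpace (V x)]
  [FiberBundle F V] [VectorBundle ℝ F V]

/-- The covariant derivative over the base set of a trivialization for which the sections that are
constant in the trivialization are parallel. -/
def trivializationCov (e : Trivialization F (π F V)) [MemTrivializationAtlas e] (σ : ∀ x, V x)
    (x : B) : TangentSpace I x →L[ℝ] V x :=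
  (e.symmL ℝ x).comp (mvfderiv I (fun y => e.continuousLinearMapAt ℝ y (σ y)) x)

theorem trivializationCov_symmL (e : Trivialization F (π F V)) [MemTrivializationAtlas e] {x : B}
    (hx : x ∈ e.baseSet) (ξ : F) :
    trivializationCov (I := I) e (fun y => e.symmL ℝ y ξ) x = 0 := by
  have hconst : (fun y => e.continuousLinearMapAt ℝ y (e.symmL ℝ y ξ)) =ᶠ[𝓝 x] fun _ => ξ := by
    filter_upwards [e.open_baseSet.mem_nhds hx] with y hy
    exact e.continuousLinearMapAt_symmL hy ξ
  rw [trivializationCov, mvfderiv, hconst.mfderiv_eq]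
  exact (congrArg (e.symmL ℝ x).comp (mvfderiv_const ξ)).trans (ContinuousLinearMap.comp_zero _)

variable [ContMDiffVectorBundle 1 F V I]

theorem mdifferentiableAt_section_iff_coord (e : Trivialization F (π F V))
    [MemTrivializationAtlas e] {x : B} (hx : x ∈ e.baseSet) {σ : ∀ x, V x} :
    MDifferentiableAt I (I.prod 𝓘(ℝ, F)) (fun y => TotalSpace.mk' F y (σ y)) x ↔
      MDifferentiableAt I 𝓘(ℝ, F) (fun y => e.continuousLinearMapAt ℝ y (σ y)) x := by
  rw [e.mdifferentiableAt_section_iff _ _ hx]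
  refine Filter.EventuallyEq.mdifferentiableAt_iff ?_
  filter_upwards [e.open_baseSet.mem_nhds hx] with y hy
  rw [Trivialization.continuousLinearMapAt_apply, Trivialization.coe_linearMapAt_of_mem _ hy]

theorem mdifferentiableAt_symmL (e : Trivialization F (π F V)) [MemTrivializationAtlas e] {x : B}
    (hx : x ∈ e.baseSet) (ξ : F) :
    MDifferentiableAt I (I.prod 𝓘(ℝ, F)) (fun y => TotalSpace.mk' F y (e.symmL ℝ y ξ)) x :=
  ((contMDiffOn_symmL e ξ).contMDiffAt (e.open_baseSet.mem_nhds hx)).mdifferentiableAt one_ne_zero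

variable [∀ x, IsTopologicalAddGroup (V x)] [∀ x, ContinuousSMul ℝ (V x)]

theorem isCovariantDerivativeOn_trivializationCov (e : Trivialization F (π F V))
    [MemTrivializationAtlas e] :
    IsCovariantDerivativeOn (I := I) F (trivializationCov e) e.baseSet where
  add {σ τ x} hσ hτ hx := by
    have hσ' := (mdifferentiableAt_section_iff_coord e hx).1 hσ
    have hτ' := (mdifferentiableAt_section_iff_coord e hx).1 hτ
    simp only [trivializationCov, Pi.add_apply, map_add]
    rw [mvfderiv_fun_add hσ' hτ', ContinuousLinearMap.comp_add]
  leibniz {σ g x} hσ hg hx := by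
    have hσ' := (mdifferentiableAt_section_iff_coord e hx).1 hσ
    simp only [trivializationCov, Pi.smul_apply', map_smul]
    rw [mvfderiv_fun_smul hg hσ']
    ext w
    simp only [add_apply, ContinuousLinearMap.comp_apply, ContinuousLinearMap.smulRight_apply,
      smul_apply, map_add, map_smul]
    rw [e.symmL_continuousLinearMapAt hx]

variable (cov : CovariantDerivative I F V)

theorem cov_symm (e : Trivialization F (π F V)) [MemTrivializationAtlas e] {x : B}
    (hx : x ∈ e.baseSet) (ξ : F) :
    cov (fun y => e.symm y ξ) x = cov (fun y => e.symmL ℝ y ξ) x := by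
  have hsymm : ∀ᶠ y in 𝓝 x, e.symmL ℝ y ξ = e.symm y ξ := by
    filter_upwards [e.open_baseSet.mem_nhds hx] with y hy
    exact e.symmL_apply hy ξ
  have hdiff := mdifferentiableAt_symmL (I := I) e hx ξ
  refine (cov.isCovariantDerivativeOn.congr_of_eventuallyEq hdiff
    (hdiff.congr_of_eventuallyEq ?_) Filter.univ_mem hsymm).symm
  filter_upwards [hsymm] with y hy
  rw [hy]

variable [FiniteDimensional ℝ F] [IsManifold I 1 B]

/-- The connection form of `∇` in the preferred trivializations of `T_B` and `V` at `x₀`: the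
difference of `∇` and the trivial connection `d`, so that `∇_u ξ = d ξ(u) + A(u) ξ`. -/
def connForm (x₀ x : B) : EB →L[ℝ] F →L[ℝ] F :=
  let e := trivializationAt F V x₀
  let eT := trivializationAt EB (TangentSpace I) x₀
  let A := (cov.isCovariantDerivativeOn (s := e.baseSet)).difference
    (isCovariantDerivativeOn_trivializationCov e) x
  ((eT.symmL ℝ x).precomp F ∘L (e.continuousLinearMapAt ℝ x).postcomp _ ∘L
    A ∘L e.symmL ℝ x).flip

variable {x₀ x : B}

theorem connForm_apply (hx : x ∈ (trivializationAt F V x₀).baseSet) (u : EB) (ξ : F) :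
    connForm cov x₀ x u ξ = (trivializationAt F V x₀).continuousLinearMapAt ℝ x
      (cov (fun y => (trivializationAt F V x₀).symmL ℝ y ξ) x
        ((trivializationAt EB (TangentSpace I) x₀).symmL ℝ x u)) := by
  have hdiff := IsCovariantDerivativeOn.difference_apply cov.isCovariantDerivativeOn (s := _)
    (isCovariantDerivativeOn_trivializationCov (trivializationAt F V x₀)) hx
    (mdifferentiableAt_symmL (I := I) _ hx ξ)
  rw [trivializationCov_symmL _ hx, sub_zero] at hdiff
  rw [← hdiff]
  rfl

theorem continuousLinearMapAt_cov (hx : x ∈ (trivializationAt F V x₀).baseSet)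
    (hx' : x ∈ (trivializationAt EB (TangentSpace I) x₀).baseSet) {σ : ∀ x, V x}
    (hσ : MDifferentiableAt I (I.prod 𝓘(ℝ, F)) (fun y => TotalSpace.mk' F y (σ y)) x)
    (w : TangentSpace I x) :
    (trivializationAt F V x₀).continuousLinearMapAt ℝ x (cov σ x w) =
      mvfderiv I (fun y => (trivializationAt F V x₀).continuousLinearMapAt ℝ y (σ y)) x w +
        connForm cov x₀ x
          ((trivializationAt EB (TangentSpace I) x₀).continuousLinearMapAt ℝ x w)
          ((trivializationAt F V x₀).continuousLinearMapAt ℝ x (σ x)) := by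
  set e := trivializationAt F V x₀
  have hdiff := IsCovariantDerivativeOn.difference_apply cov.isCovariantDerivativeOn (s := _)
    (isCovariantDerivativeOn_trivializationCov e) hx hσ
  have hform : connForm cov x₀ x
      ((trivializationAt EB (TangentSpace I) x₀).continuousLinearMapAt ℝ x w)
      (e.continuousLinearMapAt ℝ x (σ x)) =
      e.continuousLinearMapAt ℝ x (cov σ x w - trivializationCov e σ x w) := by
    rw [← sub_apply, ← hdiff, ← congrArg (IsCovariantDerivativeOn.difference _ _ x)
      (e.symmL_continuousLinearMapAt (R := ℝ) hx (σ x))]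
    conv_rhs => rw [← (trivializationAt EB (TangentSpace I) x₀).symmL_continuousLinearMapAt
      (R := ℝ) hx' w]
    rfl
  rw [hform, map_sub, trivializationCov, ContinuousLinearMap.comp_apply,
    e.continuousLinearMapAt_symmL hx, add_sub_cancel]

/-- The connection form at `x₀` in the preferred chart at `x₀`. -/
def connChart (x₀ : B) (y : EB) : EB →L[ℝ] F →L[ℝ] F :=
  connForm cov x₀ ((extChartAt I x₀).symm y)

theorem connChart_self (x₀ : B) : connChart cov x₀ (extChartAt I x₀ x₀) = connForm cov x₀ x₀ := by
  rw [connChart, extChartAt_to_inv]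

theorem differentiableAt_connChart [I.Boundaryless]
    (h : ContMDiffAt I 𝓘(ℝ, EB →L[ℝ] F →L[ℝ] F) ∞ (connForm cov x₀) x₀) :
    DifferentiableAt ℝ (connChart cov x₀) (extChartAt I x₀ x₀) :=
  differentiableAt_comp_extChartAt_symm (h.mdifferentiableAt (by simp))

variable {σ : ∀ x, V x}

theorem continuousLinearMapAt_cov_of_hasFDerivAt (hx : x ∈ (chartAt HB x₀).source)
    (hx' : x ∈ (trivializationAt F V x₀).baseSet) {σ' : EB →L[ℝ] F}
    (hσ : HasFDerivAt (sectionCoord I F x₀ σ) σ' (extChartAt I x₀ x)) (w : TangentSpace I x) :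
    (trivializationAt F V x₀).continuousLinearMapAt ℝ x (cov σ x w) =
      σ' ((trivializationAt EB (TangentSpace I) x₀).continuousLinearMapAt ℝ x w) +
        connForm cov x₀ x
          ((trivializationAt EB (TangentSpace I) x₀).continuousLinearMapAt ℝ x w)
          ((trivializationAt F V x₀).continuousLinearMapAt ℝ x (σ x)) := by
  have hcoord : ∀ᶠ y in 𝓝 (extChartAt I x₀ x),
      (trivializationAt F V x₀).continuousLinearMapAt ℝ ((extChartAt I x₀).symm y)
        (σ ((extChartAt I x₀).symm y)) = sectionCoord I F x₀ σ y := .of_forall fun _ => rfl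
  rw [continuousLinearMapAt_cov cov hx' hx ((mdifferentiableAt_section_iff_coord _ hx').2
    (hasMFDerivAt_of_extChartAt hx
      (g := fun y => (trivializationAt F V x₀).continuousLinearMapAt ℝ y (σ y))
      hcoord hσ).mdifferentiableAt), mvfderiv_of_extChartAt hx
      (g := fun y => (trivializationAt F V x₀).continuousLinearMapAt ℝ y (σ y)) hcoord hσ]

theorem continuousLinearMapAt_cov_self
    (hσ : DifferentiableAt ℝ (sectionCoord I F x₀ σ) (extChartAt I x₀ x₀))
    (X : ∀ x, TangentSpace I x) :
    (trivializationAt F V x₀).continuousLinearMapAt ℝ x₀ (cov σ x₀ (X x₀)) =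
      chartCov (connChart cov x₀) (sectionCoord I EB x₀ X) (sectionCoord I F x₀ σ)
        (extChartAt I x₀ x₀) := by
  rw [continuousLinearMapAt_cov_of_hasFDerivAt cov (mem_chart_source HB x₀)
    (mem_baseSet_trivializationAt F V x₀) hσ.hasFDerivAt, chartCov, sectionCoord_self x₀ σ,
    sectionCoord_self x₀ X, connChart_self]

theorem sectionCoord_cov [I.Boundaryless] (Y : ∀ x, TangentSpace I x)
    (hσ : ∀ᶠ y in 𝓝 (extChartAt I x₀ x₀), DifferentiableAt ℝ (sectionCoord I F x₀ σ) y) :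
    sectionCoord I F x₀ (fun y => cov σ y (Y y)) =ᶠ[𝓝 (extChartAt I x₀ x₀)]
      chartCov (connChart cov x₀) (sectionCoord I EB x₀ Y) (sectionCoord I F x₀ σ) := by
  have hbase : ∀ᶠ y in 𝓝 (extChartAt I x₀ x₀),
      (extChartAt I x₀).symm y ∈ (trivializationAt F V x₀).baseSet :=
    (continuousAt_extChartAt_symm x₀).preimage_mem_nhds (by
      rw [extChartAt_to_inv]
      exact baseSet_trivializationAt_mem_nhds x₀)
  filter_upwards [hσ, extChartAt_target_mem_nhds (I := I) x₀, hbase] with y hy htarget hybase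
  rw [← (extChartAt I x₀).right_inv htarget] at hy
  refine (continuousLinearMapAt_cov_of_hasFDerivAt cov (extChartAt_symm_mem_baseSet htarget)
    hybase hy.hasFDerivAt _).trans ?_
  rw [(extChartAt I x₀).right_inv htarget]
  rfl

end ConnectionForm

section SmoothConnection

variable {E : Type*} [NormedAddCommGroup E] [NormedSpace ℝ E]
  {F : Type*} [NormedAddCommGroup F] [NormedSpace ℝ F] [FiniteDimensional ℝ F]
  {M : Type*} [TopologicalSpace M] [ChartedSpace E M] [IsManifold 𝓘(ℝ, E) ∞ M]
  {V : M → Type*} [TopologicalSpace (TotalSpace F V)]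
  [∀ x, AddCommGroup (V x)] [∀ x, Module ℝ (V x)] [∀ x, TopologicalSpace (V x)]
  [∀ x, IsTopologicalAddGroup (V x)] [∀ x, ContinuousSMul ℝ (V x)]
  [FiberBundle F V] [VectorBundle ℝ F V] [ContMDiffVectorBundle ∞ F V 𝓘(ℝ, E)]
  (cov : CovariantDerivative 𝓘(ℝ, E) F V)

theorem continuousLinearMapAt_curvature {X Y : ∀ x : M, TangentSpace 𝓘(ℝ, E) x} {σ : ∀ x, V x}
    {x₀ : M}
    (hA : DifferentiableAt ℝ (connChart cov x₀) (extChartAt 𝓘(ℝ, E) x₀ x₀))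
    (hX : ContMDiffAt 𝓘(ℝ, E) (𝓘(ℝ, E).prod 𝓘(ℝ, E)) ∞ (fun x => TotalSpace.mk' E x (X x)) x₀)
    (hY : ContMDiffAt 𝓘(ℝ, E) (𝓘(ℝ, E).prod 𝓘(ℝ, E)) ∞ (fun x => TotalSpace.mk' E x (Y x)) x₀)
    (hσ : ContMDiffAt 𝓘(ℝ, E) (𝓘(ℝ, E).prod 𝓘(ℝ, F)) ∞ (fun x => TotalSpace.mk' F x (σ x)) x₀) :
    (trivializationAt F V x₀).continuousLinearMapAt ℝ x₀
        (cov (fun y => cov σ y (Y y)) x₀ (X x₀) - cov (fun y => cov σ y (X y)) x₀ (Y x₀)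
          - cov σ x₀ (VectorField.mlieBracket 𝓘(ℝ, E) X Y x₀)) =
      curvatureForm (connChart cov x₀) (extChartAt 𝓘(ℝ, E) x₀ x₀)
        (sectionCoord 𝓘(ℝ, E) E x₀ X (extChartAt 𝓘(ℝ, E) x₀ x₀))
        (sectionCoord 𝓘(ℝ, E) E x₀ Y (extChartAt 𝓘(ℝ, E) x₀ x₀))
        (sectionCoord 𝓘(ℝ, E) F x₀ σ (extChartAt 𝓘(ℝ, E) x₀ x₀)) := by
  have hX' := (contDiffAt_sectionCoord hX).differentiableAt (by simp)
  have hY' := (contDiffAt_sectionCoord hY).differentiableAt (by simp)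
  have hσ' : ContDiffAt ℝ 2 (sectionCoord 𝓘(ℝ, E) F x₀ σ) (extChartAt 𝓘(ℝ, E) x₀ x₀) :=
    (contDiffAt_sectionCoord hσ).of_le (WithTop.coe_le_coe.2 (le_top : (2 : ℕ∞) ≤ ⊤))
  have hσ'' : ∀ᶠ y in 𝓝 (extChartAt 𝓘(ℝ, E) x₀ x₀),
      DifferentiableAt ℝ (sectionCoord 𝓘(ℝ, E) F x₀ σ) y :=
    (hσ'.eventually (by simp)).mono fun y hy => hy.differentiableAt two_ne_zero
  have hiterated (X Y : ∀ x : M, TangentSpace 𝓘(ℝ, E) x)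
      (hY : DifferentiableAt ℝ (sectionCoord 𝓘(ℝ, E) E x₀ Y) (extChartAt 𝓘(ℝ, E) x₀ x₀)) :
      (trivializationAt F V x₀).continuousLinearMapAt ℝ x₀
          (cov (fun y => cov σ y (Y y)) x₀ (X x₀)) =
        chartCov (connChart cov x₀) (sectionCoord 𝓘(ℝ, E) E x₀ X)
          (chartCov (connChart cov x₀) (sectionCoord 𝓘(ℝ, E) E x₀ Y)
            (sectionCoord 𝓘(ℝ, E) F x₀ σ)) (extChartAt 𝓘(ℝ, E) x₀ x₀) := by
    have hcov := sectionCoord_cov cov Y hσ''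
    rw [continuousLinearMapAt_cov_self cov (hcov.differentiableAt_iff.2
      (hasFDerivAt_chartCov hA hY hσ').differentiableAt), chartCov, hcov.fderiv_eq, hcov.eq_of_nhds]
    rfl
  have hbracket : sectionCoord 𝓘(ℝ, E) E x₀ (VectorField.mlieBracket 𝓘(ℝ, E) X Y)
      (extChartAt 𝓘(ℝ, E) x₀ x₀) = VectorField.lieBracket ℝ (sectionCoord 𝓘(ℝ, E) E x₀ X)
        (sectionCoord 𝓘(ℝ, E) E x₀ Y) (extChartAt 𝓘(ℝ, E) x₀ x₀) :=
    (sectionCoord_self x₀ _).trans (continuousLinearMapAt_mlieBracket x₀ X Y)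
  rw [map_sub, map_sub, hiterated X Y hY', hiterated Y X hX',
    continuousLinearMapAt_cov_self cov hσ''.self_of_nhds, ← chartCov_commutator hA hX' hY' hσ']
  simp only [chartCov, hbracket]

/-- The curvature form vanishes at the centre of each chart. -/
def HasZeroCurvature : Prop :=
  ∀ (x₀ : M) (u v : E) (ξ : F),
    curvatureForm (connChart cov x₀) (extChartAt 𝓘(ℝ, E) x₀ x₀) u v ξ = 0

theorem isFlat_iff
    (hA : ∀ x₀, DifferentiableAt ℝ (connChart cov x₀) (extChartAt 𝓘(ℝ, E) x₀ x₀)) :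
    IsFlat cov ↔ HasZeroCurvature cov := by
  constructor
  · intro h x₀ u v ξ
    have hV := mem_baseSet_trivializationAt F V x₀
    have hT := mem_baseSet_trivializationAt E (TangentSpace 𝓘(ℝ, E)) x₀
    have hV' := baseSet_trivializationAt_mem_nhds (G := F) (W := V) x₀
    have hT' := baseSet_trivializationAt_mem_nhds (G := E) (W := TangentSpace 𝓘(ℝ, E)) x₀
    have hX (u : E) := contMDiffOn_symmL (I := 𝓘(ℝ, E)) (n := ∞)
      (trivializationAt E (TangentSpace 𝓘(ℝ, E)) x₀) u
    have hσ := contMDiffOn_symmL (I := 𝓘(ℝ, E)) (n := ∞) (trivializationAt F V x₀) ξ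
    have hzero := h _ ((trivializationAt F V x₀).open_baseSet.inter
        (trivializationAt E (TangentSpace 𝓘(ℝ, E)) x₀).open_baseSet) _ _ _
      ((hX u).mono Set.inter_subset_right) ((hX v).mono Set.inter_subset_right)
      (hσ.mono Set.inter_subset_left) x₀ ⟨hV, hT⟩
    have hcurv := continuousLinearMapAt_curvature cov (hA x₀) ((hX u).contMDiffAt hT')
      ((hX v).contMDiffAt hT') (hσ.contMDiffAt hV')
    rw [hzero, map_zero, sectionCoord_self, sectionCoord_self, sectionCoord_self,
      Trivialization.continuousLinearMapAt_symmL _ hV,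
      Trivialization.continuousLinearMapAt_symmL _ hT,
      Trivialization.continuousLinearMapAt_symmL _ hT] at hcurv
    exact hcurv.symm
  · intro h U hU X Y σ hX hY hσ x hx
    have hcurv := continuousLinearMapAt_curvature cov (hA x) (hX.contMDiffAt (hU.mem_nhds hx))
      (hY.contMDiffAt (hU.mem_nhds hx)) (hσ.contMDiffAt (hU.mem_nhds hx))
    rw [h] at hcurv
    have hsymmL := congrArg ((trivializationAt F V x).symmL ℝ x) hcurv
    rwa [Trivialization.symmL_continuousLinearMapAt _ (mem_baseSet_trivializationAt F V x),
      map_zero] at hsymmL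

theorem contMDiffAt_connForm [FiniteDimensional ℝ E] [T2Space M]
    (hsmooth : CovariantDerivative.ContMDiffCovariantDerivative cov ∞) (x₀ : M) :
    ContMDiffAt 𝓘(ℝ, E) 𝓘(ℝ, E →L[ℝ] F →L[ℝ] F) ∞ (connForm cov x₀) x₀ := by
  refine contMDiffAt_clm_of_apply fun u => contMDiffAt_clm_of_apply fun ξ => ?_
  set e := trivializationAt F V x₀
  have hx₀ : x₀ ∈ e.baseSet := mem_baseSet_trivializationAt F V x₀
  obtain ⟨ψ, -, hψ⟩ := (SmoothBumpFunction.nhds_basis_tsupport (I := 𝓘(ℝ, E)) x₀).mem_iff.1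
    (e.open_baseSet.mem_nhds hx₀)
  have hglobal : ContMDiff 𝓘(ℝ, E) (𝓘(ℝ, E).prod 𝓘(ℝ, F)) ∞
      (fun y => TotalSpace.mk' F y (ψ y • e.symmL ℝ y ξ)) :=
    ContMDiffOn.smul_section_of_tsupport ψ.contMDiff.contMDiffOn e.open_baseSet hψ
      (contMDiffOn_symmL e ξ)
  have hcov := (hsmooth.contMDiff.contMDiff (σ := fun y => ψ y • e.symmL ℝ y ξ)
    (by simpa using hglobal.contMDiffOn)).contMDiffAt (Filter.univ_mem (f := 𝓝 x₀))
  rw [contMDiffAt_hom_bundle] at hcov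
  refine (hcov.2.clm_apply (contMDiffAt_const (c := u))).congr_of_eventuallyEq ?_
  filter_upwards [ψ.eventuallyEq_one.eventually_nhds, e.open_baseSet.mem_nhds hx₀] with y hy hye
  have hlocal : cov (fun y => ψ y • e.symmL ℝ y ξ) y = cov (fun y => e.symmL ℝ y ξ) y := by
    refine cov.isCovariantDerivativeOn.congr_of_eventuallyEq
      (hglobal.mdifferentiableAt (by simp)) (mdifferentiableAt_symmL e hye ξ) Filter.univ_mem ?_
    filter_upwards [hy] with z hz
    rw [hz, Pi.one_apply, one_smul]
  rw [connForm_apply cov hye, ← hlocal]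
  rfl

end SmoothConnection

section DualConnectionForm

scoped instance {F : Type*} [NormedAddCommGroup F] [NormedSpace ℝ F] :
    NormedAddCommGroup ((F →L[ℝ] ℝ) →L[ℝ] F →L[ℝ] ℝ) :=
  ContinuousLinearMap.toNormedAddCommGroup

scoped instance {F : Type*} [NormedAddCommGroup F] [NormedSpace ℝ F] :
    AddCommGroup ((F →L[ℝ] ℝ) →L[ℝ] F →L[ℝ] ℝ) := inferInstance

scoped instance {F : Type*} [NormedAddCommGroup F] [NormedSpace ℝ F] :
    NormedSpace ℝ ((F →L[ℝ] ℝ) →L[ℝ] F →L[ℝ] ℝ) :=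
  ContinuousLinearMap.toNormedSpace

scoped instance {E F : Type*} [NormedAddCommGroup E] [NormedSpace ℝ E] [NormedAddCommGroup F]
    [NormedSpace ℝ F] : NormedAddCommGroup (E →L[ℝ] (F →L[ℝ] ℝ) →L[ℝ] F →L[ℝ] ℝ) :=
  ContinuousLinearMap.toNormedAddCommGroup

scoped instance {E F : Type*} [NormedAddCommGroup E] [NormedSpace ℝ E] [NormedAddCommGroup F]
    [NormedSpace ℝ F] : AddCommGroup (E →L[ℝ] (F →L[ℝ] ℝ) →L[ℝ] F →L[ℝ] ℝ) := inferInstance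

variable {E : Type*} [NormedAddCommGroup E] [NormedSpace ℝ E]
  {F : Type*} [NormedAddCommGroup F] [NormedSpace ℝ F]
  {A : E → E →L[ℝ] F →L[ℝ] F} {A' : E → E →L[ℝ] (F →L[ℝ] ℝ) →L[ℝ] F →L[ℝ] ℝ} {y : E}

theorem hasFDerivAt_clm_apply_const {P Q R : Type*} [NormedAddCommGroup P] [NormedSpace ℝ P]
    [NormedAddCommGroup Q] [NormedSpace ℝ Q] [NormedAddCommGroup R] [NormedSpace ℝ R]
    {c : P → Q →L[ℝ] R} {c' : P →L[ℝ] Q →L[ℝ] R} {x : P} (h : HasFDerivAt c c' x) (v : Q) :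
    HasFDerivAt (fun y => c y v) (c'.flip v) x :=
  (ContinuousLinearMap.apply ℝ R v).hasFDerivAt.comp x h

theorem fderiv_dual_connection_form (hA : DifferentiableAt ℝ A y) (hA' : DifferentiableAt ℝ A' y)
    (hdual : ∀ᶠ z in 𝓝 y, ∀ u f ξ, A' z u f ξ = -f (A z u ξ)) (u v : E) (f : F →L[ℝ] ℝ) (ξ : F) :
    fderiv ℝ A' y u v f ξ = -f (fderiv ℝ A y u v ξ) := by
  have hleft := hasFDerivAt_clm_apply_const (hasFDerivAt_clm_apply_const
    (hasFDerivAt_clm_apply_const hA'.hasFDerivAt v) f) ξ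
  have hright := (f.hasFDerivAt.comp y (hasFDerivAt_clm_apply_const
    (hasFDerivAt_clm_apply_const hA.hasFDerivAt v) ξ)).fun_neg
  exact DFunLike.congr_fun
    (hleft.unique (hright.congr_of_eventuallyEq (hdual.mono fun z hz => hz v f ξ))) u

theorem curvatureForm_dual (hA : DifferentiableAt ℝ A y) (hA' : DifferentiableAt ℝ A' y)
    (hdual : ∀ᶠ z in 𝓝 y, ∀ u f ξ, A' z u f ξ = -f (A z u ξ)) (u v : E) (f : F →L[ℝ] ℝ) (ξ : F) :
    curvatureForm A' y u v f ξ = -f (curvatureForm A y u v ξ) := by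
  have hdual_y := hdual.self_of_nhds
  simp only [curvatureForm, sub_apply, add_apply, fderiv_dual_connection_form hA hA' hdual, hdual_y,
    map_sub, map_add]
  ring

end DualConnectionForm

section DualTrivialization

variable {B : Type*} [TopologicalSpace B]
  {F : Type*} [NormedAddCommGroup F] [NormedSpace ℝ F]
  {V : B → Type*} [TopologicalSpace (TotalSpace F V)]
  [∀ x, AddCommGroup (V x)] [∀ x, Module ℝ (V x)] [∀ x, TopologicalSpace (V x)]
  [FiberBundle F V] [VectorBundle ℝ F V] {x₀ x : B}

theorem dualBundle_trivializationAt_baseSet (x₀ : B) :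
    (trivializationAt (F →L[ℝ] ℝ) (DualBundle V) x₀).baseSet =
      (trivializationAt F V x₀).baseSet := by
  rw [hom_trivializationAt_baseSet]
  exact Set.inter_univ _

theorem dualBundle_continuousLinearMapAt (hx : x ∈ (trivializationAt F V x₀).baseSet)
    (f : DualBundle V x) :
    (trivializationAt (F →L[ℝ] ℝ) (DualBundle V) x₀).continuousLinearMapAt ℝ x f =
      f.comp ((trivializationAt F V x₀).symmL ℝ x) := by
  rw [Trivialization.continuousLinearMapAt_apply, Trivialization.coe_linearMapAt_of_mem _
    (by rwa [dualBundle_trivializationAt_baseSet])]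
  change (trivializationAt (F →L[ℝ] ℝ) (fun x => V x →L[ℝ] ℝ) x₀ ⟨x, f⟩).2 = _
  rw [hom_trivializationAt_apply]
  ext v
  simp [ContinuousLinearMap.inCoordinates]

theorem dualBundle_symmL (hx : x ∈ (trivializationAt F V x₀).baseSet) (f : F →L[ℝ] ℝ) :
    (trivializationAt (F →L[ℝ] ℝ) (DualBundle V) x₀).symmL ℝ x f =
      f.comp ((trivializationAt F V x₀).continuousLinearMapAt ℝ x) := by
  have hcoord := dualBundle_continuousLinearMapAt hx
    (f.comp ((trivializationAt F V x₀).continuousLinearMapAt ℝ x))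
  have hcancel : (f.comp ((trivializationAt F V x₀).continuousLinearMapAt ℝ x)).comp
      ((trivializationAt F V x₀).symmL ℝ x) = f := by
    ext ξ
    exact congrArg f (Trivialization.continuousLinearMapAt_symmL _ hx ξ)
  rw [hcancel] at hcoord
  rw [← congrArg ((trivializationAt (F →L[ℝ] ℝ) (DualBundle V) x₀).symmL ℝ x) hcoord,
    Trivialization.symmL_continuousLinearMapAt _ (by rwa [dualBundle_trivializationAt_baseSet])]

end DualTrivialization

section DualConnection

variable {E : Type*} [NormedAddCommGroup E] [NormedSpace ℝ E] [FiniteDimensional ℝ E]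
  {F : Type*} [NormedAddCommGroup F] [NormedSpace ℝ F] [FiniteDimensional ℝ F]
  {M : Type*} [TopologicalSpace M] [ChartedSpace E M] [IsManifold 𝓘(ℝ, E) ∞ M]
  {V : M → Type*} [TopologicalSpace (TotalSpace F V)]
  [∀ x, AddCommGroup (V x)] [∀ x, Module ℝ (V x)] [∀ x, TopologicalSpace (V x)]
  [∀ x, IsTopologicalAddGroup (V x)] [∀ x, ContinuousSMul ℝ (V x)]
  [FiberBundle F V] [VectorBundle ℝ F V] [ContMDiffVectorBundle ∞ F V 𝓘(ℝ, E)]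
  (cov : CovariantDerivative 𝓘(ℝ, E) F V)

theorem connForm_dualConn {x₀ x : M} (hx : x ∈ (trivializationAt F V x₀).baseSet) (u : E)
    (f : F →L[ℝ] ℝ) (ξ : F) :
    connForm (dualConn cov) x₀ x u f ξ = -f (connForm cov x₀ x u ξ) := by
  set e := trivializationAt F V x₀
  set e' := trivializationAt (F →L[ℝ] ℝ) (DualBundle V) x₀
  have hx' : x ∈ e'.baseSet := by rwa [dualBundle_trivializationAt_baseSet]
  have hconst : (fun y => e'.symmL ℝ y f (e.symmL ℝ y ξ)) =ᶠ[𝓝 x] fun _ => f ξ := by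
    filter_upwards [e.open_baseSet.mem_nhds hx] with y hy
    rw [dualBundle_symmL hy, ContinuousLinearMap.comp_apply, e.continuousLinearMapAt_symmL hy]
  have hderiv : mvfderiv 𝓘(ℝ, E) (fun y => e'.symmL ℝ y f (e.symmL ℝ y ξ)) x = 0 := by
    rw [mvfderiv, hconst.mfderiv_eq]
    exact mvfderiv_const _
  have hleibniz := dualConnFun_apply cov (mdifferentiableAt_symmL e' hx' f)
    (mdifferentiableAt_symmL e hx ξ) ((trivializationAt E (TangentSpace 𝓘(ℝ, E)) x₀).symmL ℝ x u)
  rw [hderiv, dualBundle_symmL hx, ContinuousLinearMap.comp_apply, zero_apply,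
    zero_sub] at hleibniz
  rw [connForm_apply _ hx', connForm_apply _ hx, dualBundle_continuousLinearMapAt hx]
  exact hleibniz

theorem contMDiffAt_connForm_dualConn {x₀ : M}
    (h : ContMDiffAt 𝓘(ℝ, E) 𝓘(ℝ, E →L[ℝ] F →L[ℝ] F) ∞ (connForm cov x₀) x₀) :
    ContMDiffAt 𝓘(ℝ, E) 𝓘(ℝ, E →L[ℝ] (F →L[ℝ] ℝ) →L[ℝ] F →L[ℝ] ℝ) ∞
      (connForm (dualConn cov) x₀) x₀ := by
  refine contMDiffAt_clm_of_apply fun u => contMDiffAt_clm_of_apply fun f =>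
    contMDiffAt_clm_of_apply fun ξ => ?_
  have hentry := (h.clm_apply (contMDiffAt_const (c := u))).clm_apply (contMDiffAt_const (c := ξ))
  refine ((f.contMDiff (n := ∞)).contMDiffAt.comp x₀ hentry).neg.congr_of_eventuallyEq ?_
  filter_upwards [baseSet_trivializationAt_mem_nhds (G := F) (W := V) x₀] with x hx
  rw [connForm_dualConn cov hx]
  rfl

theorem connChart_dualConn_eventually (x₀ : M) :
    ∀ᶠ y in 𝓝 (extChartAt 𝓘(ℝ, E) x₀ x₀), ∀ u f ξ,
      connChart (dualConn cov) x₀ y u f ξ = -f (connChart cov x₀ y u ξ) := by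
  have htendsto := continuousAt_extChartAt_symm (I := 𝓘(ℝ, E)) x₀
  rw [ContinuousAt, extChartAt_to_inv] at htendsto
  filter_upwards [htendsto (baseSet_trivializationAt_mem_nhds (G := F) (W := V) x₀)] with y hy u f ξ
  exact connForm_dualConn cov hy u f ξ

theorem isFlat_dualConn
    (hA : ∀ x₀, ContMDiffAt 𝓘(ℝ, E) 𝓘(ℝ, E →L[ℝ] F →L[ℝ] F) ∞ (connForm cov x₀) x₀)
    (h : IsFlat cov) : IsFlat (dualConn cov) := by
  have hdiff := fun x₀ => differentiableAt_connChart cov (hA x₀)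
  have hdiff' := fun x₀ => differentiableAt_connChart (dualConn cov)
    (contMDiffAt_connForm_dualConn cov (hA x₀))
  rw [isFlat_iff _ hdiff] at h
  rw [isFlat_iff _ hdiff']
  intro x₀ u v f
  ext ξ
  rw [curvatureForm_dual (hdiff x₀) (hdiff' x₀) (connChart_dualConn_eventually cov x₀), h, map_zero,
    neg_zero, zero_apply]

end DualConnection

section TrivializationChange

variable {F : Type*} [NormedAddCommGroup F] [NormedSpace ℝ F]
  {B : Type*} [TopologicalSpace B] {V : B → Type*} [TopologicalSpace (TotalSpace F V)]
  [∀ x, AddCommGroup (V x)] [∀ x, Module ℝ (V x)] [∀ x, TopologicalSpace (V x)]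
  [FiberBundle F V] [VectorBundle ℝ F V] {q : TotalSpace F V} {x : B}
  (e e' : Trivialization F (π F V)) [MemTrivializationAtlas e] [MemTrivializationAtlas e']

theorem apply_snd_eq_continuousLinearMapAt (hq : q.proj ∈ e.baseSet) :
    (e q).2 = e.continuousLinearMapAt ℝ q.proj q.snd := by
  rw [Trivialization.continuousLinearMapAt_apply, Trivialization.coe_linearMapAt_of_mem _ hq]

theorem continuousLinearMapAt_symmL_eq_coordChangeL (hx : x ∈ e.baseSet)
    (hx' : x ∈ e'.baseSet) (ξ : F) :
    e'.continuousLinearMapAt ℝ x (e.symmL ℝ x ξ) = e.coordChangeL ℝ e' x ξ := by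
  rw [Trivialization.continuousLinearMapAt_apply, Trivialization.coe_linearMapAt_of_mem _ hx',
    e.symmL_apply hx]
  exact (e.coordChangeL_apply (R := ℝ) e' ⟨hx, hx'⟩ ξ).symm

theorem apply_snd_eq_coordChangeL (hq : q.proj ∈ e.baseSet) (hq' : q.proj ∈ e'.baseSet) :
    (e' q).2 = e.coordChangeL ℝ e' q.proj (e q).2 := by
  rw [← continuousLinearMapAt_symmL_eq_coordChangeL e e' hq hq',
    apply_snd_eq_continuousLinearMapAt e hq, apply_snd_eq_continuousLinearMapAt e' hq',
    e.symmL_continuousLinearMapAt hq]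

variable {EB : Type*} [NormedAddCommGroup EB] [NormedSpace ℝ EB]
  {HB : Type*} [TopologicalSpace HB] {I : ModelWithCorners ℝ EB HB} [ChartedSpace HB B]

theorem trivializationCov_symmL_of_mem (hx : x ∈ e.baseSet) (hx' : x ∈ e'.baseSet) (ξ : F)
    (u : TangentSpace I x) :
    trivializationCov e' (fun y => e.symmL ℝ y ξ) x u =
      e'.symmL ℝ x (mvfderiv I (fun y => e.coordChangeL ℝ e' y ξ) x u) := by
  have hchange : (fun y => e'.continuousLinearMapAt ℝ y (e.symmL ℝ y ξ)) =ᶠ[𝓝 x]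
      fun y => e.coordChangeL ℝ e' y ξ := by
    filter_upwards [e.open_baseSet.mem_nhds hx, e'.open_baseSet.mem_nhds hx'] with y hy hy'
    exact continuousLinearMapAt_symmL_eq_coordChangeL e e' hy hy' ξ
  rw [trivializationCov, mvfderiv, hchange.mfderiv_eq]
  rfl

variable [ContMDiffVectorBundle 1 F V I] [FiniteDimensional ℝ F]
  [∀ x, IsTopologicalAddGroup (V x)] [∀ x, ContinuousSMul ℝ (V x)]
  (cov : CovariantDerivative I F V)

theorem cov_symmL_change (hx : x ∈ e.baseSet) (hx' : x ∈ e'.baseSet) (ξ : F)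
    (u : TangentSpace I x) :
    cov (fun y => e.symmL ℝ y ξ) x u =
      e'.symmL ℝ x (mvfderiv I (fun y => e.coordChangeL ℝ e' y ξ) x u) +
        cov (fun y => e'.symmL ℝ y (e.coordChangeL ℝ e' x ξ)) x u := by
  have hdifference (σ : ∀ x, V x)
      (hσ : MDifferentiableAt I (I.prod 𝓘(ℝ, F)) (fun y => TotalSpace.mk' F y (σ y)) x) :=
    IsCovariantDerivativeOn.difference_apply cov.isCovariantDerivativeOn (s := _)
      (isCovariantDerivativeOn_trivializationCov e') hx' hσ
  have hvalue : e'.symmL ℝ x (e.coordChangeL ℝ e' x ξ) = e.symmL ℝ x ξ := by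
    rw [← continuousLinearMapAt_symmL_eq_coordChangeL e e' hx hx',
      e'.symmL_continuousLinearMapAt hx']
  have hconst := hdifference _ (mdifferentiableAt_symmL e' hx' (e.coordChangeL ℝ e' x ξ))
  rw [hvalue, hdifference _ (mdifferentiableAt_symmL e hx ξ), trivializationCov_symmL e' hx',
    sub_zero] at hconst
  rw [← hconst, ← trivializationCov_symmL_of_mem e e' hx hx', ← add_apply, add_sub_cancel]

end TrivializationChange

section VerticalProjection

theorem mvfderiv_clm_apply {E : Type*} [NormedAddCommGroup E] [NormedSpace ℝ E]
    {H : Type*} [TopologicalSpace H] {I : ModelWithCorners ℝ E H}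
    {B : Type*} [TopologicalSpace B] [ChartedSpace H B]
    {P Q : Type*} [NormedAddCommGroup P] [NormedSpace ℝ P] [NormedAddCommGroup Q] [NormedSpace ℝ Q]
    {c : B → P →L[ℝ] Q} {f : B → P} {x : B} (hc : MDifferentiableAt I 𝓘(ℝ, P →L[ℝ] Q) c x)
    (hf : MDifferentiableAt I 𝓘(ℝ, P) f x) (w : TangentSpace I x) :
    mvfderiv I (fun y => c y (f y)) x w = mvfderiv I c x w (f x) + c x (mvfderiv I f x w) := by
  let dc : E →L[ℝ] P →L[ℝ] Q := mvfderiv I c x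
  let df : E →L[ℝ] P := mvfderiv I f x
  have hdc : HasFDerivWithinAt (c ∘ (extChartAt I x).symm) dc (Set.range I) (extChartAt I x x) :=
    hc.hasMFDerivAt.2
  have hdf : HasFDerivWithinAt (f ∘ (extChartAt I x).symm) df (Set.range I) (extChartAt I x x) :=
    hf.hasMFDerivAt.2
  have happly := hdc.clm_apply hdf
  simp only [Function.comp_apply, extChartAt_to_inv] at happly
  have hderiv : HasMFDerivAt I 𝓘(ℝ, Q) (fun y => c y (f y)) x
      ((c x).comp df + dc.flip (f x)) :=
    ⟨hc.continuousAt.clm_apply hf.continuousAt, happly⟩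
  exact (DFunLike.congr_fun hderiv.mfderiv w).trans (add_comm _ _)

variable {EB : Type*} [NormedAddCommGroup EB] [NormedSpace ℝ EB]
  {HB : Type*} [TopologicalSpace HB] {I : ModelWithCorners ℝ EB HB}
  {B : Type*} [TopologicalSpace B] [ChartedSpace HB B]
  {F : Type*} [NormedAddCommGroup F] [NormedSpace ℝ F]
  {V : B → Type*} [TopologicalSpace (TotalSpace F V)] [∀ x, TopologicalSpace (V x)]
  [FiberBundle F V]

theorem mdifferentiableAt_proj (q : TotalSpace F V) :
    MDifferentiableAt (I.prod 𝓘(ℝ, F)) I (fun r : TotalSpace F V => r.proj) q :=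
  (contMDiffAt_proj (n := 1) (IB := I) V).mdifferentiableAt one_ne_zero

variable [∀ x, AddCommGroup (V x)] [∀ x, Module ℝ (V x)] [VectorBundle ℝ F V]
  [ContMDiffVectorBundle 1 F V I] {q : TotalSpace F V}
  (e e' : Trivialization F (π F V)) [MemTrivializationAtlas e] [MemTrivializationAtlas e']

theorem mdifferentiableAt_apply_snd (hq : q.proj ∈ e.baseSet) :
    MDifferentiableAt (I.prod 𝓘(ℝ, F)) 𝓘(ℝ, F) (fun r : TotalSpace F V => (e r).2) q :=
  (((Bundle.Trivialization.contMDiffOn (n := 1) (IB := I) e).contMDiffAt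
    (e.open_source.mem_nhds (e.mem_source.2 hq))).mdifferentiableAt one_ne_zero).snd

theorem mvfderiv_apply_snd_change (hq : q.proj ∈ e.baseSet) (hq' : q.proj ∈ e'.baseSet)
    (w : TangentSpace (I.prod 𝓘(ℝ, F)) q) :
    mvfderiv (I.prod 𝓘(ℝ, F)) (fun r : TotalSpace F V => (e' r).2) q w =
      mvfderiv I (fun y => e.coordChangeL ℝ e' y (e q).2) q.proj
        (mfderiv (I.prod 𝓘(ℝ, F)) I (fun r : TotalSpace F V => r.proj) q w) +
      e.coordChangeL ℝ e' q.proj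
        (mvfderiv (I.prod 𝓘(ℝ, F)) (fun r : TotalSpace F V => (e r).2) q w) := by
  let g : B → F →L[ℝ] F := fun y => (e.coordChangeL ℝ e' y : F →L[ℝ] F)
  have hg : MDifferentiableAt I 𝓘(ℝ, F →L[ℝ] F) g q.proj :=
    (contMDiffAt_coordChangeL (n := 1) (IB := I) hq hq').mdifferentiableAt one_ne_zero
  have hproj := mdifferentiableAt_proj (I := I) q
  have hchange : (fun r : TotalSpace F V => (e' r).2) =ᶠ[𝓝 q]
      fun r => (g ∘ fun r : TotalSpace F V => r.proj) r (e r).2 := by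
    filter_upwards [e.open_source.mem_nhds (e.mem_source.2 hq),
      e'.open_source.mem_nhds (e'.mem_source.2 hq')] with r hr hr'
    exact apply_snd_eq_coordChangeL e e' (e.mem_source.1 hr) (e'.mem_source.1 hr')
  have hbase : mvfderiv (I.prod 𝓘(ℝ, F)) (g ∘ fun r : TotalSpace F V => r.proj) q w =
      mvfderiv I g q.proj
        (mfderiv (I.prod 𝓘(ℝ, F)) I (fun r : TotalSpace F V => r.proj) q w) :=
    mfderiv_comp_apply q hg hproj w
  have hconst := mvfderiv_clm_apply hg (mdifferentiableAt_const (c := (e q).2))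
    (mfderiv (I.prod 𝓘(ℝ, F)) I (fun r : TotalSpace F V => r.proj) q w)
  rw [mvfderiv_const, zero_apply, map_zero, add_zero] at hconst
  rw [mvfderiv, hchange.mfderiv_eq]
  refine (mvfderiv_clm_apply (hg.comp q hproj) (mdifferentiableAt_apply_snd e hq) w).trans ?_
  rw [hbase]
  exact congrArg (· + _) hconst.symm

end VerticalProjection

section VerticalProjectionFormula

variable {E : Type*} [NormedAddCommGroup E] [NormedSpace ℝ E]
  {F : Type*} [NormedAddCommGroup F] [NormedSpace ℝ F] [FiniteDimensional ℝ F]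
  {M : Type*} [TopologicalSpace M] [ChartedSpace E M]
  {V : M → Type*} [TopologicalSpace (TotalSpace F V)]
  [∀ x, AddCommGroup (V x)] [∀ x, Module ℝ (V x)] [∀ x, TopologicalSpace (V x)]
  [∀ x, IsTopologicalAddGroup (V x)] [∀ x, ContinuousSMul ℝ (V x)]
  [FiberBundle F V] [VectorBundle ℝ F V] [ContMDiffVectorBundle ∞ F V 𝓘(ℝ, E)]

theorem vertProj_eq (cov : CovariantDerivative 𝓘(ℝ, E) F V) {q : TotalSpace F V}
    (e : Trivialization F (π F V)) [MemTrivializationAtlas e]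
    (hq : q.proj ∈ e.baseSet) (w : TangentSpace (𝓘(ℝ, E).prod 𝓘(ℝ, F)) q) :
    vertProj cov q w =
      e.symmL ℝ q.proj (mvfderiv (𝓘(ℝ, E).prod 𝓘(ℝ, F)) (fun r : TotalSpace F V => (e r).2) q w) +
      cov (fun y => e.symmL ℝ y (e q).2) q.proj
        (mfderiv (𝓘(ℝ, E).prod 𝓘(ℝ, F)) 𝓘(ℝ, E) (fun r : TotalSpace F V => r.proj) q w) := by
  set e' := trivializationAt F V q.proj
  have hq' : q.proj ∈ e'.baseSet := mem_baseSet_trivializationAt F V q.proj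
  set u := mfderiv (𝓘(ℝ, E).prod 𝓘(ℝ, F)) 𝓘(ℝ, E) (fun r : TotalSpace F V => r.proj) q w
  have hdef : vertProj cov q w = e'.symmL ℝ q.proj
      (mvfderiv (𝓘(ℝ, E).prod 𝓘(ℝ, F)) (fun r : TotalSpace F V => (e' r).2) q w) +
      cov (fun y => e'.symm y (e' q).2) q.proj u := rfl
  rw [hdef, cov_symm cov e' hq', mvfderiv_apply_snd_change e e' hq hq',
    cov_symmL_change e e' cov hq hq', map_add, ← apply_snd_eq_coordChangeL e e' hq hq', ←
    continuousLinearMapAt_symmL_eq_coordChangeL e e' hq hq', e'.symmL_continuousLinearMapAt hq']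
  abel

end VerticalProjectionFormula

section CoordinatesOfBundleMap

variable {B₁ B₂ : Type*} [TopologicalSpace B₁] [TopologicalSpace B₂]
  {G₁ : Type*} [NormedAddCommGroup G₁] [NormedSpace ℝ G₁]
  {W₁ : B₁ → Type*} [TopologicalSpace (TotalSpace G₁ W₁)]
  [∀ x, AddCommGroup (W₁ x)] [∀ x, Module ℝ (W₁ x)] [∀ x, TopologicalSpace (W₁ x)]
  [FiberBundle G₁ W₁]
  {G₂ : Type*} [NormedAddCommGroup G₂] [NormedSpace ℝ G₂]
  {W₂ : B₂ → Type*} [TopologicalSpace (TotalSpace G₂ W₂)]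
  [∀ x, AddCommGroup (W₂ x)] [∀ x, Module ℝ (W₂ x)] [∀ x, TopologicalSpace (W₂ x)]
  [FiberBundle G₂ W₂]
  {e₁ : Trivialization G₁ (π G₁ W₁)} [e₁.IsLinear ℝ]
  {e₂ : Trivialization G₂ (π G₂ W₂)} [e₂.IsLinear ℝ] {x₁ : B₁} {x₂ : B₂}

variable [∀ x, IsTopologicalAddGroup (W₁ x)] [∀ x, ContinuousSMul ℝ (W₁ x)]
  [∀ x, IsTopologicalAddGroup (W₂ x)] [∀ x, ContinuousSMul ℝ (W₂ x)]

theorem coordGen_genMap (h₁ : x₁ ∈ e₁.baseSet) (h₂ : x₂ ∈ e₂.baseSet) {S : W₁ x₁ ≃L[ℝ] W₂ x₂}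
    {L : G₁ ≃L[ℝ] G₂}
    (hSL : ∀ w, e₂.continuousLinearMapAt ℝ x₂ (S w) = L (e₁.continuousLinearMapAt ℝ x₁ w))
    (a : Gen (W₁ x₁)) :
    coordGen e₂ x₂ (genMap S a) = genMap L (coordGen e₁ x₁ a) := by
  refine Prod.ext (hSL a.1) (ContinuousLinearMap.ext fun z => congrArg a.2 ?_)
  change S.symm (e₂.symmL ℝ x₂ z) = e₁.symmL ℝ x₁ (L.symm z)
  rw [ContinuousLinearEquiv.symm_apply_eq]
  have hsymm := hSL (e₁.symmL ℝ x₁ (L.symm z))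
  rw [e₁.continuousLinearMapAt_symmL h₁, L.apply_symm_apply] at hsymm
  exact (congrArg (e₂.symmL ℝ x₂) hsymm).symm.trans (e₂.symmL_continuousLinearMapAt h₂ _)

theorem genMap_coordEnd [FiniteDimensional ℝ G₁] [FiniteDimensional ℝ G₂]
    {J₁ : ∀ x, Gen (W₁ x) →ₗ[ℝ] Gen (W₁ x)} {J₂ : ∀ x, Gen (W₂ x) →ₗ[ℝ] Gen (W₂ x)}
    (h₁ : x₁ ∈ e₁.baseSet) (h₂ : x₂ ∈ e₂.baseSet) {S : W₁ x₁ ≃L[ℝ] W₂ x₂} {L : G₁ ≃L[ℝ] G₂}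
    (hSL : ∀ w, e₂.continuousLinearMapAt ℝ x₂ (S w) = L (e₁.continuousLinearMapAt ℝ x₁ w))
    (hSJ : ∀ a, genMap S (J₁ x₁ a) = J₂ x₂ (genMap S a)) (b : Gen G₁) :
    genMap L (coordEnd e₁ J₁ x₁ b) = coordEnd e₂ J₂ x₂ (genMap L b) := by
  obtain ⟨a, rfl⟩ : ∃ a, coordGen e₁ x₁ a = b := ⟨coordGenSymm e₁ x₁ b, coordGen_coordGenSymm h₁ b⟩
  rw [coordEnd_coordGen h₁, ← coordGen_genMap h₁ h₂ hSL, ← coordGen_genMap h₁ h₂ hSL,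
    coordEnd_coordGen h₂, hSJ]

end CoordinatesOfBundleMap

theorem mfderiv_prodMk_space {E : Type*} [NormedAddCommGroup E] [NormedSpace ℝ E]
    {H : Type*} [TopologicalSpace H] {I : ModelWithCorners ℝ E H}
    {B : Type*} [TopologicalSpace B] [ChartedSpace H B]
    {P Q : Type*} [NormedAddCommGroup P] [NormedSpace ℝ P] [NormedAddCommGroup Q] [NormedSpace ℝ Q]
    {f : B → P} {g : B → Q} {x : B} (hf : MDifferentiableAt I 𝓘(ℝ, P) f x)
    (hg : MDifferentiableAt I 𝓘(ℝ, Q) g x) (w : TangentSpace I x) :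
    mfderiv I 𝓘(ℝ, P × Q) (fun y => (f y, g y)) x w = (mvfderiv I f x w, mvfderiv I g x w) := by
  let df : E →L[ℝ] P := mvfderiv I f x
  let dg : E →L[ℝ] Q := mvfderiv I g x
  have hdf : HasFDerivWithinAt (f ∘ (extChartAt I x).symm) df (Set.range I) (extChartAt I x x) :=
    hf.hasMFDerivAt.2
  have hdg : HasFDerivWithinAt (g ∘ (extChartAt I x).symm) dg (Set.range I) (extChartAt I x x) :=
    hg.hasMFDerivAt.2
  have hderiv : HasMFDerivAt I 𝓘(ℝ, P × Q) (fun y => (f y, g y)) x (df.prod dg) :=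
    ⟨hf.continuousAt.prodMk hg.continuousAt, hdf.prodMk hdg⟩
  exact DFunLike.congr_fun hderiv.mfderiv w

section TotalSpaceCoordinates

variable {E : Type*} [NormedAddCommGroup E] [NormedSpace ℝ E]
  {F : Type*} [NormedAddCommGroup F]
  {M : Type*} [TopologicalSpace M] [ChartedSpace E M]
  {V : M → Type*} [TopologicalSpace (TotalSpace F V)] [∀ x, TopologicalSpace (V x)]
  [FiberBundle F V]

section

variable [NormedSpace ℝ F]

theorem extChartAt_totalSpace {p q : TotalSpace F V}
    (hq : q.proj ∈ (trivializationAt F V p.proj).baseSet) :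
    extChartAt (𝓘(ℝ, E).prod 𝓘(ℝ, F)) p q =
      (extChartAt 𝓘(ℝ, E) p.proj q.proj, (trivializationAt F V p.proj q).2) := by
  rw [FiberBundle.extChartAt]
  refine Prod.ext ?_ rfl
  change extChartAt 𝓘(ℝ, E) p.proj (trivializationAt F V p.proj q).1 = _
  rw [Trivialization.coe_fst' _ hq]

theorem extChartAt_totalSpace_self (p : TotalSpace F V) :
    extChartAt (𝓘(ℝ, E).prod 𝓘(ℝ, F)) p p =
      (extChartAt 𝓘(ℝ, E) p.proj p.proj, (trivializationAt F V p.proj p).2) :=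
  extChartAt_totalSpace (mem_baseSet_trivializationAt F V p.proj)

end

variable [∀ x, AddCommGroup (V x)] [IsManifold 𝓘(ℝ, E) ∞ M]

/-- The preferred trivialization at `x₀` of the bundle `V ⊕ T_M`, in which `F` and `F⁻¹ (π^* K) F`
are computed. -/
abbrev sumTrivializationAt (F : Type*) [NormedAddCommGroup F] (V : M → Type*)
    [TopologicalSpace (TotalSpace F V)] [∀ x, AddCommGroup (V x)] [∀ x, TopologicalSpace (V x)]
    [FiberBundle F V] (x₀ : M) :
    Trivialization (F × E) (π (F × E) (V ×ᵇ (TangentSpace 𝓘(ℝ, E) : M → Type _))) :=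
  trivializationAt (F × E) (V ×ᵇ (TangentSpace 𝓘(ℝ, E) : M → Type _)) x₀

theorem sumTrivializationAt_baseSet (x₀ : M) :
    (sumTrivializationAt (E := E) F V x₀).baseSet =
      (trivializationAt F V x₀).baseSet ∩ (chartAt E x₀).source := rfl

theorem mem_chartAt_totalSpace_source {p q : TotalSpace F V} :
    q ∈ (chartAt (ModelProd E F) p).source ↔
      q.proj ∈ (sumTrivializationAt (E := E) F V p.proj).baseSet := by
  rw [FiberBundle.chartedSpace_chartAt, sumTrivializationAt_baseSet]
  simp only [mfld_simps]
  rw [Trivialization.mem_source]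
  exact and_congr_right fun h => by rw [Trivialization.coe_fst' _ h]

variable [NormedSpace ℝ F]

section

variable {p : TotalSpace F V} {y : E × F}
  (hy : y ∈ (extChartAt (𝓘(ℝ, E).prod 𝓘(ℝ, F)) p).target)
include hy

theorem proj_extChartAt_symm_mem_baseSet :
    ((extChartAt (𝓘(ℝ, E).prod 𝓘(ℝ, F)) p).symm y).proj ∈
      (sumTrivializationAt (E := E) F V p.proj).baseSet := by
  rw [← mem_chartAt_totalSpace_source, ← extChartAt_source (𝓘(ℝ, E).prod 𝓘(ℝ, F))]
  exact (extChartAt (𝓘(ℝ, E).prod 𝓘(ℝ, F)) p).map_target hy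

theorem eq_extChartAt_proj_symm_apply_snd :
    y = (extChartAt 𝓘(ℝ, E) p.proj ((extChartAt (𝓘(ℝ, E).prod 𝓘(ℝ, F)) p).symm y).proj,
      (trivializationAt F V p.proj ((extChartAt (𝓘(ℝ, E).prod 𝓘(ℝ, F)) p).symm y)).2) := by
  rw [← extChartAt_totalSpace (proj_extChartAt_symm_mem_baseSet hy).1,
    (extChartAt (𝓘(ℝ, E).prod 𝓘(ℝ, F)) p).right_inv hy]

theorem proj_extChartAt_symm :
    ((extChartAt (𝓘(ℝ, E).prod 𝓘(ℝ, F)) p).symm y).proj = (extChartAt 𝓘(ℝ, E) p.proj).symm y.1 := by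
  conv_rhs => rw [eq_extChartAt_proj_symm_apply_snd hy]
  refine ((extChartAt 𝓘(ℝ, E) p.proj).left_inv ?_).symm
  rw [extChartAt_source]
  exact (proj_extChartAt_symm_mem_baseSet hy).2

theorem trivializationAt_extChartAt_symm_snd :
    (trivializationAt F V p.proj ((extChartAt (𝓘(ℝ, E).prod 𝓘(ℝ, F)) p).symm y)).2 = y.2 :=
  (congrArg Prod.snd (eq_extChartAt_proj_symm_apply_snd hy)).symm

end

variable [∀ x, Module ℝ (V x)] [VectorBundle ℝ F V]

theorem sumTrivializationAt_continuousLinearMapAt {x₀ x : M}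
    (hx : x ∈ (sumTrivializationAt (E := E) F V x₀).baseSet) (z : V x × TangentSpace 𝓘(ℝ, E) x) :
    (sumTrivializationAt (E := E) F V x₀).continuousLinearMapAt ℝ x z =
      ((trivializationAt F V x₀).continuousLinearMapAt ℝ x z.1,
        (trivializationAt E (TangentSpace 𝓘(ℝ, E)) x₀).continuousLinearMapAt ℝ x z.2) := by
  rw [Trivialization.continuousLinearMapAt_apply, Trivialization.coe_linearMapAt_of_mem _ hx,
    Trivialization.continuousLinearMapAt_apply, Trivialization.coe_linearMapAt_of_mem _ hx.1,
    Trivialization.continuousLinearMapAt_apply, Trivialization.coe_linearMapAt_of_mem _ hx.2]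
  rfl

end TotalSpaceCoordinates

section LiftCoordinates

variable {E : Type*} [NormedAddCommGroup E] [NormedSpace ℝ E]
  {F : Type*} [NormedAddCommGroup F] [NormedSpace ℝ F]
  {M : Type*} [TopologicalSpace M] [ChartedSpace E M] [IsManifold 𝓘(ℝ, E) ∞ M]
  {V : M → Type*} [TopologicalSpace (TotalSpace F V)]
  [∀ x, AddCommGroup (V x)] [∀ x, Module ℝ (V x)] [∀ x, TopologicalSpace (V x)]
  [FiberBundle F V] [VectorBundle ℝ F V] [ContMDiffVectorBundle ∞ F V 𝓘(ℝ, E)]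
  {p q : TotalSpace F V}

theorem continuousLinearMapAt_tangent_totalSpace
    (hq : q.proj ∈ (sumTrivializationAt (E := E) F V p.proj).baseSet)
    (w : TangentSpace (𝓘(ℝ, E).prod 𝓘(ℝ, F)) q) :
    (trivializationAt (E × F) (TangentSpace (𝓘(ℝ, E).prod 𝓘(ℝ, F))) p).continuousLinearMapAt ℝ q w =
      ((trivializationAt E (TangentSpace 𝓘(ℝ, E)) p.proj).continuousLinearMapAt ℝ q.proj
        (mfderiv (𝓘(ℝ, E).prod 𝓘(ℝ, F)) 𝓘(ℝ, E) (fun r : TotalSpace F V => r.proj) q w),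
        mvfderiv (𝓘(ℝ, E).prod 𝓘(ℝ, F))
          (fun r : TotalSpace F V => (trivializationAt F V p.proj r).2) q w) := by
  have hchart : MDifferentiableAt 𝓘(ℝ, E) 𝓘(ℝ, E) (extChartAt 𝓘(ℝ, E) p.proj) q.proj :=
    mdifferentiableAt_extChartAt hq.2
  have hproj := mdifferentiableAt_proj (I := 𝓘(ℝ, E)) q
  have hchart_eq : extChartAt (𝓘(ℝ, E).prod 𝓘(ℝ, F)) p =ᶠ[𝓝 q] fun r =>
      ((extChartAt 𝓘(ℝ, E) p.proj ∘ fun r : TotalSpace F V => r.proj) r,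
        (trivializationAt F V p.proj r).2) := by
    filter_upwards [(trivializationAt F V p.proj).open_source.mem_nhds
      ((trivializationAt F V p.proj).mem_source.2 hq.1)] with r hr
    exact extChartAt_totalSpace ((trivializationAt F V p.proj).mem_source.1 hr)
  have hbase : mvfderiv (𝓘(ℝ, E).prod 𝓘(ℝ, F))
      (extChartAt 𝓘(ℝ, E) p.proj ∘ fun r : TotalSpace F V => r.proj) q w =
      mfderiv 𝓘(ℝ, E) 𝓘(ℝ, E) (extChartAt 𝓘(ℝ, E) p.proj) q.proj
        (mfderiv (𝓘(ℝ, E).prod 𝓘(ℝ, F)) 𝓘(ℝ, E) (fun r : TotalSpace F V => r.proj) q w) :=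
    mfderiv_comp_apply q hchart hproj w
  rw [TangentBundle.continuousLinearMapAt_trivializationAt (mem_chartAt_totalSpace_source.2 hq),
    TangentBundle.continuousLinearMapAt_trivializationAt hq.2]
  refine (DFunLike.congr_fun hchart_eq.mfderiv_eq w).trans ?_
  exact (mfderiv_prodMk_space (hchart.comp q hproj) (mdifferentiableAt_apply_snd _ hq.1) w).trans
    (congrArg (Prod.mk · _) hbase)

variable [FiniteDimensional ℝ E] [FiniteDimensional ℝ F]
  [∀ x, IsTopologicalAddGroup (V x)] [∀ x, ContinuousSMul ℝ (V x)]
  (cov : CovariantDerivative 𝓘(ℝ, E) F V)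

theorem splitEquiv_apply (q : TotalSpace F V) (w : TangentSpace (𝓘(ℝ, E).prod 𝓘(ℝ, F)) q) :
    splitEquiv cov q w = (vertProj cov q w,
      mfderiv (𝓘(ℝ, E).prod 𝓘(ℝ, F)) 𝓘(ℝ, E) (fun r : TotalSpace F V => r.proj) q w) := rfl

theorem continuousLinearMapAt_splitEquiv
    (hq : q.proj ∈ (sumTrivializationAt (E := E) F V p.proj).baseSet)
    (w : TangentSpace (𝓘(ℝ, E).prod 𝓘(ℝ, F)) q) :
    (sumTrivializationAt (E := E) F V p.proj).continuousLinearMapAt ℝ q.proj (splitEquiv cov q w) =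
      shear ((connForm cov p.proj q.proj).flip (trivializationAt F V p.proj q).2)
        ((trivializationAt (E × F) (TangentSpace (𝓘(ℝ, E).prod 𝓘(ℝ, F))) p).continuousLinearMapAt
          ℝ q w) := by
  rw [continuousLinearMapAt_tangent_totalSpace hq, sumTrivializationAt_continuousLinearMapAt hq,
    splitEquiv_apply, shear_apply, vertProj_eq cov (trivializationAt F V p.proj) hq.1, map_add,
    Trivialization.continuousLinearMapAt_symmL _ hq.1, ContinuousLinearMap.flip_apply,
    connForm_apply cov hq.1, Trivialization.symmL_continuousLinearMapAt _ hq.2]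

variable {K : ∀ x : M, Gen (V x × TangentSpace 𝓘(ℝ, E) x) →ₗ[ℝ] Gen (V x × TangentSpace 𝓘(ℝ, E) x)}

theorem genMap_splitEquiv_lift (q : TotalSpace F V) (a : GenTangent (𝓘(ℝ, E).prod 𝓘(ℝ, F)) q) :
    genMap (splitEquiv cov q) (lift cov K q a) = K q.proj (genMap (splitEquiv cov q) a) :=
  (genMap (splitEquiv cov q)).apply_symm_apply _

theorem genMap_shear_coordEnd_lift
    (hq : q.proj ∈ (sumTrivializationAt (E := E) F V p.proj).baseSet) (b : Gen (E × F)) :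
    genMap (shear ((connForm cov p.proj q.proj).flip (trivializationAt F V p.proj q).2))
        (coordEnd (trivializationAt (E × F) (TangentSpace (𝓘(ℝ, E).prod 𝓘(ℝ, F))) p)
          (lift cov K) q b) =
      coordEnd (sumTrivializationAt (E := E) F V p.proj) K q.proj
        (genMap (shear ((connForm cov p.proj q.proj).flip (trivializationAt F V p.proj q).2)) b) :=
  genMap_coordEnd (mem_chartAt_totalSpace_source.2 hq) hq (continuousLinearMapAt_splitEquiv cov hq)
    (genMap_splitEquiv_lift cov q) b

end LiftCoordinates

section ShearSmoothness

variable {E F : Type*} [NormedAddCommGroup E] [NormedSpace ℝ E]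
  [NormedAddCommGroup F] [NormedSpace ℝ F] {n : WithTop ℕ∞}

theorem contDiff_genMap_shear :
    ContDiff ℝ n fun z : (E →L[ℝ] F) × Gen (E × F) => genMap (shear z.1) z.2 := by
  have hsymm (C : E →L[ℝ] F) : ((shear C).symm : F × E →L[ℝ] E × F) =
      (ContinuousLinearMap.inl ℝ E F).comp (ContinuousLinearMap.snd ℝ F E) +
        (ContinuousLinearMap.inr ℝ E F).comp
          (ContinuousLinearMap.fst ℝ F E - C.comp (ContinuousLinearMap.snd ℝ F E)) := by
    ext <;> simp
  simp only [genMap, LinearEquiv.coe_mk, LinearMap.coe_mk, AddHom.coe_mk, hsymm, shear_apply]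
  have hmul : ContDiff ℝ n fun z : (E →L[ℝ] F) × Gen (E × F) => z.1 z.2.1.1 :=
    contDiff_fst.clm_apply (by fun_prop)
  exact (((by fun_prop : ContDiff ℝ n fun z : (E →L[ℝ] F) × Gen (E × F) => z.2.1.2).add
    hmul).prodMk (by fun_prop)).prodMk (contDiff_snd.snd.clm_comp (by fun_prop))

theorem contDiff_genMap_shear_symm :
    ContDiff ℝ n fun z : (E →L[ℝ] F) × Gen (F × E) => (genMap (shear z.1)).symm z.2 := by
  have hshear (C : E →L[ℝ] F) : (shear C : E × F →L[ℝ] F × E) =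
      (ContinuousLinearMap.inl ℝ F E).comp
          (ContinuousLinearMap.snd ℝ E F + C.comp (ContinuousLinearMap.fst ℝ E F)) +
        (ContinuousLinearMap.inr ℝ F E).comp (ContinuousLinearMap.fst ℝ E F) := by
    ext <;> simp
  simp only [genMap, LinearEquiv.coe_symm_mk, hshear, shear_symm_apply]
  have hmul : ContDiff ℝ n fun z : (E →L[ℝ] F) × Gen (F × E) => z.1 z.2.1.2 :=
    contDiff_fst.clm_apply (by fun_prop)
  exact ((by fun_prop : ContDiff ℝ n fun z : (E →L[ℝ] F) × Gen (F × E) => z.2.1.2).prodMk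
    ((by fun_prop : ContDiff ℝ n fun z : (E →L[ℝ] F) × Gen (F × E) => z.2.1.1).sub hmul)).prodMk
      (contDiff_snd.snd.clm_comp (by fun_prop))

end ShearSmoothness

section LiftSmoothness

variable {E : Type*} [NormedAddCommGroup E] [NormedSpace ℝ E] [FiniteDimensional ℝ E]
  {F : Type*} [NormedAddCommGroup F] [NormedSpace ℝ F] [FiniteDimensional ℝ F]
  {M : Type*} [TopologicalSpace M] [ChartedSpace E M] [IsManifold 𝓘(ℝ, E) ∞ M]
  {V : M → Type*} [TopologicalSpace (TotalSpace F V)]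
  [∀ x, AddCommGroup (V x)] [∀ x, Module ℝ (V x)] [∀ x, TopologicalSpace (V x)]
  [FiberBundle F V] [VectorBundle ℝ F V]

/-- The local representative of an endomorphism of `V ⊕ T_M ⊕ V^∨ ⊕ T_M^∨` in the preferred chart
and trivialization at `x₀`. -/
def baseEndInChart (F : Type*) [NormedAddCommGroup F] [NormedSpace ℝ F] [FiniteDimensional ℝ F]
    {V : M → Type*} [TopologicalSpace (TotalSpace F V)]
    [∀ x, AddCommGroup (V x)] [∀ x, Module ℝ (V x)] [∀ x, TopologicalSpace (V x)]
    [FiberBundle F V] [VectorBundle ℝ F V]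
    (K : ∀ x : M, Gen (V x × TangentSpace 𝓘(ℝ, E) x) →ₗ[ℝ] Gen (V x × TangentSpace 𝓘(ℝ, E) x))
    (x₀ : M) (y : E) : Gen (F × E) →L[ℝ] Gen (F × E) :=
  coordEnd (sumTrivializationAt (E := E) F V x₀) K ((extChartAt 𝓘(ℝ, E) x₀).symm y)

variable
  {K : ∀ x : M, Gen (V x × TangentSpace 𝓘(ℝ, E) x) →ₗ[ℝ] Gen (V x × TangentSpace 𝓘(ℝ, E) x)}

theorem baseEndInChart_self (x₀ : M) : baseEndInChart F K x₀ (extChartAt 𝓘(ℝ, E) x₀ x₀) =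
    coordEnd (sumTrivializationAt (E := E) F V x₀) K x₀ := by
  rw [baseEndInChart, extChartAt_to_inv]

variable [ContMDiffVectorBundle ∞ F V 𝓘(ℝ, E)]

theorem differentiableAt_baseEndInChart
    (hK : IsGenAlmostComplex (W := V ×ᵇ (TangentSpace 𝓘(ℝ, E) : M → Type _)) 𝓘(ℝ, E) (F × E) K)
    (x₀ : M) : DifferentiableAt ℝ (baseEndInChart F K x₀) (extChartAt 𝓘(ℝ, E) x₀ x₀) :=
  differentiableAt_comp_extChartAt_symm
    ((contMDiffAt_coordEnd hK.smooth x₀).mdifferentiableAt (by simp))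

variable [∀ x, IsTopologicalAddGroup (V x)] [∀ x, ContinuousSMul ℝ (V x)]
  (cov : CovariantDerivative 𝓘(ℝ, E) F V)

theorem contMDiffAt_coordEnd_lift {p : TotalSpace F V}
    (hA : ContMDiffAt 𝓘(ℝ, E) 𝓘(ℝ, E →L[ℝ] F →L[ℝ] F) ∞ (connForm cov p.proj) p.proj)
    (hK : ContMDiffAt 𝓘(ℝ, E) 𝓘(ℝ, Gen (F × E) →L[ℝ] Gen (F × E)) ∞
      (coordEnd (sumTrivializationAt (E := E) F V p.proj) K) p.proj) :
    ContMDiffAt (𝓘(ℝ, E).prod 𝓘(ℝ, F)) 𝓘(ℝ, Gen (E × F) →L[ℝ] Gen (E × F)) ∞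
      (coordEnd (trivializationAt (E × F) (TangentSpace (𝓘(ℝ, E).prod 𝓘(ℝ, F))) p)
        (lift cov K)) p := by
  set e := trivializationAt F V p.proj
  have hp : p.proj ∈ (sumTrivializationAt (E := E) F V p.proj).baseSet :=
    mem_baseSet_trivializationAt (F × E) (V ×ᵇ (TangentSpace 𝓘(ℝ, E) : M → Type _)) p.proj
  have hproj : ContMDiffAt (𝓘(ℝ, E).prod 𝓘(ℝ, F)) 𝓘(ℝ, E) ∞
      (fun q : TotalSpace F V => q.proj) p := contMDiffAt_proj V
  have hfiber : ContMDiffAt (𝓘(ℝ, E).prod 𝓘(ℝ, F)) 𝓘(ℝ, F) ∞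
      (fun q : TotalSpace F V => (e q).2) p :=
    ((Bundle.Trivialization.contMDiffOn (n := ∞) (IB := 𝓘(ℝ, E)) e).contMDiffAt
      (e.open_source.mem_nhds (e.mem_source.2 hp.1))).snd
  have hshear : ContMDiffAt (𝓘(ℝ, E).prod 𝓘(ℝ, F)) 𝓘(ℝ, E →L[ℝ] F) ∞
      (fun q : TotalSpace F V => (connForm cov p.proj q.proj).flip (e q).2) p :=
    contMDiffAt_clm_of_apply fun u =>
      ((hA.comp p hproj).clm_apply contMDiffAt_const).clm_apply hfiber
  refine contMDiffAt_clm_of_apply fun b => ?_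
  have himage := contDiff_genMap_shear.contMDiff.contMDiffAt.comp p
    (hshear.prodMk_space (contMDiffAt_const (c := b)))
  refine (contDiff_genMap_shear_symm.contMDiff.contMDiffAt.comp p
    (hshear.prodMk_space ((hK.comp p hproj).clm_apply himage))).congr_of_eventuallyEq ?_
  filter_upwards [hproj.continuousAt.preimage_mem_nhds
    ((sumTrivializationAt (E := E) F V p.proj).open_baseSet.mem_nhds hp)] with q hq
  exact (LinearEquiv.eq_symm_apply _).2 (genMap_shear_coordEnd_lift cov hq b)

theorem lift_isGenAlmostComplex
    (hA : ∀ x₀, ContMDiffAt 𝓘(ℝ, E) 𝓘(ℝ, E →L[ℝ] F →L[ℝ] F) ∞ (connForm cov x₀) x₀)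
    (hK : IsGenAlmostComplex (W := V ×ᵇ (TangentSpace 𝓘(ℝ, E) : M → Type _)) 𝓘(ℝ, E) (F × E) K) :
    IsGenAlmostComplex (𝓘(ℝ, E).prod 𝓘(ℝ, F)) (E × F) (lift cov K) where
  sq p u := (genMap (splitEquiv cov p)).injective <| by
    rw [genMap_splitEquiv_lift, genMap_splitEquiv_lift, hK.sq, map_neg]
  orth p u v := by
    rw [← pairing_genMap (splitEquiv cov p), genMap_splitEquiv_lift, genMap_splitEquiv_lift,
      hK.orth, pairing_genMap]
  smooth := smoothSectionOn_apply_of_contMDiffAt_coordEnd fun p =>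
    contMDiffAt_coordEnd_lift cov (hA p.proj) (contMDiffAt_coordEnd hK.smooth p.proj)

theorem genMap_shear_endInChart_lift (p : TotalSpace F V) :
    ∀ᶠ y in 𝓝 (extChartAt (𝓘(ℝ, E).prod 𝓘(ℝ, F)) p p), ∀ b,
      genMap (shear ((connChart cov p.proj y.1).flip y.2)) (endInChart (lift cov K) p y b) =
        baseEndInChart F K p.proj y.1
          (genMap (shear ((connChart cov p.proj y.1).flip y.2)) b) := by
  filter_upwards [extChartAt_target_mem_nhds (I := 𝓘(ℝ, E).prod 𝓘(ℝ, F)) p] with y hy b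
  have h := genMap_shear_coordEnd_lift cov (K := K) (proj_extChartAt_symm_mem_baseSet hy) b
  rwa [trivializationAt_extChartAt_symm_snd hy, proj_extChartAt_symm hy] at h

/-- The Nijenhuis form of an endomorphism of `V ⊕ T_M ⊕ V^∨ ⊕ T_M^∨` at `x₀`, computed in the
preferred chart and trivialization: the obstruction to the integrability of its lift. -/
def baseNijenhuisFormAt
    (K : ∀ x : M, Gen (V x × TangentSpace 𝓘(ℝ, E) x) →ₗ[ℝ] Gen (V x × TangentSpace 𝓘(ℝ, E) x))
    (x₀ : M) : Gen (F × E) → Gen (F × E) → Gen (F × E) → ℝ :=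
  baseNijenhuisForm (connChart cov x₀ (extChartAt 𝓘(ℝ, E) x₀ x₀))
    (baseEndInChart F K x₀ (extChartAt 𝓘(ℝ, E) x₀ x₀))
    (fun u => fderiv ℝ (baseEndInChart F K x₀) (extChartAt 𝓘(ℝ, E) x₀ x₀) u)

theorem nijenhuisForm_endInChart_lift
    (hA : ∀ x₀, ContMDiffAt 𝓘(ℝ, E) 𝓘(ℝ, E →L[ℝ] F →L[ℝ] F) ∞ (connForm cov x₀) x₀)
    (hflat : HasZeroCurvature cov)
    (hK : IsGenAlmostComplex (W := V ×ᵇ (TangentSpace 𝓘(ℝ, E) : M → Type _)) 𝓘(ℝ, E) (F × E) K)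
    (p : TotalSpace F V) :
    ∃ S : Gen (E × F) ≃ₗ[ℝ] Gen (F × E), ∀ a b c,
      nijenhuisForm (endInChart (lift cov K) p (extChartAt (𝓘(ℝ, E).prod 𝓘(ℝ, F)) p p))
        (fun a => fderiv ℝ (endInChart (lift cov K) p)
          (extChartAt (𝓘(ℝ, E).prod 𝓘(ℝ, F)) p p) a.1) a b c =
      baseNijenhuisFormAt cov K p.proj (S a) (S b) (S c) := by
  have hp := mem_baseSet_trivializationAt (F × E)
    (V ×ᵇ (TangentSpace 𝓘(ℝ, E) : M → Type _)) p.proj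
  have hsq : ∀ u, baseEndInChart F K p.proj (extChartAt 𝓘(ℝ, E) p.proj p.proj)
      (baseEndInChart F K p.proj (extChartAt 𝓘(ℝ, E) p.proj p.proj) u) = -u := by
    rw [baseEndInChart_self]
    exact coordEnd_sq hK.sq hp
  have horth : ∀ u v, pairing (baseEndInChart F K p.proj (extChartAt 𝓘(ℝ, E) p.proj p.proj) u)
      (baseEndInChart F K p.proj (extChartAt 𝓘(ℝ, E) p.proj p.proj) v) = pairing u v := by
    rw [baseEndInChart_self]
    exact pairing_coordEnd hK.orth hp
  have hj :=
    ((lift_isGenAlmostComplex cov hA hK).differentiableAt_endInChart p).hasFDerivAt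
  have hjk := genMap_shear_endInChart_lift (K := K) cov p
  rw [extChartAt_totalSpace_self] at hj hjk ⊢
  exact ⟨_, nijenhuisForm_eq_baseNijenhuisForm
    (differentiableAt_connChart cov (hA p.proj)).hasFDerivAt
    (differentiableAt_baseEndInChart hK p.proj).hasFDerivAt hj hjk hsq
    (pairing_skew_of_orthogonal hsq horth) (hflat p.proj)⟩

theorem integrable_lift_iff
    (hA : ∀ x₀, ContMDiffAt 𝓘(ℝ, E) 𝓘(ℝ, E →L[ℝ] F →L[ℝ] F) ∞ (connForm cov x₀) x₀)
    (hflat : IsFlat cov)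
    (hK : IsGenAlmostComplex (W := V ×ᵇ (TangentSpace 𝓘(ℝ, E) : M → Type _)) 𝓘(ℝ, E) (F × E) K) :
    Integrable (𝓘(ℝ, E).prod 𝓘(ℝ, F)) (lift cov K) ↔
      ∀ x₀ a b c, baseNijenhuisFormAt cov K x₀ a b c = 0 := by
  have hcurv := (isFlat_iff cov fun x₀ => differentiableAt_connChart cov (hA x₀)).1 hflat
  rw [(lift_isGenAlmostComplex cov hA hK).integrable_iff]
  refine ⟨fun h x₀ a b c => ?_, fun h p a b c => ?_⟩
  · obtain ⟨S, hS⟩ := nijenhuisForm_endInChart_lift cov hA hcurv hK ⟨x₀, 0⟩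
    have hzero := hS (S.symm a) (S.symm b) (S.symm c)
    rw [h, S.apply_symm_apply, S.apply_symm_apply, S.apply_symm_apply] at hzero
    exact hzero.symm
  · obtain ⟨S, hS⟩ := nijenhuisForm_endInChart_lift cov hA hcurv hK p
    rw [hS, h]

end LiftSmoothness

section TransposeParts

variable {v : Type*} [AddCommGroup v] [Module ℝ v] [TopologicalSpace v]
  [ContinuousSMul ℝ v]
  {t : Type*} [AddCommGroup t] [Module ℝ t] [TopologicalSpace t]

theorem transposeMap_neg (u : Gen (v × t)) :
    transposeMap (-u) = -transposeMap u :=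
  map_neg transposeMap u

theorem transposeMap_mem_leftPart_iff {u : Gen (v × t)} :
    transposeMap u ∈ (leftPart : Submodule ℝ (Gen ((v →L[ℝ] ℝ) × t))) ↔
      u ∈ (leftPart : Submodule ℝ (Gen (v × t))) := by
  have hsnd : (transposeMap u).2.comp (ContinuousLinearMap.inr ℝ (v →L[ℝ] ℝ) t) =
      u.2.comp (ContinuousLinearMap.inr ℝ v t) := by
    ext x
    simp [transposeMap]
  exact and_congr_right fun _ => by rw [hsnd]

variable [IsTopologicalAddGroup v]

theorem evalDual_eq_zero_iff [T2Space v] [FiniteDimensional ℝ v] {a : v} :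
    evalDual a = 0 ↔ a = 0 := by
  refine ⟨fun h => ?_, fun h => ?_⟩
  · rw [← Module.forall_dual_apply_eq_zero_iff ℝ]
    exact fun f => DFunLike.congr_fun h (LinearMap.toContinuousLinearMap f)
  · rw [h]
    ext f
    exact map_zero f

theorem transposeMap_mem_rightPart_iff [T2Space v] [FiniteDimensional ℝ v] {u : Gen (v × t)} :
    transposeMap u ∈ (rightPart : Submodule ℝ (Gen ((v →L[ℝ] ℝ) × t))) ↔
      u ∈ (rightPart : Submodule ℝ (Gen (v × t))) := by
  have hsnd : (transposeMap u).2.comp (ContinuousLinearMap.inl ℝ (v →L[ℝ] ℝ) t) =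
      evalDual u.1.1 := by
    ext x
    simp [transposeMap]
  change (u.2.comp (ContinuousLinearMap.inl ℝ v t) = 0 ∧ (transposeMap u).2.comp _ = 0) ↔
    (u.1.1 = 0 ∧ u.2.comp (ContinuousLinearMap.inl ℝ v t) = 0)
  rw [hsnd, evalDual_eq_zero_iff, and_comm]

variable [IsTopologicalAddGroup t] [ContinuousSMul ℝ t]

theorem map_leftPart_eq_rightPart_iff_of_transposeMap [T2Space v] [FiniteDimensional ℝ v]
    {k : Gen (v × t) →ₗ[ℝ] Gen (v × t)}
    {k' : Gen ((v →L[ℝ] ℝ) × t) →ₗ[ℝ] Gen ((v →L[ℝ] ℝ) × t)}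
    (h : ∀ z, k' (transposeMap z) = transposeMap (k z)) :
    Submodule.map k' leftPart = rightPart ↔ Submodule.map k leftPart = rightPart := by
  obtain ⟨hinj, hsurj⟩ := transposeMap_bijective (v := v) (t := t)
  have hmem (z : Gen (v × t)) :
      transposeMap z ∈ Submodule.map k' leftPart ↔ z ∈ Submodule.map k leftPart := by
    simp only [Submodule.mem_map, hsurj.exists, transposeMap_mem_leftPart_iff, h, hinj.eq_iff]
  rw [SetLike.ext_iff, SetLike.ext_iff, hsurj.forall]
  simp only [hmem, transposeMap_mem_rightPart_iff]

end TransposeParts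

section Mirror

theorem transposeMap_fiber_bijective (F : Type*) [NormedAddCommGroup F] [NormedSpace ℝ F]
    [FiniteDimensional ℝ F] {B : Type*} [TopologicalSpace B] {V : B → Type*}
    [TopologicalSpace (TotalSpace F V)] [∀ x, AddCommGroup (V x)] [∀ x, Module ℝ (V x)]
    [∀ x, TopologicalSpace (V x)] [∀ x, IsTopologicalAddGroup (V x)]
    [∀ x, ContinuousSMul ℝ (V x)] [FiberBundle F V] [VectorBundle ℝ F V]
    {t : Type*} [AddCommGroup t] [Module ℝ t] [TopologicalSpace t] [IsTopologicalAddGroup t]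
    [ContinuousSMul ℝ t] (x : B) :
    Function.Bijective (transposeMap (v := V x) (t := t)) :=
  haveI : T2Space (V x) := FiberBundle.t2Space F V x
  haveI : FiniteDimensional ℝ (V x) := VectorBundle.finiteDimensional ℝ F V x
  transposeMap_bijective

variable {E : Type*} [NormedAddCommGroup E] [NormedSpace ℝ E]
  {F : Type*} [NormedAddCommGroup F] [NormedSpace ℝ F] [FiniteDimensional ℝ F]
  {M : Type*} [TopologicalSpace M] [ChartedSpace E M]
  {V : M → Type*} [TopologicalSpace (TotalSpace F V)]
  [∀ x, AddCommGroup (V x)] [∀ x, Module ℝ (V x)] [∀ x, TopologicalSpace (V x)]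
  [∀ x, IsTopologicalAddGroup (V x)] [∀ x, ContinuousSMul ℝ (V x)]
  [FiberBundle F V] [VectorBundle ℝ F V]

theorem mirror_transposeMap
    (K : ∀ x : M, Gen (V x × TangentSpace 𝓘(ℝ, E) x) →ₗ[ℝ] Gen (V x × TangentSpace 𝓘(ℝ, E) x))
    (x : M) (z : Gen (V x × TangentSpace 𝓘(ℝ, E) x)) :
    mirror F K x (transposeMap z) = transposeMap (K x z) := by
  have : T2Space (V x) := FiberBundle.t2Space F V x
  have : FiniteDimensional ℝ (V x) := VectorBundle.finiteDimensional ℝ F V x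
  exact congrArg (fun w => transposeMap (K x w)) (transpose.symm_apply_apply z)

theorem mirror_bijective : Function.Bijective (mirror F (V := V) (E := E) (M := M)) := by
  have (x : M) : T2Space (V x) := FiberBundle.t2Space F V x
  have (x : M) : FiniteDimensional ℝ (V x) := VectorBundle.finiteDimensional ℝ F V x
  refine ⟨fun K K₁ h => ?_, fun K' =>
    ⟨fun x => transpose.symm.toLinearMap ∘ₗ K' x ∘ₗ transpose.toLinearMap, ?_⟩⟩
  · funext x
    refine LinearMap.ext fun z => transposeMap_bijective.1 ?_
    rw [← mirror_transposeMap (F := F), ← mirror_transposeMap (F := F), h]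
  · funext x
    refine LinearMap.ext ((transposeMap_fiber_bijective F x).2.forall.2 fun z => ?_)
    rw [mirror_transposeMap]
    exact transpose.apply_symm_apply _

end Mirror

section MirrorCoordinates

variable {E : Type*} [NormedAddCommGroup E] [NormedSpace ℝ E]
  {F : Type*} [NormedAddCommGroup F] [NormedSpace ℝ F]

scoped instance : NormedAddCommGroup (Gen ((F →L[ℝ] ℝ) × E)) :=
  Prod.normedAddCommGroup (E := (F →L[ℝ] ℝ) × E) (F := ((F →L[ℝ] ℝ) × E) →L[ℝ] ℝ)
scoped instance : AddCommGroup (Gen ((F →L[ℝ] ℝ) × E)) := NormedAddCommGroup.toAddCommGroup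
scoped instance : NormedSpace ℝ (Gen ((F →L[ℝ] ℝ) × E)) :=
  Prod.normedSpace (E := (F →L[ℝ] ℝ) × E) (F := ((F →L[ℝ] ℝ) × E) →L[ℝ] ℝ)

variable
  {M : Type*} [TopologicalSpace M] [ChartedSpace E M] [IsManifold 𝓘(ℝ, E) ∞ M]
  {V : M → Type*} [TopologicalSpace (TotalSpace F V)]
  [∀ x, AddCommGroup (V x)] [∀ x, Module ℝ (V x)] [∀ x, TopologicalSpace (V x)]
  [FiberBundle F V] [VectorBundle ℝ F V] {x₀ x : M}

theorem sumTrivializationAt_symmL (hx : x ∈ (sumTrivializationAt (E := E) F V x₀).baseSet)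
    (z : F × E) :
    (sumTrivializationAt (E := E) F V x₀).symmL ℝ x z =
      ((trivializationAt F V x₀).symmL ℝ x z.1,
        (trivializationAt E (TangentSpace 𝓘(ℝ, E)) x₀).symmL ℝ x z.2) := by
  set w : V x × TangentSpace 𝓘(ℝ, E) x := ((trivializationAt F V x₀).symmL ℝ x z.1,
    (trivializationAt E (TangentSpace 𝓘(ℝ, E)) x₀).symmL ℝ x z.2) with hw
  have hz := sumTrivializationAt_continuousLinearMapAt hx w
  rw [hw, Trivialization.continuousLinearMapAt_symmL _ hx.1,
    Trivialization.continuousLinearMapAt_symmL _ hx.2, ← hw] at hz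
  rw [← Trivialization.symmL_continuousLinearMapAt (R := ℝ)
    (sumTrivializationAt (E := E) F V x₀) hx w, hz]

theorem sumTrivializationAt_dualBundle_baseSet (x₀ : M) :
    (sumTrivializationAt (E := E) (F →L[ℝ] ℝ) (DualBundle V) x₀).baseSet =
      (sumTrivializationAt (E := E) F V x₀).baseSet := by
  rw [sumTrivializationAt_baseSet, sumTrivializationAt_baseSet,
    dualBundle_trivializationAt_baseSet]

variable [∀ x, ContinuousSMul ℝ (V x)]

theorem coordGen_transposeMap (hx : x ∈ (sumTrivializationAt (E := E) F V x₀).baseSet)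
    (u : Gen (V x × TangentSpace 𝓘(ℝ, E) x)) :
    coordGen (sumTrivializationAt (E := E) (F →L[ℝ] ℝ) (DualBundle V) x₀) x (transposeMap u) =
      transposeMap (coordGen (sumTrivializationAt (E := E) F V x₀) x u) := by
  have hx' : x ∈ (sumTrivializationAt (E := E) (F →L[ℝ] ℝ) (DualBundle V) x₀).baseSet := by
    rwa [sumTrivializationAt_dualBundle_baseSet]
  have hfst := sumTrivializationAt_continuousLinearMapAt hx u.1
  refine Prod.ext ?_ (ContinuousLinearMap.ext fun z => ?_)
  · refine (sumTrivializationAt_continuousLinearMapAt hx' _).trans (Prod.ext ?_ ?_)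
    · refine (dualBundle_continuousLinearMapAt hx.1 _).trans (ContinuousLinearMap.ext fun ξ => ?_)
      have hsymm := sumTrivializationAt_symmL hx (ξ, 0)
      rw [map_zero] at hsymm
      exact (congrArg u.2 hsymm).symm
    · exact (congrArg Prod.snd hfst).symm
  · have hsymm' : (sumTrivializationAt (E := E) (F →L[ℝ] ℝ) (DualBundle V) x₀).symmL ℝ x z = _ :=
      sumTrivializationAt_symmL hx' z
    rw [dualBundle_symmL hx.1] at hsymm'
    have hsymm := sumTrivializationAt_symmL hx (0, z.2)
    rw [map_zero] at hsymm
    exact (congrArg (transposeMap u).2 hsymm').trans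
      (congrArg₂ (· + ·) (congrArg z.1 (congrArg Prod.fst hfst)).symm (congrArg u.2 hsymm).symm)

variable [FiniteDimensional ℝ E] [FiniteDimensional ℝ F] [∀ x, IsTopologicalAddGroup (V x)]
  {K : ∀ x : M, Gen (V x × TangentSpace 𝓘(ℝ, E) x) →ₗ[ℝ] Gen (V x × TangentSpace 𝓘(ℝ, E) x)}

theorem coordEnd_mirror_transposeMap
    (hx : x ∈ (sumTrivializationAt (E := E) F V x₀).baseSet) (b : Gen (F × E)) :
    coordEnd (sumTrivializationAt (E := E) (F →L[ℝ] ℝ) (DualBundle V) x₀) (mirror F K) x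
        (transposeMap b) =
      transposeMap (coordEnd (sumTrivializationAt (E := E) F V x₀) K x b) := by
  obtain ⟨a, rfl⟩ : ∃ a, coordGen (sumTrivializationAt (E := E) F V x₀) x a = b :=
    ⟨coordGenSymm (sumTrivializationAt (E := E) F V x₀) x b, coordGen_coordGenSymm hx b⟩
  have hx' : x ∈ (sumTrivializationAt (E := E) (F →L[ℝ] ℝ) (DualBundle V) x₀).baseSet := by
    rwa [sumTrivializationAt_dualBundle_baseSet]
  rw [← coordGen_transposeMap hx, coordEnd_coordGen hx', mirror_transposeMap, coordEnd_coordGen hx,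
    coordGen_transposeMap hx]

/-- The transposition of `F` and its dual in the model fibre, as a continuous linear
isomorphism. -/
def transposeL (E F : Type*) [NormedAddCommGroup E] [NormedSpace ℝ E] [FiniteDimensional ℝ E]
    [NormedAddCommGroup F] [NormedSpace ℝ F] [FiniteDimensional ℝ F] :
    Gen (F × E) ≃L[ℝ] Gen ((F →L[ℝ] ℝ) × E) :=
  LinearEquiv.toContinuousLinearEquiv transpose

theorem contMDiffAt_coordEnd_mirror_iff (x₀ : M) :
    ContMDiffAt 𝓘(ℝ, E) 𝓘(ℝ, Gen ((F →L[ℝ] ℝ) × E) →L[ℝ] Gen ((F →L[ℝ] ℝ) × E)) ∞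
        (coordEnd (sumTrivializationAt (E := E) (F →L[ℝ] ℝ) (DualBundle V) x₀) (mirror F K)) x₀ ↔
      ContMDiffAt 𝓘(ℝ, E) 𝓘(ℝ, Gen (F × E) →L[ℝ] Gen (F × E)) ∞
        (coordEnd (sumTrivializationAt (E := E) F V x₀) K) x₀ := by
  have hmem : ∀ᶠ x in 𝓝 x₀, x ∈ (sumTrivializationAt (E := E) F V x₀).baseSet :=
    baseSet_trivializationAt_mem_nhds (G := F × E)
      (W := V ×ᵇ (TangentSpace 𝓘(ℝ, E) : M → Type _)) x₀
  refine ⟨fun hK => contMDiffAt_clm_of_apply fun b => ?_,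
    fun hK => contMDiffAt_clm_of_apply ((transposeL E F).surjective.forall.2 fun b => ?_)⟩
  · refine ((transposeL E F).symm.contDiff.contMDiff.contMDiffAt.comp x₀
      (hK.clm_apply (contMDiffAt_const (c := transposeMap b)))).congr_of_eventuallyEq ?_
    filter_upwards [hmem] with x hx
    exact ((ContinuousLinearEquiv.symm_apply_eq _).2 (coordEnd_mirror_transposeMap hx b)).symm
  · refine ((transposeL E F).contDiff.contMDiff.contMDiffAt.comp x₀
      (hK.clm_apply (contMDiffAt_const (c := b)))).congr_of_eventuallyEq ?_
    filter_upwards [hmem] with x hx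
    exact coordEnd_mirror_transposeMap hx b

theorem fderiv_baseEndInChart_mirror
    (h : DifferentiableAt ℝ (baseEndInChart F K x₀) (extChartAt 𝓘(ℝ, E) x₀ x₀))
    (h' : DifferentiableAt ℝ (baseEndInChart (F →L[ℝ] ℝ) (mirror F K) x₀)
      (extChartAt 𝓘(ℝ, E) x₀ x₀)) (u : E) (z : Gen (F × E)) :
    fderiv ℝ (baseEndInChart (F →L[ℝ] ℝ) (mirror F K) x₀) (extChartAt 𝓘(ℝ, E) x₀ x₀) u
        (transposeMap z) =
      transposeMap (fderiv ℝ (baseEndInChart F K x₀) (extChartAt 𝓘(ℝ, E) x₀ x₀) u z) := by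
  have htendsto := continuousAt_extChartAt_symm (I := 𝓘(ℝ, E)) x₀
  rw [ContinuousAt, extChartAt_to_inv] at htendsto
  have hcongr : (fun y => baseEndInChart (F →L[ℝ] ℝ) (mirror F K) x₀ y (transposeMap z))
      =ᶠ[𝓝 (extChartAt 𝓘(ℝ, E) x₀ x₀)]
      (transposeL E F).toContinuousLinearMap ∘ fun y => baseEndInChart F K x₀ y z := by
    filter_upwards [htendsto (baseSet_trivializationAt_mem_nhds (G := F × E)
      (W := V ×ᵇ (TangentSpace 𝓘(ℝ, E) : M → Type _)) x₀)] with y hy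
    exact coordEnd_mirror_transposeMap hy z
  have hleft := (hasFDerivAt_clm_apply_const h'.hasFDerivAt (transposeMap z)).fderiv
  have hright := ((transposeL E F).toContinuousLinearMap.hasFDerivAt.comp _
    (hasFDerivAt_clm_apply_const h.hasFDerivAt z)).fderiv
  exact DFunLike.congr_fun (hleft.symm.trans ((hcongr.fderiv_eq (𝕜 := ℝ)).trans hright)) u

end MirrorCoordinates

section MirrorStructures

variable {E : Type*} [NormedAddCommGroup E] [NormedSpace ℝ E] [FiniteDimensional ℝ E]
  {F : Type*} [NormedAddCommGroup F] [NormedSpace ℝ F] [FiniteDimensional ℝ F]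
  {M : Type*} [TopologicalSpace M] [ChartedSpace E M] [IsManifold 𝓘(ℝ, E) ∞ M]
  {V : M → Type*} [TopologicalSpace (TotalSpace F V)]
  [∀ x, AddCommGroup (V x)] [∀ x, Module ℝ (V x)] [∀ x, TopologicalSpace (V x)]
  [∀ x, IsTopologicalAddGroup (V x)] [∀ x, ContinuousSMul ℝ (V x)]
  [FiberBundle F V] [VectorBundle ℝ F V] [ContMDiffVectorBundle ∞ F V 𝓘(ℝ, E)]
  {K : ∀ x : M, Gen (V x × TangentSpace 𝓘(ℝ, E) x) →ₗ[ℝ] Gen (V x × TangentSpace 𝓘(ℝ, E) x)}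

theorem isGenAlmostComplex_mirror_iff :
    IsGenAlmostComplex (W := DualBundle V ×ᵇ (TangentSpace 𝓘(ℝ, E) : M → Type _)) 𝓘(ℝ, E)
        ((F →L[ℝ] ℝ) × E) (mirror F K) ↔
      IsGenAlmostComplex (W := V ×ᵇ (TangentSpace 𝓘(ℝ, E) : M → Type _)) 𝓘(ℝ, E) (F × E) K := by
  have hbij (x : M) := transposeMap_fiber_bijective F (V := V) (t := TangentSpace 𝓘(ℝ, E) x) x
  have hsq (x : M) (u : Gen (V x × TangentSpace 𝓘(ℝ, E) x)) :
      mirror F K x (mirror F K x (transposeMap u)) = -transposeMap u ↔ K x (K x u) = -u := by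
    rw [mirror_transposeMap, mirror_transposeMap, ← transposeMap_neg, (hbij x).1.eq_iff]
  have horth (x : M) (u v : Gen (V x × TangentSpace 𝓘(ℝ, E) x)) :
      pairing (mirror F K x (transposeMap u)) (mirror F K x (transposeMap v)) =
        pairing (transposeMap u) (transposeMap v) ↔ pairing (K x u) (K x v) = pairing u v := by
    rw [mirror_transposeMap, mirror_transposeMap, pairing_transposeMap, pairing_transposeMap]
  refine ⟨fun hK => ⟨fun x u => (hsq x u).1 (hK.sq x _), fun x u v => (horth x u v).1
    (hK.orth x _ _), smoothSectionOn_apply_of_contMDiffAt_coordEnd fun x₀ =>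
      (contMDiffAt_coordEnd_mirror_iff x₀).1 (contMDiffAt_coordEnd hK.smooth x₀)⟩,
    fun hK => ⟨fun x => (hbij x).2.forall.2 fun u => (hsq x u).2 (hK.sq x u),
    fun x => (hbij x).2.forall₂.2 fun u v => (horth x u v).2 (hK.orth x u v),
    smoothSectionOn_apply_of_contMDiffAt_coordEnd fun x₀ =>
      (contMDiffAt_coordEnd_mirror_iff x₀).2 (contMDiffAt_coordEnd hK.smooth x₀)⟩⟩

theorem isAdapted_mirror_iff : IsAdapted (F →L[ℝ] ℝ) (mirror F K) ↔ IsAdapted F K := by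
  have (x : M) : T2Space (V x) := FiberBundle.t2Space F V x
  have (x : M) : FiniteDimensional ℝ (V x) := VectorBundle.finiteDimensional ℝ F V x
  have hmap (x : M) :=
    map_leftPart_eq_rightPart_iff_of_transposeMap (mirror_transposeMap (F := F) K x)
  exact ⟨fun h => ⟨isGenAlmostComplex_mirror_iff.1 h.1, fun x => (hmap x).1 (h.2 x)⟩,
    fun h => ⟨isGenAlmostComplex_mirror_iff.2 h.1, fun x => (hmap x).2 (h.2 x)⟩⟩

end MirrorStructures

section MirrorLift

variable {E : Type*} [NormedAddCommGroup E] [NormedSpace ℝ E] [FiniteDimensional ℝ E]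
  {F : Type*} [NormedAddCommGroup F] [NormedSpace ℝ F] [FiniteDimensional ℝ F]
  {M : Type*} [TopologicalSpace M] [ChartedSpace E M] [IsManifold 𝓘(ℝ, E) ∞ M]
  {V : M → Type*} [TopologicalSpace (TotalSpace F V)]
  [∀ x, AddCommGroup (V x)] [∀ x, Module ℝ (V x)] [∀ x, TopologicalSpace (V x)]
  [∀ x, IsTopologicalAddGroup (V x)] [∀ x, ContinuousSMul ℝ (V x)]
  [FiberBundle F V] [VectorBundle ℝ F V] [ContMDiffVectorBundle ∞ F V 𝓘(ℝ, E)]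
  (cov : CovariantDerivative 𝓘(ℝ, E) F V)
  {K K₁ : ∀ x : M, Gen (V x × TangentSpace 𝓘(ℝ, E) x) →ₗ[ℝ] Gen (V x × TangentSpace 𝓘(ℝ, E) x)}

theorem lift_injective : Function.Injective (lift cov) := by
  intro K K₁ h
  funext x
  let p : TotalSpace F V := ⟨x, 0⟩
  refine LinearMap.ext ((genMap (splitEquiv cov p)).surjective.forall.2 fun u => ?_)
  have hK := genMap_splitEquiv_lift cov (K := K) p u
  rw [h] at hK
  exact hK.symm.trans (genMap_splitEquiv_lift cov p u)

theorem commutes_lift_iff :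
    Commutes (𝓘(ℝ, E).prod 𝓘(ℝ, F)) (lift cov K) (lift cov K₁) ↔
      ∀ x z, K x (K₁ x z) = K₁ x (K x z) := by
  have hiff (p : TotalSpace F V) (u : GenTangent (𝓘(ℝ, E).prod 𝓘(ℝ, F)) p) :
      lift cov K p (lift cov K₁ p u) = lift cov K₁ p (lift cov K p u) ↔
        K p.proj (K₁ p.proj (genMap (splitEquiv cov p) u)) =
          K₁ p.proj (K p.proj (genMap (splitEquiv cov p) u)) := by
    rw [← (genMap (splitEquiv cov p)).injective.eq_iff]
    simp only [genMap_splitEquiv_lift]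
  exact ⟨fun h x => (genMap (splitEquiv cov ⟨x, 0⟩)).surjective.forall.2 fun u =>
    (hiff ⟨x, 0⟩ u).1 (h _ u), fun h p u => (hiff p u).2 (h _ _)⟩

theorem positiveProduct_lift_iff (σ : ℤˣ) :
    PositiveProduct (𝓘(ℝ, E).prod 𝓘(ℝ, F)) σ (lift cov K) (lift cov K₁) ↔
      ∀ x z, z ≠ 0 → 0 < ((σ : ℤ) : ℝ) * pairing (-(K x (K₁ x z))) z := by
  have hpair (p : TotalSpace F V) (u : GenTangent (𝓘(ℝ, E).prod 𝓘(ℝ, F)) p) :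
      pairing (-(lift cov K p (lift cov K₁ p u))) u =
      pairing (-(K p.proj (K₁ p.proj (genMap (splitEquiv cov p) u))))
        (genMap (splitEquiv cov p) u) := by
    rw [← pairing_genMap (splitEquiv cov p), map_neg, genMap_splitEquiv_lift,
      genMap_splitEquiv_lift]
  have hne (p : TotalSpace F V) (u : GenTangent (𝓘(ℝ, E).prod 𝓘(ℝ, F)) p) :
      genMap (splitEquiv cov p) u ≠ 0 ↔ u ≠ 0 := (genMap (splitEquiv cov p)).map_ne_zero_iff
  refine ⟨fun h x => (genMap (splitEquiv cov ⟨x, 0⟩)).surjective.forall.2 fun u hu => ?_,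
    fun h p u hu => ?_⟩
  · rw [← hpair ⟨x, 0⟩]
    exact h _ u ((hne _ u).1 hu)
  · rw [hpair]
    exact h _ _ ((hne p u).2 hu)

theorem commutes_lift_mirror_iff :
    Commutes (𝓘(ℝ, E).prod 𝓘(ℝ, F →L[ℝ] ℝ)) (lift (dualConn cov) (mirror F K))
        (lift (dualConn cov) (mirror F K₁)) ↔
      Commutes (𝓘(ℝ, E).prod 𝓘(ℝ, F)) (lift cov K) (lift cov K₁) := by
  rw [commutes_lift_iff, commutes_lift_iff]
  refine forall_congr' fun x => ?_
  obtain ⟨hinj, hsurj⟩ :=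
    transposeMap_fiber_bijective F (V := V) (t := TangentSpace 𝓘(ℝ, E) x) x
  rw [hsurj.forall]
  simp only [mirror_transposeMap, hinj.eq_iff]

theorem positiveProduct_lift_mirror_iff (σ : ℤˣ) :
    PositiveProduct (𝓘(ℝ, E).prod 𝓘(ℝ, F →L[ℝ] ℝ)) σ (lift (dualConn cov) (mirror F K))
        (lift (dualConn cov) (mirror F K₁)) ↔
      PositiveProduct (𝓘(ℝ, E).prod 𝓘(ℝ, F)) σ (lift cov K) (lift cov K₁) := by
  rw [positiveProduct_lift_iff, positiveProduct_lift_iff]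
  refine forall_congr' fun x => ?_
  obtain ⟨hinj, hsurj⟩ :=
    transposeMap_fiber_bijective F (V := V) (t := TangentSpace 𝓘(ℝ, E) x) x
  have hne (z : Gen (V x × TangentSpace 𝓘(ℝ, E) x)) : transposeMap z ≠ 0 ↔ z ≠ 0 :=
    (map_ne_zero_iff transposeMap hinj)
  rw [hsurj.forall]
  simp only [hne, mirror_transposeMap, ← transposeMap_neg, pairing_transposeMap]

theorem baseNijenhuisFormAt_mirror
    (hK : IsGenAlmostComplex (W := V ×ᵇ (TangentSpace 𝓘(ℝ, E) : M → Type _)) 𝓘(ℝ, E) (F × E) K)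
    (x₀ : M) (a b c : Gen (F × E)) :
    baseNijenhuisFormAt (dualConn cov) (mirror F K) x₀ (transposeMap a) (transposeMap b)
      (transposeMap c) = baseNijenhuisFormAt cov K x₀ a b c := by
  have hend (z : Gen (F × E)) :
      baseEndInChart (F →L[ℝ] ℝ) (mirror F K) x₀ (extChartAt 𝓘(ℝ, E) x₀ x₀) (transposeMap z) =
        transposeMap (baseEndInChart F K x₀ (extChartAt 𝓘(ℝ, E) x₀ x₀) z) := by
    rw [baseEndInChart_self, baseEndInChart_self]
    exact coordEnd_mirror_transposeMap (mem_baseSet_trivializationAt (F × E)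
      (V ×ᵇ (TangentSpace 𝓘(ℝ, E) : M → Type _)) x₀) z
  exact baseNijenhuisForm_transposeMap (connChart_dualConn_eventually cov x₀).self_of_nhds
    (k' := (baseEndInChart (F →L[ℝ] ℝ) (mirror F K) x₀
      (extChartAt 𝓘(ℝ, E) x₀ x₀)).toLinearMap) hend
    (fderiv_baseEndInChart_mirror (differentiableAt_baseEndInChart hK x₀)
      (differentiableAt_baseEndInChart (isGenAlmostComplex_mirror_iff.2 hK) x₀)) a b c

theorem integrable_lift_mirror_iff
    (hA : ∀ x₀, ContMDiffAt 𝓘(ℝ, E) 𝓘(ℝ, E →L[ℝ] F →L[ℝ] F) ∞ (connForm cov x₀) x₀)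
    (hflat : IsFlat cov)
    (hK : IsGenAlmostComplex (W := V ×ᵇ (TangentSpace 𝓘(ℝ, E) : M → Type _)) 𝓘(ℝ, E) (F × E) K) :
    Integrable (𝓘(ℝ, E).prod 𝓘(ℝ, F →L[ℝ] ℝ)) (lift (dualConn cov) (mirror F K)) ↔
      Integrable (𝓘(ℝ, E).prod 𝓘(ℝ, F)) (lift cov K) := by
  have hsurj := (transposeMap_bijective (v := F) (t := E)).2
  rw [integrable_lift_iff cov hA hflat hK, integrable_lift_iff (dualConn cov)
    (fun x₀ => contMDiffAt_connForm_dualConn cov (hA x₀)) (isFlat_dualConn cov hA hflat)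
    (isGenAlmostComplex_mirror_iff.2 hK)]
  simp only [hsurj.forall, baseNijenhuisFormAt_mirror cov hK]

end MirrorLift

section Correspondence

variable {E : Type*} [NormedAddCommGroup E] [NormedSpace ℝ E] [FiniteDimensional ℝ E]
  {F : Type*} [NormedAddCommGroup F] [NormedSpace ℝ F] [FiniteDimensional ℝ F]
  {M : Type*} [TopologicalSpace M] [ChartedSpace E M] [IsManifold 𝓘(ℝ, E) ∞ M]
  {V : M → Type*} [TopologicalSpace (TotalSpace F V)]
  [∀ x, AddCommGroup (V x)] [∀ x, Module ℝ (V x)] [∀ x, TopologicalSpace (V x)]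
  [∀ x, IsTopologicalAddGroup (V x)] [∀ x, ContinuousSMul ℝ (V x)]
  [FiberBundle F V] [VectorBundle ℝ F V] [ContMDiffVectorBundle ∞ F V 𝓘(ℝ, E)]

/-- The fibrewise dual, as a bijection between the adapted structures on `V ⊕ T_M` and those on
`V^∨ ⊕ T_M`. -/
def mirrorEquiv :
    {K : ∀ x : M, Gen (V x × TangentSpace 𝓘(ℝ, E) x) →ₗ[ℝ] Gen (V x × TangentSpace 𝓘(ℝ, E) x) //
      IsAdapted F K} ≃
    {K : ∀ x : M, Gen (DualBundle V x × TangentSpace 𝓘(ℝ, E) x) →ₗ[ℝ]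
      Gen (DualBundle V x × TangentSpace 𝓘(ℝ, E) x) // IsAdapted (F →L[ℝ] ℝ) K} :=
  (Equiv.ofBijective (mirror F) mirror_bijective).subtypeEquiv fun _ => isAdapted_mirror_iff.symm

variable {cov : CovariantDerivative 𝓘(ℝ, E) F V}
  (hA : ∀ x₀, ContMDiffAt 𝓘(ℝ, E) 𝓘(ℝ, E →L[ℝ] F →L[ℝ] F) ∞ (connForm cov x₀) x₀)
  (hflat : IsFlat cov)

/-- The lift to the total space, as a bijection from the adapted structures on `V ⊕ T_M` to the
semi-flat structures. -/
def liftEquiv :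
    {K : ∀ x : M, Gen (V x × TangentSpace 𝓘(ℝ, E) x) →ₗ[ℝ] Gen (V x × TangentSpace 𝓘(ℝ, E) x) //
      IsAdapted F K} ≃ SemiFlat cov :=
  Equiv.ofBijective
    (fun K => ⟨lift cov K.1, hflat, lift_isGenAlmostComplex cov hA K.2.isGenAlmostComplex,
      K.1, K.2, rfl⟩)
    ⟨fun _ _ h => Subtype.ext (lift_injective cov (congrArg Subtype.val h)), fun J =>
      let ⟨K, hK, hJ⟩ := J.2.exists_lift
      ⟨⟨K, hK⟩, Subtype.ext hJ.symm⟩⟩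

/-- The mirror correspondence: the bijection between the semi-flat structures on `tot V` and those
on `tot V^∨` that takes the fibrewise dual of the underlying adapted structures. -/
def semiFlatMirrorEquiv : SemiFlat cov ≃ SemiFlat (dualConn cov) :=
  (liftEquiv hA hflat).symm.trans (mirrorEquiv.trans (liftEquiv
    (fun x₀ => contMDiffAt_connForm_dualConn cov (hA x₀)) (isFlat_dualConn cov hA hflat)))

theorem semiFlatMirrorEquiv_val_of_eq_lift {J : SemiFlat cov}
    {K : ∀ x : M, Gen (V x × TangentSpace 𝓘(ℝ, E) x) →ₗ[ℝ] Gen (V x × TangentSpace 𝓘(ℝ, E) x)}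
    (hJ : J.1 = lift cov K) :
    (semiFlatMirrorEquiv hA hflat J).1 = lift (dualConn cov) (mirror F K) := by
  have hK : ((liftEquiv hA hflat).symm J).1 = K := by
    refine lift_injective cov (Eq.trans ?_ hJ)
    exact congrArg Subtype.val ((liftEquiv hA hflat).apply_symm_apply J)
  exact congrArg (fun K => lift (dualConn cov) (mirror F K)) hK

theorem integrable_semiFlatMirrorEquiv_iff (J : SemiFlat cov) :
    Integrable (𝓘(ℝ, E).prod 𝓘(ℝ, F →L[ℝ] ℝ)) (semiFlatMirrorEquiv hA hflat J).1 ↔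
      Integrable (𝓘(ℝ, E).prod 𝓘(ℝ, F)) J.1 := by
  obtain ⟨K, hK, hJ⟩ := J.2.exists_lift
  rw [semiFlatMirrorEquiv_val_of_eq_lift hA hflat hJ, hJ]
  exact integrable_lift_mirror_iff cov hA hflat hK.isGenAlmostComplex

theorem commutes_semiFlatMirrorEquiv_iff (J J' : SemiFlat cov) :
    Commutes (𝓘(ℝ, E).prod 𝓘(ℝ, F →L[ℝ] ℝ)) (semiFlatMirrorEquiv hA hflat J).1
        (semiFlatMirrorEquiv hA hflat J').1 ↔
      Commutes (𝓘(ℝ, E).prod 𝓘(ℝ, F)) J.1 J'.1 := by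
  obtain ⟨K, -, hJ⟩ := J.2.exists_lift
  obtain ⟨K', -, hJ'⟩ := J'.2.exists_lift
  rw [semiFlatMirrorEquiv_val_of_eq_lift hA hflat hJ,
    semiFlatMirrorEquiv_val_of_eq_lift hA hflat hJ', hJ, hJ']
  exact commutes_lift_mirror_iff cov

theorem positiveProduct_semiFlatMirrorEquiv_iff (σ : ℤˣ) (J J' : SemiFlat cov) :
    PositiveProduct (𝓘(ℝ, E).prod 𝓘(ℝ, F →L[ℝ] ℝ)) σ (semiFlatMirrorEquiv hA hflat J).1
        (semiFlatMirrorEquiv hA hflat J').1 ↔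
      PositiveProduct (𝓘(ℝ, E).prod 𝓘(ℝ, F)) σ J.1 J'.1 := by
  obtain ⟨K, -, hJ⟩ := J.2.exists_lift
  obtain ⟨K', -, hJ'⟩ := J'.2.exists_lift
  rw [semiFlatMirrorEquiv_val_of_eq_lift hA hflat hJ,
    semiFlatMirrorEquiv_val_of_eq_lift hA hflat hJ', hJ, hJ']
  exact positiveProduct_lift_mirror_iff cov σ

theorem isGenKahler_semiFlat_iff {σ : ℤˣ} {J J' : SemiFlat cov} :
    IsGenKahler (𝓘(ℝ, E).prod 𝓘(ℝ, F)) σ J.1 J'.1 ↔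
      Commutes (𝓘(ℝ, E).prod 𝓘(ℝ, F)) J.1 J'.1 ∧
        PositiveProduct (𝓘(ℝ, E).prod 𝓘(ℝ, F)) σ J.1 J'.1 ∧
        Integrable (𝓘(ℝ, E).prod 𝓘(ℝ, F)) J.1 ∧ Integrable (𝓘(ℝ, E).prod 𝓘(ℝ, F)) J'.1 :=
  ⟨fun h => ⟨h.commutes, h.positive, h.integrable_left, h.integrable_right⟩,
    fun ⟨hcomm, hpos, hJ, hJ'⟩ =>
      ⟨J.2.isGenAlmostComplex, J'.2.isGenAlmostComplex, hcomm, hpos, hJ, hJ'⟩⟩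

/-- The mirror correspondence on pairs, as a bijection between the semi-flat generalized Kähler
structures on `tot V` and those on `tot V^∨`. -/
def semiFlatKahlerMirrorEquiv (σ : ℤˣ) : SemiFlatKahler σ cov ≃ SemiFlatKahler σ (dualConn cov) :=
  ((semiFlatMirrorEquiv hA hflat).prodCongr (semiFlatMirrorEquiv hA hflat)).subtypeEquiv fun P => by
    rw [isGenKahler_semiFlat_iff, ← commutes_semiFlatMirrorEquiv_iff hA hflat,
      ← positiveProduct_semiFlatMirrorEquiv_iff hA hflat,
      ← integrable_semiFlatMirrorEquiv_iff hA hflat P.1,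
      ← integrable_semiFlatMirrorEquiv_iff hA hflat P.2]
    exact isGenKahler_semiFlat_iff.symm

end Correspondence

end GenGeom

end

theorem mainTheorem5
    {E : Type*} [NormedAddCommGroup E] [NormedSpace ℝ E] [FiniteDimensional ℝ E]
    {F : Type*} [NormedAddCommGroup F] [NormedSpace ℝ F] [FiniteDimensional ℝ F]
    {M : Type*} [TopologicalSpace M] [T2Space M] [ChartedSpace E M] [IsManifold 𝓘(ℝ, E) ∞ M]
    {V : M → Type*} [TopologicalSpace (TotalSpace F V)]
    [∀ x, AddCommGroup (V x)] [∀ x, Module ℝ (V x)] [∀ x, TopologicalSpace (V x)]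
    [∀ x, IsTopologicalAddGroup (V x)] [∀ x, ContinuousSMul ℝ (V x)]
    [FiberBundle F V] [VectorBundle ℝ F V] [ContMDiffVectorBundle ∞ F V 𝓘(ℝ, E)]
    (hrank : Module.finrank ℝ F = Module.finrank ℝ E)
    (cov : CovariantDerivative 𝓘(ℝ, E) F V)
    (hsmooth : CovariantDerivative.ContMDiffCovariantDerivative cov ∞)
    (hflat : GenGeom.IsFlat cov) :
    ∃ Φ : GenGeom.SemiFlat cov ≃ GenGeom.SemiFlat (GenGeom.dualConn cov),
      -- the lift of `K` is sent to the lift of the fibrewise dual of `K`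
      (∀ K, GenGeom.IsAdapted F K → GenGeom.IsAdapted (F →L[ℝ] ℝ) (GenGeom.mirror F K) ∧
        ∀ J : GenGeom.SemiFlat cov, J.1 = GenGeom.lift cov K →
          (Φ J).1 = GenGeom.lift (GenGeom.dualConn cov) (GenGeom.mirror F K)) ∧
      (∀ J : GenGeom.SemiFlat cov,
        GenGeom.Integrable (𝓘(ℝ, E).prod 𝓘(ℝ, F)) J.1 ↔
          GenGeom.Integrable (𝓘(ℝ, E).prod 𝓘(ℝ, F →L[ℝ] ℝ)) (Φ J).1) ∧
      (∀ J J' : GenGeom.SemiFlat cov,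
        GenGeom.Commutes (𝓘(ℝ, E).prod 𝓘(ℝ, F)) J.1 J'.1 ↔
          GenGeom.Commutes (𝓘(ℝ, E).prod 𝓘(ℝ, F →L[ℝ] ℝ)) (Φ J).1 (Φ J').1) ∧
      ∀ σ : ℤˣ,
        (∀ J J' : GenGeom.SemiFlat cov,
          GenGeom.PositiveProduct (𝓘(ℝ, E).prod 𝓘(ℝ, F)) σ J.1 J'.1 ↔
            GenGeom.PositiveProduct (𝓘(ℝ, E).prod 𝓘(ℝ, F →L[ℝ] ℝ)) σ (Φ J).1 (Φ J').1) ∧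
        ∃ Ψ : GenGeom.SemiFlatKahler σ cov ≃ GenGeom.SemiFlatKahler σ (GenGeom.dualConn cov),
          ∀ P, (Ψ P).1 = (Φ P.1.1, Φ P.1.2) := by
  have hA := GenGeom.contMDiffAt_connForm cov hsmooth
  exact ⟨GenGeom.semiFlatMirrorEquiv hA hflat,
    fun K hK => ⟨GenGeom.isAdapted_mirror_iff.2 hK, fun J hJ =>
      GenGeom.semiFlatMirrorEquiv_val_of_eq_lift hA hflat hJ⟩,
    fun J => (GenGeom.integrable_semiFlatMirrorEquiv_iff hA hflat J).symm,
    fun J J' => (GenGeom.commutes_semiFlatMirrorEquiv_iff hA hflat J J').symm,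
    fun σ => ⟨fun J J' => (GenGeom.positiveProduct_semiFlatMirrorEquiv_iff hA hflat σ J J').symm,
      GenGeom.semiFlatKahlerMirrorEquiv hA hflat σ, fun P => rfl⟩⟩
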